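/- Let $A(z)=\sum_{k\ge 0}\prod_{1\le j\le k}\bigl(e^{jz}-1\bigr)$, viewed as a formal power series in $z$ (the product for $k=0$ is $1$, and the $k$-th product is divisible by $z^k$, so the sum is well defined), and let $a_n=[z^n]A(z)$ be the coefficient of $z^n$ in $A(z)$. Then, as $n\to\infty$, $$a_n = c\,\rho^n\, n^{n+\frac12}\bigl(1+O(n^{-1})\bigr),\qquad c=\frac{12}{\pi^{3/2}},\quad \rho=\frac{12}{e\pi^2},$$ that is, there are a constant $C$ and an index $N\ge 1$ such that $\bigl|a_n/(c\rho^n n^{n+1/2})-1\bigr|\le C/n$ for all $n\ge N$. -/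

import Mathlib

open Filter Asymptotics
open scoped PowerSeries.WithPiTopology

namespace Fishburn

/-- The formal power series `e ^ (j z)` in the variable `z = X`. -/
noncomputable def expMul (j : ℕ) : PowerSeries ℝ :=
  PowerSeries.rescale (j : ℝ) (PowerSeries.exp ℝ)

/-- `A_k(z) = ∏_{1 ≤ j ≤ k} (e ^ (j z) - 1)`, as a formal power series. -/
noncomputable def term (k : ℕ) : PowerSeries ℝ :=
  ∏ j ∈ Finset.Icc 1 k, (expMul j - 1)

/-- `A(z) = ∑_{k ≥ 0} A_k(z)`, the sum of the formal power series in the topology of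
coefficientwise convergence. The sum converges by `hasSum_gf`. -/
noncomputable def gf : PowerSeries ℝ :=
  ∑' k : ℕ, term k

/-- `a_n = [z^n] A(z)`. -/
noncomputable def a (n : ℕ) : ℝ :=
  PowerSeries.coeff n gf

theorem coeff_expMul (j m : ℕ) :
    PowerSeries.coeff m (expMul j) = (j : ℝ) ^ m / (m.factorial : ℝ) := by
  simp [expMul, PowerSeries.coeff_rescale, PowerSeries.coeff_exp, div_eq_mul_inv]

theorem X_pow_dvd_term (k : ℕ) : (PowerSeries.X : PowerSeries ℝ) ^ k ∣ term k := by
  have h : ∏ _j ∈ Finset.Icc 1 k, (PowerSeries.X : PowerSeries ℝ) ∣ term k := by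
    refine Finset.prod_dvd_prod_of_dvd _ _ fun j _ => ?_
    rw [PowerSeries.X_dvd_iff, map_sub, ← PowerSeries.coeff_zero_eq_constantCoeff_apply,
      coeff_expMul]
    simp
  simpa using h

/-- Only the terms with `k ≤ n` contribute to the coefficient of `z^n`. -/
theorem coeff_term_eq_zero {n k : ℕ} (h : n < k) : PowerSeries.coeff n (term k) = 0 :=
  PowerSeries.X_pow_dvd_iff.1 (X_pow_dvd_term k) n h

theorem hasSum_gf : HasSum term gf := by
  have h : HasSum term
      (PowerSeries.mk fun n => ∑ k ∈ Finset.range (n + 1), PowerSeries.coeff n (term k)) := by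
    rw [PowerSeries.WithPiTopology.hasSum_iff_hasSum_coeff]
    intro n
    rw [PowerSeries.coeff_mk]
    refine hasSum_sum_of_ne_finset_zero (f := fun k => PowerSeries.coeff n (term k))
      fun k hk => coeff_term_eq_zero ?_
    rw [Finset.mem_range] at hk
    omega
  exact h.summable.hasSum

end Fishburn

/-! Put `q = exp (-t)`. At `z = -t` the `k`-th product is `(-1)^k (q; q)_k`. The alternating series
of these diverges, but the sum of two consecutive partial sums converges, to Ramanujan's function
`σ(q) = 1 + ∑ (-1)^n q^(n+1) (q; q)_n`. Since `(q; q)_K ≤ K! t^K`, `σ(exp (-t))` has the asymptotic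
expansion `2 A(-t)` at `0⁺` (`hasExpansion_sigmaSeries`). Expansions are unique, so it suffices to
expand `σ` in another way and read off the coefficients.

The other way is the theorem of Andrews, Dyson and Hickerson. One has `σ(q) = ∑ q^(n(n+1)/2) / (-q;
q)_n`; a Bailey pair turns this into an indefinite theta series (`sigmaSeries_eq_tsum_thetaTerm`),
and after multiplication by `q^(1/24)` into a sum over a full lattice quadrant: `∑ χ(y - x) q^((x² +
10xy + y²)/24)` over `x ≥ 0`, `y ≥ 1`, with `χ` the even character mod 12 (`sigmaSeries_exp`).

Now `χ` is a combination of the exponentials `exp (iθd)` with `θ = ±π/6, ±5π/6`, so the sum splits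
into double sums of `w₁^j w₂^m` times a smooth function, with `|w₁| = |w₂| = 1` and both different
from 1. Repeated summation by parts replaces each by a finite combination of exponentials in `t`, up
to `O(t^K)`; its Taylor coefficients are the regularized moments `∑ w^j j^a` inserted into the
powers of the quadratic form (`hasExpansion_coneSum`).

The moments of `w = exp (-s)` have generating function `1/(1 - exp (-(x+s)))`, whose pole at `x =
-s` gives `a! s^(-a-1)`; the rest is holomorphic in a larger disc (`exists_abelMoment_sub_le`). By
the beta integral the main moments combine to `(2N+1)! ∫ (1 - 12p(1-p))^N dp` over `[0, 1]`, where
`p = 1/2` dominates with value `(-2)^N`. The angles `±π/6` therefore contribute `12√2/π² · (-1)^N N!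
(12/π²)^N`, and everything else is smaller by a factor of about `(4/5)^N`
(`exists_norm_sigmaCoeff_sub_le`). Multiplying back by `exp (t/24)` costs a relative `O(1/n)`, and
Stirling's formula with its `1/n` error finishes the proof. -/

namespace Fishburn
open Topology

/-! ### Asymptotic expansions at `0⁺` -/

/-- `φ` is the asymptotic expansion of `f` at `0⁺`. -/
def HasExpansion (f : ℝ → ℂ) (φ : PowerSeries ℂ) : Prop :=
  ∀ K : ℕ, (fun t : ℝ => f t - (PowerSeries.trunc K φ).eval (t : ℂ)) =O[𝓝[>] 0] fun t : ℝ => t ^ K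

theorem eval_isBigO_one (p : Polynomial ℂ) :
    (fun t : ℝ => p.eval (t : ℂ)) =O[𝓝[>] 0] fun _ : ℝ => (1 : ℝ) := by
  have h : ContinuousAt (fun t : ℝ => p.eval (t : ℂ)) 0 :=
    (p.continuous.comp Complex.continuous_ofReal).continuousAt
  exact (h.tendsto.mono_left nhdsWithin_le_nhds).isBigO_one ℝ

theorem eval_isBigO_pow {p : Polynomial ℂ} {K : ℕ} (h : ∀ i < K, p.coeff i = 0) :
    (fun t : ℝ => p.eval (t : ℂ)) =O[𝓝[>] 0] fun t : ℝ => t ^ K := by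
  obtain ⟨r, rfl⟩ := Polynomial.X_pow_dvd_iff.2 h
  have h1 : (fun t : ℝ => (t : ℂ) ^ K) =O[𝓝[>] 0] fun t : ℝ => t ^ K :=
    IsBigO.of_bound 1 (Eventually.of_forall fun t => by simp)
  simpa using h1.mul (eval_isBigO_one r)

theorem pow_isBigO_pow {m n : ℕ} (h : m ≤ n) :
    (fun t : ℝ => t ^ n) =O[𝓝[>] 0] fun t : ℝ => t ^ m := by
  refine IsBigO.of_bound 1 ?_
  filter_upwards [Ioo_mem_nhdsGT (zero_lt_one' ℝ)] with t ht
  rw [one_mul, Real.norm_of_nonneg (pow_nonneg ht.1.le _), Real.norm_of_nonneg (pow_nonneg ht.1.le _)]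
  exact pow_le_pow_of_le_one ht.1.le ht.2.le h

/-! ### Arithmetic and uniqueness of asymptotic expansions. -/

namespace HasExpansion

variable {f g : ℝ → ℂ} {φ ψ : PowerSeries ℂ}

/-- Polynomials agreeing below degree `K` differ by `O(t^K)`. Hence any convenient polynomial may
replace the truncation, and truncations of sums and products need not be computed. -/
theorem of_eval {K : ℕ} {p : Polynomial ℂ}
    (h : (fun t : ℝ => f t - p.eval (t : ℂ)) =O[𝓝[>] 0] fun t : ℝ => t ^ K)
    (hp : ∀ i < K, p.coeff i = PowerSeries.coeff i φ) :
    (fun t : ℝ => f t - (PowerSeries.trunc K φ).eval (t : ℂ)) =O[𝓝[>] 0] fun t : ℝ => t ^ K := by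
  have h2 := eval_isBigO_pow (p := p - PowerSeries.trunc K φ) (K := K) fun i hi => by
    rw [Polynomial.coeff_sub, PowerSeries.coeff_trunc, if_pos hi, hp i hi, sub_self]
  simpa using h.add h2

theorem add (hf : HasExpansion f φ) (hg : HasExpansion g ψ) :
    HasExpansion (fun t => f t + g t) (φ + ψ) := fun K =>
  of_eval (p := PowerSeries.trunc K φ + PowerSeries.trunc K ψ)
    (((hf K).add (hg K)).congr_left fun t => by simp; ring) fun i hi => by
      simp [PowerSeries.coeff_trunc, hi]

theorem isBigO_one (hf : HasExpansion f φ) : f =O[𝓝[>] 0] fun _ : ℝ => (1 : ℝ) := by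
  refine (hf 0).congr (fun t => ?_) fun t => pow_zero t
  simp

theorem mul (hf : HasExpansion f φ) (hg : HasExpansion g ψ) :
    HasExpansion (fun t => f t * g t) (φ * ψ) := fun K => by
  refine of_eval (p := PowerSeries.trunc K φ * PowerSeries.trunc K ψ) ?_ fun i hi => ?_
  · have h1 := (hf K).mul hg.isBigO_one
    have h2 := (eval_isBigO_one (PowerSeries.trunc K φ)).mul (hg K)
    refine ((h1.congr_right fun t => mul_one _).add (h2.congr_right fun t => one_mul _)).congr_left
      fun t => ?_
    simp only [Polynomial.eval_mul]
    ring
  · rw [PowerSeries.coeff_mul_eq_coeff_trunc_mul_trunc _ _ hi, ← Polynomial.coe_mul,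
      Polynomial.coeff_coe]

theorem const (c : ℂ) : HasExpansion (fun _ => c) (PowerSeries.C c) := fun K =>
  of_eval (p := Polynomial.C c) (by simpa using isBigO_zero _ _) fun i hi => by
    rw [PowerSeries.coeff_C, Polynomial.coeff_C]

theorem const_mul (c : ℂ) (hf : HasExpansion f φ) :
    HasExpansion (fun t => c * f t) (PowerSeries.C c * φ) := (const c).mul hf

theorem sum {ι : Type*} (s : Finset ι) {f : ι → ℝ → ℂ} {φ : ι → PowerSeries ℂ}
    (h : ∀ i ∈ s, HasExpansion (f i) (φ i)) :
    HasExpansion (fun t => ∑ i ∈ s, f i t) (∑ i ∈ s, φ i) := by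
  classical
  induction s using Finset.induction_on with
  | empty => simpa using const 0
  | insert i s hi ih =>
    simp only [Finset.sum_insert hi]
    exact (h i (by simp)).add (ih fun j hj => h j (by simp [hj]))

theorem prod {ι : Type*} (s : Finset ι) {f : ι → ℝ → ℂ} {φ : ι → PowerSeries ℂ}
    (h : ∀ i ∈ s, HasExpansion (f i) (φ i)) :
    HasExpansion (fun t => ∏ i ∈ s, f i t) (∏ i ∈ s, φ i) := by
  classical
  induction s using Finset.induction_on with
  | empty => simpa using const 1
  | insert i s hi ih =>
    simp only [Finset.prod_insert hi]
    exact (h i (by simp)).mul (ih fun j hj => h j (by simp [hj]))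

theorem exp (c : ℂ) :
    HasExpansion (fun t => Complex.exp (c * t)) (PowerSeries.rescale c (PowerSeries.exp ℂ)) := by
  intro K
  rcases Nat.eq_zero_or_pos K with rfl | hK
  · have h : ContinuousAt (fun t : ℝ => Complex.exp (c * t)) 0 := by fun_prop
    simpa using (h.tendsto.mono_left nhdsWithin_le_nhds).isBigO_one ℝ
  · refine of_eval (p := ∑ i ∈ Finset.range K, Polynomial.monomial i (c ^ i / (i.factorial : ℂ)))
      ?_ fun i hi => ?_
    · have hc : Tendsto (fun t : ℝ => c * (t : ℂ)) (𝓝[>] 0) (𝓝 0) := by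
        have h : ContinuousAt (fun t : ℝ => c * (t : ℂ)) 0 := by fun_prop
        simpa using h.tendsto.mono_left nhdsWithin_le_nhds
      have hb : ∀ᶠ t : ℝ in 𝓝[>] 0, ‖c * (t : ℂ)‖ ≤ 1 := by
        have := (hc.norm).eventually_le_const (u := 1) (by simp)
        simpa using this
      refine IsBigO.of_bound (‖c‖ ^ K * ((K.succ : ℝ) * ((K.factorial : ℝ) * K)⁻¹)) ?_
      filter_upwards [hb] with t ht
      have := Complex.exp_bound ht hK
      simp only [Polynomial.eval_finsetSum, Polynomial.eval_monomial]
      rw [show (∑ i ∈ Finset.range K, c ^ i / (i.factorial : ℂ) * (t : ℂ) ^ i)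
        = ∑ m ∈ Finset.range K, (c * t) ^ m / (m.factorial : ℂ) from
          Finset.sum_congr rfl fun i _ => by rw [mul_pow]; ring]
      refine this.trans (le_of_eq ?_)
      rw [norm_mul, mul_pow, norm_pow, Complex.norm_real]
      ring
    · simp [Polynomial.coeff_monomial, hi, PowerSeries.coeff_rescale, PowerSeries.coeff_exp,
        div_eq_mul_inv]

/-- Uniqueness up to order `K`: the difference of the truncations is a polynomial of size `O(t^K)`,
and its lowest nonzero term would dominate it near `0`. -/
theorem of_isBigO (h : HasExpansion f φ) {K : ℕ}
    (hg : (fun t => g t - f t) =O[𝓝[>] 0] fun t : ℝ => t ^ K) {i : ℕ} (hi : i < K)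
    (hψ : HasExpansion g ψ) : PowerSeries.coeff i ψ = PowerSeries.coeff i φ := by
  set p := PowerSeries.trunc K ψ - PowerSeries.trunc K φ with hp
  have h1 : (fun t : ℝ => p.eval (t : ℂ)) =O[𝓝[>] 0] fun t : ℝ => t ^ K := by
    refine ((hg.add (h K)).sub (hψ K)).congr_left fun t => ?_
    simp only [hp, Polynomial.eval_sub]
    ring
  have hc : ∀ i < K, p.coeff i = 0 := by
    intro i
    induction i using Nat.strong_induction_on with
    | _ i ih =>
      intro hi
      -- The lower coefficients vanish, so `p = X^i r`; dividing the bound by `t^i` gives `r =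
      -- O(t)`, whence `r(0) = 0`.
      obtain ⟨r, hr⟩ := Polynomial.X_pow_dvd_iff.2 fun d hd => ih d hd (hd.trans hi)
      have h2 : (fun t : ℝ => r.eval (t : ℂ)) =O[𝓝[>] 0] fun t : ℝ => t ^ 1 := by
        have h3 := (h1.trans (pow_isBigO_pow (Nat.succ_le_of_lt hi))).bound
        obtain ⟨C, hC⟩ := h3
        refine IsBigO.of_bound C ?_
        filter_upwards [hC, self_mem_nhdsWithin] with t ht ht0
        have ht0 : 0 < t := ht0
        rw [hr] at ht
        simp only [Polynomial.eval_mul, Polynomial.eval_pow, Polynomial.eval_X, norm_mul, norm_pow,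
          Complex.norm_real, pow_succ] at ht
        have : 0 < ‖t‖ ^ i := pow_pos (norm_pos_iff.2 ht0.ne') _
        rw [pow_one]
        refine le_of_mul_le_mul_left ?_ this
        linarith
      have h4 : Tendsto (fun t : ℝ => r.eval (t : ℂ)) (𝓝[>] 0) (𝓝 0) := by
        refine h2.trans_tendsto ?_
        have : ContinuousAt (fun t : ℝ => t ^ 1) 0 := by fun_prop
        simpa using this.tendsto.mono_left nhdsWithin_le_nhds
      have h5 : Tendsto (fun t : ℝ => r.eval (t : ℂ)) (𝓝[>] 0) (𝓝 (r.eval ((0 : ℝ) : ℂ))) :=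
        ((r.continuous.comp Complex.continuous_ofReal).continuousAt (x := 0)).tendsto.mono_left
          nhdsWithin_le_nhds
      have h6 := tendsto_nhds_unique h5 h4
      have : p.coeff i = r.coeff 0 := by
        rw [hr]
        simpa using Polynomial.coeff_X_pow_mul r i 0
      rw [this, Polynomial.coeff_zero_eq_eval_zero]
      simpa using h6
  have := hc i hi
  rw [hp, Polynomial.coeff_sub, PowerSeries.coeff_trunc, PowerSeries.coeff_trunc, if_pos hi, if_pos hi]
    at this
  exact sub_eq_zero.1 this

/-- An expansion may be checked order by order, against functions with known expansions. -/
theorem of_approx (h : ∀ K : ℕ, ∃ (g : ℝ → ℂ) (ψ : PowerSeries ℂ), HasExpansion g ψ ∧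
      (fun t => f t - g t) =O[𝓝[>] 0] (fun t : ℝ => t ^ K) ∧
      ∀ i < K, PowerSeries.coeff i ψ = PowerSeries.coeff i φ) : HasExpansion f φ := fun K => by
  obtain ⟨g, ψ, hg, hfg, hc⟩ := h K
  refine of_eval (p := PowerSeries.trunc K ψ) ((hfg.add (hg K)).congr_left fun t => by ring)
    fun i hi => ?_
  rw [PowerSeries.coeff_trunc, if_pos hi, hc i hi]

theorem unique (h : HasExpansion f φ) (h' : HasExpansion f ψ) : φ = ψ := by
  ext i
  exact (of_isBigO (K := i + 1) h' (by simpa using isBigO_zero _ _) (Nat.lt_succ_self i) h)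

end HasExpansion

/-! ### A `q`-series identity -/

/-- The finite `q`-Pochhammer symbol `(q; q)_n`. -/
noncomputable def qPoch (q : ℝ) (n : ℕ) : ℝ :=
  ∏ j ∈ Finset.range n, (1 - q ^ (j + 1))

theorem qPoch_zero (q : ℝ) : qPoch q 0 = 1 := by simp [qPoch]

theorem qPoch_succ (q : ℝ) (n : ℕ) : qPoch q (n + 1) = qPoch q n * (1 - q ^ (n + 1)) := by
  simp [qPoch, Finset.prod_range_succ]

/-! ### Ramanujan's function `σ(q)` and summation formulas for `0 < q < 1`. -/

section

variable {q : ℝ}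

theorem one_sub_pow_pos (h0 : 0 < q) (h1 : q < 1) (n : ℕ) : 0 < 1 - q ^ (n + 1) :=
  sub_pos.2 (pow_lt_one₀ h0.le h1 n.succ_ne_zero)

theorem qPoch_pos (h0 : 0 < q) (h1 : q < 1) (n : ℕ) : 0 < qPoch q n :=
  Finset.prod_pos fun j _ => one_sub_pow_pos h0 h1 j

theorem qPoch_antitone (h0 : 0 < q) (h1 : q < 1) : Antitone (qPoch q) :=
  antitone_nat_of_succ_le fun n => by
    rw [qPoch_succ]
    exact mul_le_of_le_one_right (qPoch_pos h0 h1 n).le (sub_le_self _ (by positivity))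

theorem qPoch_le_one (h0 : 0 < q) (h1 : q < 1) (n : ℕ) : qPoch q n ≤ 1 :=
  (qPoch_antitone h0 h1 (Nat.zero_le n)).trans_eq (qPoch_zero q)

/-- From `log (1 - x) ≥ -x/(1 - x) ≥ -x/(1 - q)` for `x = q^(j+1)`, and the geometric series. The
uniform bound controls the denominators in all the `q`-series below. -/
theorem exists_le_qPoch (h0 : 0 < q) (h1 : q < 1) : ∃ c > 0, ∀ n, c ≤ qPoch q n := by
  have hq : 0 < 1 - q := sub_pos.2 h1
  have key : ∀ n, Real.exp (-(∑ j ∈ Finset.range n, q ^ (j + 1)) / (1 - q)) ≤ qPoch q n := by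
    intro n
    rw [qPoch, ← Finset.sum_neg_distrib, Finset.sum_div, Real.exp_sum]
    refine Finset.prod_le_prod (fun _ _ => (Real.exp_pos _).le) fun j _ => ?_
    have hj := one_sub_pow_pos h0 h1 j
    have hle : q ^ (j + 1) ≤ q := by
      simpa using pow_le_pow_of_le_one h0.le h1.le (Nat.succ_le_succ (Nat.zero_le j))
    rw [← Real.le_log_iff_exp_le hj]
    refine le_trans ?_ (Real.one_sub_inv_le_log_of_pos hj)
    have e : 1 - (1 - q ^ (j + 1))⁻¹ = -(q ^ (j + 1) / (1 - q ^ (j + 1))) := by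
      field_simp
      ring
    rw [neg_div, e]
    refine neg_le_neg (div_le_div_of_nonneg_left (by positivity) hq (by linarith))
  refine ⟨Real.exp (-(q * (1 - q)⁻¹) / (1 - q)), Real.exp_pos _, fun n => le_trans ?_ (key n)⟩
  rw [Real.exp_le_exp]
  refine div_le_div_of_nonneg_right (neg_le_neg ?_) hq.le
  have := (summable_geometric_of_lt_one h0.le h1).sum_le_tsum (Finset.range n)
    fun i _ => pow_nonneg h0.le i
  rw [tsum_geometric_of_lt_one h0.le h1] at this
  simp only [pow_succ', ← Finset.mul_sum]
  exact mul_le_mul_of_nonneg_left this h0.le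

theorem choose_two_succ (n : ℕ) : (n + 2).choose 2 = (n + 1) + (n + 1).choose 2 := by
  rw [Nat.choose_succ_succ' (n + 1) 1, Nat.choose_one_right]

theorem le_choose_two (n : ℕ) : n ≤ (n + 1).choose 2 := by
  cases n with
  | zero => simp
  | succ n => rw [choose_two_succ]; omega

/-- The series `1 + ∑ (-1)^n q^(n+1) (q; q)_n`. -/
noncomputable def sigmaSeries (q : ℝ) : ℝ :=
  1 + ∑' n : ℕ, (-1) ^ n * q ^ (n + 1) * qPoch q n

theorem summable_qPoch_mul (h0 : 0 < q) (h1 : q < 1) {y : ℝ} (hy : |y| < 1) :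
    Summable fun n => qPoch q n * y ^ n := by
  refine Summable.of_norm_bounded (summable_geometric_of_lt_one (abs_nonneg y) hy) fun n => ?_
  rw [norm_mul, norm_pow, Real.norm_eq_abs y, Real.norm_of_nonneg (qPoch_pos h0 h1 n).le]
  exact mul_le_of_le_one_left (by positivity) (qPoch_le_one h0 h1 n)

/-- The recursion `(q; q)_(n+1) = (q; q)_n (1 - q^(n+1))` becomes a functional equation relating the
arguments `y` and `yq`. -/
theorem one_sub_mul_tsum_qPoch (h0 : 0 < q) (h1 : q < 1) {y : ℝ} (hy : |y| < 1) :
    (1 - y) * ∑' n, qPoch q n * y ^ n = 1 - y * q * ∑' n, qPoch q n * (y * q) ^ n := by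
  have hyq : |y * q| < 1 := by
    rw [abs_mul, abs_of_pos h0]
    exact mul_lt_one_of_nonneg_of_lt_one_left (abs_nonneg y) hy h1.le
  have hs := summable_qPoch_mul h0 h1 hy
  have hs' := summable_qPoch_mul h0 h1 hyq
  have h : ∑' n, qPoch q n * y ^ n
      = 1 + (y * (∑' n, qPoch q n * y ^ n) - y * q * ∑' n, qPoch q n * (y * q) ^ n) := by
    conv_lhs => rw [hs.tsum_eq_zero_add]
    rw [qPoch_zero, pow_zero, one_mul, ← tsum_mul_left, ← tsum_mul_left,
      ← (hs.mul_left y).tsum_sub (hs'.mul_left (y * q))]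
    congr 1
    refine tsum_congr fun n => ?_
    rw [qPoch_succ]
    ring
  linarith

/-- The functional equation at `y = -q^(k+1)` is a first-order recursion in `k`. Iterating it from
`k = 0` splits off the stated terms one at a time, with a remainder tending to `0`. -/
theorem hasSum_sigmaSeries (h0 : 0 < q) (h1 : q < 1) :
    HasSum (fun n : ℕ => q ^ (n + 1).choose 2 / ∏ j ∈ Finset.range n, (1 + q ^ (j + 1)))
      (sigmaSeries q) := by
  set P : ℕ → ℝ := fun n => q ^ (n + 1).choose 2 / ∏ j ∈ Finset.range n, (1 + q ^ (j + 1)) with hP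
  set f : ℕ → ℝ := fun k => ∑' n, qPoch q n * (-q ^ (k + 1)) ^ n with hf
  have hd : ∀ n, 0 < ∏ j ∈ Finset.range n, (1 + q ^ (j + 1)) := fun n =>
    Finset.prod_pos fun j _ => by positivity
  have hy : ∀ k, |(-q ^ (k + 1))| < 1 := fun k => by
    rw [abs_neg, abs_of_pos (pow_pos h0 _)]
    exact pow_lt_one₀ h0.le h1 k.succ_ne_zero
  have hrec : ∀ k, (1 + q ^ (k + 1)) * f k = 1 + q ^ (k + 2) * f (k + 1) := fun k => by
    have := one_sub_mul_tsum_qPoch h0 h1 (hy k)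
    have e : -q ^ (k + 1) * q = -q ^ (k + 1 + 1) := by ring
    rw [e] at this
    simp only [hf]
    linarith
  have hF : sigmaSeries q = 1 + q * f 0 := by
    simp only [sigmaSeries, hf]
    rw [← tsum_mul_left]
    congr 1
    refine tsum_congr fun n => ?_
    rw [neg_pow (q ^ (0 + 1))]
    ring
  have hPs : ∀ k, P (k + 1) * (1 + q ^ (k + 1)) = P k * q ^ (k + 1) := fun k => by
    have := (hd k).ne'
    have h2 : (1 + q ^ (k + 1)) ≠ 0 := by positivity
    simp only [hP]
    rw [Finset.prod_range_succ, choose_two_succ, pow_add]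
    field_simp
  have hpart : ∀ N, sigmaSeries q = ∑ n ∈ Finset.range (N + 1), P n
      + P (N + 1) * (1 + q ^ (N + 1)) * f N := by
    intro N
    induction N with
    | zero => rw [hF, hPs]; simp [hP]
    | succ N ih =>
      rw [ih, Finset.sum_range_succ _ (N + 1), mul_assoc, hrec, hPs (N + 1)]
      ring
  have hP0 : ∀ n, 0 ≤ P n := fun n => div_nonneg (by positivity) (hd n).le
  have hPle : ∀ n, P n ≤ q ^ n := fun n => by
    refine (div_le_self (by positivity) ?_).trans
      (pow_le_pow_of_le_one h0.le h1.le (le_choose_two n))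
    calc (1 : ℝ) = ∏ _j ∈ Finset.range n, 1 := by simp
      _ ≤ _ := Finset.prod_le_prod (fun _ _ => zero_le_one' ℝ)
        fun j _ => le_add_of_nonneg_right (by positivity)
  have hPsum : Summable P :=
    Summable.of_nonneg_of_le hP0 hPle (summable_geometric_of_lt_one h0.le h1)
  have hfb : ∀ k, |f k| ≤ (1 - q)⁻¹ := fun k => by
    rw [← tsum_geometric_of_lt_one h0.le h1, ← Real.norm_eq_abs]
    refine tsum_of_norm_bounded (summable_geometric_of_lt_one h0.le h1).hasSum fun n => ?_
    rw [norm_mul, Real.norm_of_nonneg (qPoch_pos h0 h1 n).le, norm_pow, norm_neg, norm_pow,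
      Real.norm_of_nonneg h0.le]
    refine (mul_le_of_le_one_left (by positivity) (qPoch_le_one h0 h1 n)).trans ?_
    refine pow_le_pow_left₀ (by positivity) ?_ n
    simpa using pow_le_pow_of_le_one h0.le h1.le (Nat.succ_le_succ (Nat.zero_le k))
  have hlim : Tendsto (fun N => ∑ n ∈ Finset.range (N + 1), P n) atTop (𝓝 (sigmaSeries q)) := by
    have hz : Tendsto (fun N => P (N + 1) * (1 + q ^ (N + 1)) * f N) atTop (𝓝 0) := by
      have hq : Tendsto (fun N => q ^ (N + 1) * (1 - q)⁻¹) atTop (𝓝 0) := by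
        simpa using ((tendsto_pow_atTop_nhds_zero_of_lt_one h0.le h1).comp
          (tendsto_add_atTop_nat 1)).mul_const (1 - q)⁻¹
      refine squeeze_zero_norm (fun N => ?_) hq
      rw [hPs, norm_mul, Real.norm_of_nonneg (mul_nonneg (hP0 N) (by positivity))]
      refine mul_le_mul ?_ (hfb N) (norm_nonneg _) (by positivity)
      refine mul_le_of_le_one_left (by positivity) ((hPle N).trans (pow_le_one₀ h0.le h1.le))
    have := hz.const_sub (sigmaSeries q)
    rw [sub_zero] at this
    refine this.congr fun N => ?_
    rw [hpart N]
    ring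
  have h2 := hPsum.hasSum.tendsto_sum_nat.comp (tendsto_add_atTop_nat 1)
  rw [tendsto_nhds_unique hlim h2]
  exact hPsum.hasSum

/-- A terminating case of Gauss's alternating sum of `q`-binomial coefficients. -/
theorem sum_antidiagonal_two_mul (h0 : 0 < q) (h1 : q < 1) (n : ℕ) :
    ∑ p ∈ Finset.HasAntidiagonal.antidiagonal (2 * n), (-1) ^ p.1 / (qPoch q p.1 * qPoch q p.2)
      = 1 / (qPoch q n * ∏ j ∈ Finset.range n, (1 + q ^ (j + 1))) := by
  set e : PowerSeries ℝ := PowerSeries.mk fun k => 1 / qPoch q k with he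
  set e' : PowerSeries ℝ := PowerSeries.mk fun k => (-1) ^ k / qPoch q k with he'
  have hne := fun n => (qPoch_pos h0 h1 n).ne'
  have hne' := fun n => (one_sub_pow_pos h0 h1 n).ne'
  -- Both Euler series satisfy a `q`-difference equation. For the product the factors combine to `1
  -- - X²`, so its coefficients satisfy a two-step recursion.
  have h1e : (1 - PowerSeries.X) * e = PowerSeries.rescale q e := by
    ext k
    rw [sub_mul, one_mul, map_sub, PowerSeries.coeff_rescale]
    cases k with
    | zero => simp [he]
    | succ k =>
      rw [PowerSeries.coeff_succ_X_mul, he, PowerSeries.coeff_mk, PowerSeries.coeff_mk, qPoch_succ]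
      have := hne k
      have := hne' k
      field_simp
      ring
  have h1e' : (1 + PowerSeries.X) * e' = PowerSeries.rescale q e' := by
    ext k
    rw [add_mul, one_mul, map_add, PowerSeries.coeff_rescale]
    cases k with
    | zero => simp [he']
    | succ k =>
      rw [PowerSeries.coeff_succ_X_mul, he', PowerSeries.coeff_mk, PowerSeries.coeff_mk, qPoch_succ]
      have := hne k
      have := hne' k
      field_simp
      ring
  have hmul : (1 - PowerSeries.X ^ 2) * (e' * e) = PowerSeries.rescale q (e' * e) := by
    rw [map_mul, ← h1e, ← h1e']
    ring
  have hf : ∀ N, PowerSeries.coeff N (e' * e)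
      = ∑ p ∈ Finset.HasAntidiagonal.antidiagonal N, (-1) ^ p.1 / (qPoch q p.1 * qPoch q p.2) := fun N => by
    rw [PowerSeries.coeff_mul]
    refine Finset.sum_congr rfl fun p _ => ?_
    simp only [he, he', PowerSeries.coeff_mk]
    rw [div_mul_div_comm, mul_one]
  have hstep : ∀ N, PowerSeries.coeff (N + 2) (e' * e) * (1 - q ^ (N + 2))
      = PowerSeries.coeff N (e' * e) := fun N => by
    have := congrArg (PowerSeries.coeff (N + 2)) hmul
    rw [sub_mul, one_mul, map_sub, PowerSeries.coeff_rescale, PowerSeries.coeff_X_pow_mul] at this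
    linarith
  rw [← hf]
  induction n with
  | zero => rw [hf]; simp [qPoch_zero]
  | succ n ih =>
    have h := hstep (2 * n)
    rw [ih] at h
    have h2 : (1 - q ^ (2 * n + 2)) = (1 - q ^ (n + 1)) * (1 + q ^ (n + 1)) := by ring
    rw [show 2 * (n + 1) = 2 * n + 2 by ring, eq_div_of_mul_eq (hne' (2 * n + 1)) h, h2, qPoch_succ,
      Finset.prod_range_succ, div_div]
    congr 1
    ring

/-- The weight of `r` when a symmetric sum over `ℤ` is written as a sum over `ℕ`. -/
def symWeight (r : ℕ) : ℝ := if r = 0 then 1 else 2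

/-- Folding the sum about its midpoint (index `n ± r`) puts it in the form of a Bailey pair relative
to `1`: a sum over `r` against `1/((q)_(n-r) (q)_(n+r))`. -/
theorem sum_antidiagonal_two_mul' (n : ℕ) :
    ∑ p ∈ Finset.HasAntidiagonal.antidiagonal (2 * n), (-1) ^ p.1 / (qPoch q p.1 * qPoch q p.2)
      = ∑ p ∈ Finset.HasAntidiagonal.antidiagonal n,
          symWeight p.1 * ((-1) ^ p.2 / (qPoch q p.2 * qPoch q (p.2 + 2 * p.1))) := by
  rw [Finset.Nat.sum_antidiagonal_eq_sum_range_succ_mk, ← Finset.Nat.sum_antidiagonal_swap,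
    Finset.Nat.sum_antidiagonal_eq_sum_range_succ_mk]
  set h : ℕ → ℝ := fun m => (-1) ^ m / (qPoch q m * qPoch q (2 * n - m)) with hh
  change ∑ k ∈ Finset.range (2 * n + 1), h k = _
  have hsym : ∀ k ≤ n, h (n + k) = h (n - k) := fun k hk => by
    simp only [hh]
    rw [show 2 * n - (n + k) = n - k by omega, show 2 * n - (n - k) = n + k by omega,
      mul_comm (qPoch q (n + k))]
    congr 1
    rw [show n + k = (n - k) + 2 * k by omega, pow_add, pow_mul]
    simp
  have h2 : ∑ k ∈ Finset.range (n + 1), h (n + k) = ∑ k ∈ Finset.range (n + 1), h k := by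
    rw [← Finset.sum_range_reflect h (n + 1)]
    refine Finset.sum_congr rfl fun k hk => ?_
    rw [Finset.mem_range] at hk
    rw [hsym k (by omega)]
    congr 1
  rw [show 2 * n + 1 = n + (n + 1) by ring, Finset.sum_range_add, h2, Finset.sum_range_succ,
    Finset.sum_range_succ, ← add_assoc, ← Finset.sum_add_distrib]
  congr 1
  · refine Finset.sum_congr rfl fun k hk => ?_
    rw [Finset.mem_range] at hk
    simp only [Prod.swap, hh, symWeight]
    rw [if_neg (by omega), show k + 2 * (n - k) = 2 * n - k by omega]
    ring
  · simp only [Prod.swap, hh, symWeight]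
    rw [if_pos (by omega), show n + 2 * (n - n) = 2 * n - n by omega, one_mul]

theorem summable_conj_term (h0 : 0 < q) (h1 : q < 1) (a b : ℕ) :
    Summable fun m : ℕ => (-1 : ℝ) ^ m * q ^ ((m + 1).choose 2 + b * m) * qPoch q (a + m)
      / (qPoch q m * qPoch q (a + b + 1 + m)) := by
  obtain ⟨c, hc, hcq⟩ := exists_le_qPoch h0 h1
  refine Summable.of_norm_bounded
    ((summable_geometric_of_lt_one h0.le h1).mul_right (1 / (c * c))) fun m => ?_
  rw [norm_div, norm_mul, norm_mul, norm_pow, norm_neg, norm_one, one_pow, one_mul,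
    Real.norm_of_nonneg (qPoch_pos h0 h1 _).le,
    Real.norm_of_nonneg (mul_pos (qPoch_pos h0 h1 _) (qPoch_pos h0 h1 _)).le, norm_pow,
    Real.norm_of_nonneg h0.le, div_eq_mul_one_div]
  refine mul_le_mul ?_ ?_ (one_div_nonneg.2 (mul_pos (qPoch_pos h0 h1 _) (qPoch_pos h0 h1 _)).le)
    (by positivity)
  · exact (mul_le_of_le_one_right (by positivity) (qPoch_le_one h0 h1 _)).trans
      (pow_le_pow_of_le_one h0.le h1.le ((le_choose_two m).trans (Nat.le_add_right _ _)))
  · exact one_div_le_one_div_of_le (by positivity)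
      (mul_le_mul (hcq _) (hcq _) hc.le (qPoch_pos h0 h1 _).le)

/-- A case of the summation formula for `₁φ₁`. -/
theorem hasSum_conj (h0 : 0 < q) (h1 : q < 1) (a b : ℕ) :
    HasSum (fun m : ℕ => (-1 : ℝ) ^ m * q ^ ((m + 1).choose 2 + b * m) * qPoch q (a + m)
      / (qPoch q m * qPoch q (a + b + 1 + m))) (qPoch q a / qPoch q b) := by
  have hne := fun n => (qPoch_pos h0 h1 n).ne'
  have hne' := fun n => (one_sub_pow_pos h0 h1 n).ne'
  induction a generalizing b with
  | zero =>
    -- For `a = 0` the factor `(q; q)_m` cancels and the series telescopes.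
    set s : ℕ → ℝ := fun m => (-1) ^ m * q ^ ((m + 1).choose 2 + b * m) / qPoch q (b + m) with hs
    have hterm : ∀ m : ℕ, (-1 : ℝ) ^ m * q ^ ((m + 1).choose 2 + b * m) * qPoch q (0 + m)
        / (qPoch q m * qPoch q (0 + b + 1 + m)) = s m - s (m + 1) := fun m => by
      have := hne m
      have := hne (b + m)
      have := hne' (b + m)
      simp only [hs]
      rw [zero_add, show 0 + b + 1 + m = b + m + 1 by ring, show b + (m + 1) = b + m + 1 by ring,
        qPoch_succ, show ((m + 1) + 1).choose 2 + b * (m + 1)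
          = ((m + 1).choose 2 + b * m) + (b + m + 1) by rw [choose_two_succ]; ring,
        pow_add q ((m + 1).choose 2 + b * m)]
      field_simp
      ring
    have hsum := summable_conj_term h0 h1 0 b
    simp only [hterm] at hsum ⊢
    have hz : Tendsto s atTop (𝓝 0) := by
      obtain ⟨c, hc, hcq⟩ := exists_le_qPoch h0 h1
      have hq : Tendsto (fun N => q ^ N * (1 / c)) atTop (𝓝 0) := by
        simpa using (tendsto_pow_atTop_nhds_zero_of_lt_one h0.le h1).mul_const (1 / c)
      refine squeeze_zero_norm (fun m => ?_) hq
      simp only [hs]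
      rw [norm_div, norm_mul, norm_pow, norm_neg, norm_one, one_pow, one_mul,
        Real.norm_of_nonneg (qPoch_pos h0 h1 _).le, norm_pow, Real.norm_of_nonneg h0.le,
        div_eq_mul_one_div]
      refine mul_le_mul ?_ (one_div_le_one_div_of_le hc (hcq _))
        (one_div_nonneg.2 (qPoch_pos h0 h1 _).le) (by positivity)
      exact pow_le_pow_of_le_one h0.le h1.le ((le_choose_two m).trans (Nat.le_add_right _ _))
    have hlim : Tendsto (fun N => ∑ m ∈ Finset.range N, (s m - s (m + 1))) atTop (𝓝 (s 0 - 0)) := by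
      simp only [Finset.sum_range_sub']
      exact hz.const_sub _
    have := tendsto_nhds_unique hlim hsum.hasSum.tendsto_sum_nat
    rw [qPoch_zero, show 1 / qPoch q b = s 0 - 0 by simp [hs], this]
    exact hsum.hasSum
  | succ a ih =>
    -- A contiguous relation: this combination of the cases `(a, b)` and `(a, b + 1)` gives `(a + 1,
    -- b)` term by term.
    have h := (ih b).sub ((ih (b + 1)).mul_left ((1 - q ^ (b + 1)) * q ^ (a + 1)))
    have e : qPoch q a / qPoch q b
        - (1 - q ^ (b + 1)) * q ^ (a + 1) * (qPoch q a / qPoch q (b + 1))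
        = qPoch q (a + 1) / qPoch q b := by
      have := hne b
      have := hne' b
      rw [qPoch_succ, qPoch_succ]
      field_simp
    rw [e] at h
    refine h.congr_fun fun m => ?_
    have := hne m
    have := hne (a + b + 1 + m)
    have := hne' (a + b + 1 + m)
    rw [show a + 1 + m = a + m + 1 by ring, show a + 1 + b + 1 + m = a + b + 1 + m + 1 by ring,
      show a + (b + 1) + 1 + m = a + b + 1 + m + 1 by ring, qPoch_succ q (a + m), qPoch_succ,
      show (m + 1).choose 2 + (b + 1) * m = ((m + 1).choose 2 + b * m) + m by ring,
      pow_add q ((m + 1).choose 2 + b * m)]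
    field_simp
    ring

end

/-! ### From the Bailey pair to an indefinite theta series. -/

section

variable {q : ℝ}

/-- The coefficient of the `r`-th term of the Bailey expansion of `sigmaSeries`. -/
noncomputable def conjTerm (q : ℝ) (r m : ℕ) : ℝ :=
  (-1) ^ m * q ^ (r + m + 1).choose 2 * qPoch q (r + m) / (qPoch q m * qPoch q (m + 2 * r))

theorem exists_norm_conjTerm_le (h0 : 0 < q) (h1 : q < 1) :
    ∃ C, 0 ≤ C ∧ ∀ r m, ‖conjTerm q r m‖ ≤ C * (q ^ r * q ^ m) := by
  obtain ⟨c, hc, hcq⟩ := exists_le_qPoch h0 h1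
  refine ⟨1 / (c * c), by positivity, fun r m => ?_⟩
  rw [conjTerm, norm_div, norm_mul, norm_mul, norm_pow, norm_neg, norm_one, one_pow, one_mul,
    Real.norm_of_nonneg (qPoch_pos h0 h1 _).le,
    Real.norm_of_nonneg (mul_pos (qPoch_pos h0 h1 _) (qPoch_pos h0 h1 _)).le, norm_pow,
    Real.norm_of_nonneg h0.le, div_eq_mul_one_div, mul_comm (1 / (c * c))]
  refine mul_le_mul ?_ ?_ (one_div_nonneg.2 (mul_pos (qPoch_pos h0 h1 _) (qPoch_pos h0 h1 _)).le)
    (by positivity)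
  · rw [← pow_add]
    exact (mul_le_of_le_one_right (by positivity) (qPoch_le_one h0 h1 _)).trans
      (pow_le_pow_of_le_one h0.le h1.le (le_choose_two _))
  · exact one_div_le_one_div_of_le (by positivity)
      (mul_le_mul (hcq _) (hcq _) hc.le (qPoch_pos h0 h1 _).le)

theorem summable_conjTerm (h0 : 0 < q) (h1 : q < 1) (r : ℕ) : Summable (conjTerm q r) := by
  obtain ⟨C, -, hC⟩ := exists_norm_conjTerm_le h0 h1
  exact Summable.of_norm_bounded
    (((summable_geometric_of_lt_one h0.le h1).mul_left (q ^ r)).mul_left C) (hC r)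

theorem symWeight_nonneg (r : ℕ) : 0 ≤ symWeight r := by
  unfold symWeight; split_ifs <;> norm_num

theorem symWeight_le_two (r : ℕ) : symWeight r ≤ 2 := by
  unfold symWeight; split_ifs <;> norm_num

theorem summable_symWeight_mul_conjTerm (h0 : 0 < q) (h1 : q < 1) :
    Summable fun p : ℕ × ℕ => symWeight p.1 * conjTerm q p.1 p.2 := by
  obtain ⟨C, hC0, hC⟩ := exists_norm_conjTerm_le h0 h1
  have hg := summable_geometric_of_lt_one h0.le h1
  have hg2 : Summable fun p : ℕ × ℕ => q ^ p.1 * q ^ p.2 :=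
    hg.mul_of_nonneg hg (fun n => pow_nonneg h0.le n) fun n => pow_nonneg h0.le n
  refine Summable.of_norm_bounded ((hg2.mul_left C).mul_left 2) fun p => ?_
  rw [norm_mul, Real.norm_of_nonneg (symWeight_nonneg _)]
  exact mul_le_mul (symWeight_le_two _) (hC _ _) (norm_nonneg _) (by norm_num)

theorem tsum_prod_eq_tsum_antidiagonal {f : ℕ × ℕ → ℝ} (hf : Summable f) :
    ∑' p, f p = ∑' n, ∑ p ∈ Finset.HasAntidiagonal.antidiagonal n, f p := by
  rw [← (Finset.HasAntidiagonal.sigmaAntidiagonalEquivProd (A := ℕ)).tsum_eq f]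
  refine ((Finset.HasAntidiagonal.sigmaAntidiagonalEquivProd.summable_iff.2 hf).tsum_sigma'
    fun n => (hasSum_fintype _).summable).trans (tsum_congr fun n => ?_)
  rw [tsum_fintype]
  exact Finset.sum_coe_sort (Finset.HasAntidiagonal.antidiagonal n) f

/-- Insert the Bailey pair for `1/((q)_n (-q)_n)` into `∑ q^(n(n+1)/2)/(-q)_n` and interchange the
summations, with `n = r + m`; absolute convergence comes from the geometric bound on `conjTerm`. -/
theorem sigmaSeries_eq_tsum_conjTerm (h0 : 0 < q) (h1 : q < 1) :
    sigmaSeries q = ∑' r, symWeight r * ∑' m, conjTerm q r m := by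
  have hne := fun n => (qPoch_pos h0 h1 n).ne'
  have hs := summable_symWeight_mul_conjTerm h0 h1
  have h2 : ∑' r, symWeight r * ∑' m, conjTerm q r m
      = ∑' p : ℕ × ℕ, symWeight p.1 * conjTerm q p.1 p.2 := by
    have hr : ∀ r, Summable fun m => symWeight r * conjTerm q r m := fun r =>
      (summable_conjTerm h0 h1 r).mul_left (symWeight r)
    refine Eq.trans (tsum_congr fun r => ?_) (hs.tsum_prod' hr).symm
    exact tsum_mul_left.symm
  rw [h2, tsum_prod_eq_tsum_antidiagonal hs, ← (hasSum_sigmaSeries h0 h1).tsum_eq]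
  refine tsum_congr fun n => ?_
  have h3 := sum_antidiagonal_two_mul h0 h1 n
  rw [sum_antidiagonal_two_mul'] at h3
  have hd : ∏ j ∈ Finset.range n, (1 + q ^ (j + 1)) ≠ 0 :=
    (Finset.prod_pos fun j _ => by positivity).ne'
  have h4 : q ^ (n + 1).choose 2 / ∏ j ∈ Finset.range n, (1 + q ^ (j + 1))
      = q ^ (n + 1).choose 2 * qPoch q n
        * (1 / (qPoch q n * ∏ j ∈ Finset.range n, (1 + q ^ (j + 1)))) := by
    have := hne n
    field_simp
  rw [h4, ← h3, Finset.mul_sum]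
  refine Finset.sum_congr rfl fun p hp => ?_
  rw [Finset.HasAntidiagonal.mem_antidiagonal] at hp
  rw [conjTerm, hp]
  ring

theorem choose_two_add (r m : ℕ) :
    (r + m + 1).choose 2 = (r + 1).choose 2 + ((m + 1).choose 2 + r * m) := by
  induction m with
  | zero => simp
  | succ m ih =>
    rw [show r + (m + 1) + 1 = r + m + 2 by ring, choose_two_succ, ih, choose_two_succ]
    ring

/-- Write `1/(q)_(m+2r)` as `(1 - q^(m+2r+1))/(q)_(m+2r+1)` and split `1 - q^(m+2r+1) = (1 -
q^(2r+1)) + q^(2r+1) (1 - q^m)`. The first part is summed by `hasSum_conj` with `a = b = r`; in the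
second `1 - q^m` cancels and the index shifts to `r + 1`. -/
theorem tsum_conjTerm_rec (h0 : 0 < q) (h1 : q < 1) (r : ℕ) :
    ∑' m, conjTerm q r m = q ^ (r + 1).choose 2 * (1 - q ^ (2 * r + 1))
      - q ^ (2 * r + 1) * ∑' m, conjTerm q (r + 1) m := by
  have hne := fun n => (qPoch_pos h0 h1 n).ne'
  have hne' := fun n => (one_sub_pow_pos h0 h1 n).ne'
  set v : ℕ → ℝ := fun m => q ^ (r + 1).choose 2 * (1 - q ^ (2 * r + 1)) *
    ((-1 : ℝ) ^ m * q ^ ((m + 1).choose 2 + r * m) * qPoch q (r + m)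
      / (qPoch q m * qPoch q (r + r + 1 + m))) with hv
  have hvs : HasSum v (q ^ (r + 1).choose 2 * (1 - q ^ (2 * r + 1)) * 1) := by
    have := hasSum_conj h0 h1 r r
    rw [div_self (hne r)] at this
    exact this.mul_left _
  have hz : conjTerm q r 0 = v 0 := by
    have := hne (2 * r)
    have := hne r
    have := hne' (2 * r)
    simp only [hv, conjTerm]
    rw [show r + r + 1 + 0 = 2 * r + 1 by ring, show 0 + 2 * r = 2 * r by ring, qPoch_succ]
    simp
    field_simp
  have hs : ∀ m, conjTerm q r (m + 1) = v (m + 1) - q ^ (2 * r + 1) * conjTerm q (r + 1) m := by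
    intro m
    have := hne m
    have := hne' m
    have := hne (m + 1 + 2 * r)
    have := hne' (m + 1 + 2 * r)
    simp only [hv, conjTerm]
    rw [show r + r + 1 + (m + 1) = m + 1 + 2 * r + 1 by ring,
      show m + 2 * (r + 1) = m + 1 + 2 * r + 1 by ring, show r + 1 + m = r + (m + 1) by ring,
      qPoch_succ q (m + 1 + 2 * r), qPoch_succ q m, choose_two_add r (m + 1), pow_add q ((r + 1).choose 2)]
    field_simp
    ring
  have h2 := (summable_conjTerm h0 h1 (r + 1)).mul_left (q ^ (2 * r + 1))
  rw [(summable_conjTerm h0 h1 r).tsum_eq_zero_add, hz]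
  rw [tsum_congr hs, ((summable_nat_add_iff 1).2 hvs.summable).tsum_sub h2,
    tsum_mul_left (a := q ^ (2 * r + 1)), ← add_sub_assoc,
    ← hvs.summable.tsum_eq_zero_add, hvs.tsum_eq, mul_one]

/-- The terms of the partial theta series attached to `r`. -/
noncomputable def thetaTerm (q : ℝ) (r k : ℕ) : ℝ :=
  q ^ (2 * r * k + k ^ 2 + (r + k + 1).choose 2) * (1 - q ^ (2 * (r + k) + 1))

theorem thetaTerm_nonneg (h0 : 0 < q) (h1 : q < 1) (r k : ℕ) : 0 ≤ thetaTerm q r k :=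
  mul_nonneg (by positivity) (one_sub_pow_pos h0 h1 _).le

theorem thetaTerm_le (h0 : 0 < q) (h1 : q < 1) (r k : ℕ) : thetaTerm q r k ≤ q ^ (r + k) :=
  (mul_le_of_le_one_right (by positivity) (sub_le_self _ (by positivity))).trans
    (pow_le_pow_of_le_one h0.le h1.le ((le_choose_two _).trans (Nat.le_add_left _ _)))

/-- Iterate `tsum_conjTerm_rec`; the exponents `2(r+i)+1` for `i < K` add up to `2rK + K²`. -/
theorem tsum_conjTerm (h0 : 0 < q) (h1 : q < 1) (r : ℕ) :
    ∑' m, conjTerm q r m = ∑' k, (-1) ^ k * thetaTerm q r k := by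
  set G : ℕ → ℝ := fun r => ∑' m, conjTerm q r m with hG
  have hpart : ∀ K, G r = ∑ k ∈ Finset.range K, (-1) ^ k * thetaTerm q r k
      + (-1) ^ K * q ^ (2 * r * K + K ^ 2) * G (r + K) := by
    intro K
    induction K with
    | zero => simp
    | succ K ih =>
      have h := tsum_conjTerm_rec h0 h1 (r + K)
      rw [ih, Finset.sum_range_succ]
      simp only [hG] at h ⊢
      rw [h, thetaTerm, show r + (K + 1) = r + K + 1 by ring]
      ring
  obtain ⟨C, hC0, hC⟩ := exists_norm_conjTerm_le h0 h1
  have hg := summable_geometric_of_lt_one h0.le h1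
  have hGb : ∀ r, ‖G r‖ ≤ C * (1 - q)⁻¹ := fun r => by
    have hh := (hg.hasSum.mul_left (q ^ r)).mul_left C
    rw [tsum_geometric_of_lt_one h0.le h1] at hh
    refine (tsum_of_norm_bounded hh (hC r)).trans ?_
    refine mul_le_mul_of_nonneg_left ?_ hC0
    exact mul_le_of_le_one_left (inv_nonneg.2 (sub_nonneg.2 h1.le)) (pow_le_one₀ h0.le h1.le)
  have hsum : Summable fun k => (-1) ^ k * thetaTerm q r k := by
    refine Summable.of_norm_bounded (hg.mul_left (q ^ r)) fun k => ?_
    rw [norm_mul, norm_pow, norm_neg, norm_one, one_pow, one_mul,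
      Real.norm_of_nonneg (thetaTerm_nonneg h0 h1 r k), ← pow_add]
    exact thetaTerm_le h0 h1 r k
  have hz : Tendsto (fun K => (-1) ^ K * q ^ (2 * r * K + K ^ 2) * G (r + K)) atTop (𝓝 0) := by
    have hq : Tendsto (fun N => q ^ N * (C * (1 - q)⁻¹)) atTop (𝓝 0) := by
      simpa using (tendsto_pow_atTop_nhds_zero_of_lt_one h0.le h1).mul_const (C * (1 - q)⁻¹)
    refine squeeze_zero_norm (fun K => ?_) hq
    rw [norm_mul, norm_mul, norm_pow, norm_neg, norm_one, one_pow, one_mul, norm_pow,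
      Real.norm_of_nonneg h0.le]
    refine mul_le_mul (pow_le_pow_of_le_one h0.le h1.le ?_) (hGb _) (norm_nonneg _) (by positivity)
    nlinarith [Nat.zero_le (2 * r * K), Nat.le_self_pow two_ne_zero K]
  have := hz.const_sub (G r)
  rw [sub_zero] at this
  refine tendsto_nhds_unique (this.congr fun K => ?_) hsum.hasSum.tendsto_sum_nat
  rw [hpart K]
  ring

/-- The Hecke-type double series of Andrews, Dyson and Hickerson. -/
theorem sigmaSeries_eq_tsum_thetaTerm (h0 : 0 < q) (h1 : q < 1) :
    sigmaSeries q = ∑' r, symWeight r * ∑' k, (-1) ^ k * thetaTerm q r k := by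
  rw [sigmaSeries_eq_tsum_conjTerm h0 h1]
  simp only [tsum_conjTerm h0 h1]

end

/-! ### The double series as a sum over a lattice cone -/

/-- The even quadratic character modulo `12`. -/
noncomputable def chi (d : ℤ) : ℝ :=
  (Real.cos (Real.pi * d / 6) - Real.cos (5 * Real.pi * d / 6)) / √3

theorem chi_neg (d : ℤ) : chi (-d) = chi d := by
  simp only [chi, Int.cast_neg, mul_neg, neg_div, Real.cos_neg]

theorem chi_add_six_mul (d : ℤ) (k : ℕ) : chi (d + 6 * k) = (-1) ^ k * chi d := by
  induction k with
  | zero => simp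
  | succ k ih =>
    have h1 : Real.pi * ((d + 6 * (k + 1 : ℕ) : ℤ) : ℝ) / 6
        = Real.pi * ((d + 6 * k : ℤ) : ℝ) / 6 + Real.pi := by
      push_cast; ring
    have h2 : 5 * Real.pi * ((d + 6 * (k + 1 : ℕ) : ℤ) : ℝ) / 6
        = 5 * Real.pi * ((d + 6 * k : ℤ) : ℝ) / 6 + Real.pi + (2 : ℕ) * (2 * Real.pi) := by
      push_cast; ring
    rw [pow_succ, mul_right_comm, ← ih, chi, h1, h2, Real.cos_add_nat_mul_two_pi, Real.cos_add_pi,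
      Real.cos_add_pi, chi]
    ring

theorem chi_zero : chi 0 = 0 := by simp [chi]

theorem chi_one : chi 1 = 1 := by
  have h1 : Real.pi * ((1 : ℤ) : ℝ) / 6 = Real.pi / 6 := by simp
  have h2 : 5 * Real.pi * ((1 : ℤ) : ℝ) / 6 = Real.pi - Real.pi / 6 := by push_cast; ring
  rw [chi, h1, h2, Real.cos_pi_sub, Real.cos_pi_div_six]
  have : √3 ≠ 0 := by positivity
  field_simp
  norm_num

theorem chi_two : chi 2 = 0 := by
  have h : 5 * Real.pi * ((2 : ℤ) : ℝ) / 6 = 2 * Real.pi - Real.pi * ((2 : ℤ) : ℝ) / 6 := by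
    push_cast; ring
  rw [chi, h, Real.cos_two_pi_sub, sub_self, zero_div]

theorem chi_three : chi 3 = 0 := by
  have h : 5 * Real.pi * ((3 : ℤ) : ℝ) / 6 = Real.pi * ((3 : ℤ) : ℝ) / 6 + 2 * Real.pi := by
    push_cast; ring
  rw [chi, h, Real.cos_add_two_pi, sub_self, zero_div]

theorem chi_four : chi 4 = 0 := by
  have := chi_add_six_mul (-2) 1
  rw [chi_neg, chi_two, mul_zero] at this
  exact this

theorem chi_five : chi 5 = -1 := by
  have := chi_add_six_mul (-1) 1
  rw [chi_neg, chi_one] at this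
  norm_num at this
  exact this

theorem abs_chi_le (d : ℤ) : |chi d| ≤ 2 := by
  have h3 : (1 : ℝ) ≤ √3 := by
    rw [Real.one_le_sqrt]; norm_num
  rw [chi, abs_div, abs_of_pos (by positivity : 0 < √3), div_le_iff₀ (by positivity)]
  refine (abs_sub _ _).trans ?_
  linarith [Real.abs_cos_le_one (Real.pi * d / 6), Real.abs_cos_le_one (5 * Real.pi * d / 6)]

/-- The Gaussian of the norm form, in the coordinates `x`, `y` of the cone. -/
noncomputable def coneExp (t x y : ℝ) : ℝ :=
  Real.exp (-(t * (x ^ 2 + 10 * x * y + y ^ 2) / 24))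

theorem coneExp_comm (t x y : ℝ) : coneExp t x y = coneExp t y x := by
  rw [coneExp, coneExp]; ring_nf

theorem coneExp_le {t : ℝ} (ht : 0 < t) (j m : ℕ) :
    coneExp t j m ≤ Real.exp (-t / 24) ^ j * Real.exp (-t / 24) ^ m := by
  have hj : (j : ℝ) ≤ (j : ℝ) ^ 2 := by exact_mod_cast Nat.le_self_pow two_ne_zero j
  have hm : (m : ℝ) ≤ (m : ℝ) ^ 2 := by exact_mod_cast Nat.le_self_pow two_ne_zero m
  rw [← Real.exp_nat_mul, ← Real.exp_nat_mul, ← Real.exp_add, coneExp, Real.exp_le_exp]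
  have h : t * (j + m : ℝ) ≤ t * ((j : ℝ) ^ 2 + 10 * j * m + (m : ℝ) ^ 2) :=
    mul_le_mul_of_nonneg_left (by nlinarith [mul_nonneg j.cast_nonneg (m.cast_nonneg (α := ℝ))]) ht.le
  linarith

theorem summable_coneExp {t : ℝ} (ht : 0 < t) : Summable fun p : ℕ × ℕ => coneExp t p.1 p.2 := by
  have hq : Real.exp (-t / 24) < 1 := by rw [Real.exp_lt_one_iff]; linarith
  have hg := summable_geometric_of_lt_one (Real.exp_pos _).le hq
  exact Summable.of_nonneg_of_le (fun p => (Real.exp_pos _).le) (fun p => coneExp_le ht p.1 p.2)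
    (hg.mul_of_nonneg hg (fun n => pow_nonneg (Real.exp_pos _).le n)
      fun n => pow_nonneg (Real.exp_pos _).le n)

/-- The factor `q^(1/24)` completes the exponent to the form `(x² + 10xy + y²)/24` at `x = r`, `y =
r + 6k + 1`; the extra `2(r+k)+1` in the second term moves `y` to `r + 6k + 5`. -/
theorem thetaTerm_mul_exp (t : ℝ) (r k : ℕ) :
    thetaTerm (Real.exp (-t)) r k * Real.exp (-t / 24)
      = coneExp t r (r + (6 * k + 1)) - coneExp t r (r + (6 * k + 5)) := by
  have hc : (((r + k + 1).choose 2 : ℕ) : ℝ) = (r + k + 1) * (r + k) / 2 := by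
    rw [Nat.cast_choose_two]
    push_cast
    ring
  rw [thetaTerm, mul_sub, mul_one, sub_mul, ← pow_add, ← Real.exp_nat_mul, ← Real.exp_nat_mul,
    ← Real.exp_add, ← Real.exp_add, coneExp, coneExp]
  push_cast
  rw [hc]
  congr 2 <;> ring

theorem summable_chi_mul_coneExp_comp {t : ℝ} (ht : 0 < t) {ι : Type*} {f : ι → ℕ × ℕ}
    (hf : Function.Injective f) (d : ι → ℤ) :
    Summable fun i => chi (d i) * coneExp t (f i).1 (f i).2 := by
  refine Summable.of_norm_bounded (((summable_coneExp ht).comp_injective hf).mul_left 2) fun i => ?_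
  rw [norm_mul, coneExp, Real.norm_of_nonneg (Real.exp_pos _).le]
  exact mul_le_mul_of_nonneg_right (abs_chi_le _) (Real.exp_pos _).le

/-- Only the residues `1` and `5` mod 6 survive in `chi`, with values `(-1)^k` and `-(-1)^k` at
`6k+1` and `6k+5`. -/
theorem tsum_thetaTerm_mul_exp {t : ℝ} (ht : 0 < t) (r : ℕ) :
    (∑' k, (-1) ^ k * thetaTerm (Real.exp (-t)) r k) * Real.exp (-t / 24)
      = ∑' d : ℕ, chi d * coneExp t r (r + d) := by
  have hs : Summable fun d : ℕ => chi d * coneExp t r (r + d) := by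
    have := summable_chi_mul_coneExp_comp ht (f := fun d : ℕ => (r, r + d))
      (fun a b h => by simpa using h) (fun d => (d : ℤ))
    exact_mod_cast this
  have hres : ∀ i : ℕ, Summable fun k : ℕ => chi ((i + 6 * k : ℕ) : ℤ) *
      coneExp t r (r + (i + 6 * k : ℕ)) := fun i =>
    hs.comp_injective (i := fun k : ℕ => i + 6 * k) fun a b h => by simpa using h
  rw [Nat.sumByResidueClasses hs 6, ← tsum_mul_right]
  have huniv : (Finset.univ : Finset (ZMod 6)) = {0, 1, 2, 3, 4, 5} := by decide
  have hc : ∀ (i k : ℕ), chi ((i + 6 * k : ℕ) : ℤ) = (-1) ^ k * chi i := fun i k => by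
    rw [← chi_add_six_mul]; push_cast; rfl
  have v0 : (0 : ZMod 6).val = 0 := rfl
  have v1 : (1 : ZMod 6).val = 1 := rfl
  have v2 : (2 : ZMod 6).val = 2 := rfl
  have v3 : (3 : ZMod 6).val = 3 := rfl
  have v4 : (4 : ZMod 6).val = 4 := rfl
  have v5 : (5 : ZMod 6).val = 5 := rfl
  rw [huniv]
  rw [Finset.sum_insert (by decide), Finset.sum_insert (by decide), Finset.sum_insert (by decide),
    Finset.sum_insert (by decide), Finset.sum_insert (by decide), Finset.sum_singleton,
    v0, v1, v2, v3, v4, v5]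
  have z : ∀ i : ℕ, chi i = 0 → ∑' k : ℕ, chi ((i + 6 * k : ℕ) : ℤ) *
      coneExp t r (r + (i + 6 * k : ℕ)) = 0 := fun i hi => by
    simp only [hc, hi, mul_zero, zero_mul, tsum_zero]
  rw [z 0 chi_zero, z 2 chi_two, z 3 chi_three, z 4 chi_four, zero_add, zero_add, zero_add, zero_add,
    ← (hres 1).tsum_add (hres 5)]
  refine tsum_congr fun k => ?_
  rw [mul_assoc, thetaTerm_mul_exp, hc, hc, Nat.cast_one, chi_one,
    show chi ((5 : ℕ) : ℤ) = -1 from chi_five]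
  push_cast
  rw [add_comm (1 : ℝ), add_comm (5 : ℝ)]
  ring

/-- Pairs of natural numbers, split according to whether `p.1 ≤ p.2`. -/
def coneEquiv : (ℕ × ℕ) ⊕ (ℕ × ℕ) ≃ ℕ × ℕ where
  toFun := Sum.elim (fun p => (p.1, p.1 + p.2)) fun p => (p.1 + 1 + p.2, p.1)
  invFun p := if p.1 ≤ p.2 then .inl (p.1, p.2 - p.1) else .inr (p.2, p.1 - p.2 - 1)
  left_inv := by
    rintro (⟨j, k⟩ | ⟨j, k⟩)
    · simp
    · have h : ¬ j + 1 + k ≤ j := by omega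
      refine (if_neg h).trans ?_
      simp only [Sum.elim_inr, Sum.inr.injEq, Prod.mk.injEq, true_and]
      omega
  right_inv := by
    rintro ⟨j, m⟩
    dsimp only
    split_ifs with h
    · simp only [Sum.elim_inl, Prod.mk.injEq, true_and]; omega
    · simp only [Sum.elim_inr, Prod.mk.injEq, and_true]; omega

/-- The weight 2 for `r > 0` counts each point twice. The second copy is reflected by `(x, y) ↦ (y,
x)`, under which form and character are invariant, and fills the half `x ≥ y ≥ 1` of the quadrant;
the diagonal contributes nothing because `chi 0 = 0`. -/
theorem sigmaSeries_exp {t : ℝ} (ht : 0 < t) :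
    sigmaSeries (Real.exp (-t)) * Real.exp (-t / 24)
      = ∑' p : ℕ × ℕ, chi (p.2 + 1 - p.1) * coneExp t p.1 (p.2 + 1 : ℕ) := by
  have hq : Real.exp (-t) < 1 := by rw [Real.exp_lt_one_iff]; linarith
  set S : ℕ → ℝ := fun r => ∑' d : ℕ, chi d * coneExp t r (r + d) with hS
  have hs1 : Summable fun p : ℕ × ℕ => chi (p.2 + 1 : ℕ) * coneExp t p.1 (p.1 + (p.2 + 1) : ℕ) :=
    summable_chi_mul_coneExp_comp ht (f := fun p : ℕ × ℕ => (p.1, p.1 + (p.2 + 1)))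
      (fun a b h => by
        simp only [Prod.mk.injEq] at h
        ext <;> omega) (fun p => ((p.2 + 1 : ℕ) : ℤ))
  have hs2 : Summable fun p : ℕ × ℕ => chi (p.2 : ℤ) * coneExp t (p.1 + 1 : ℕ) (p.1 + 1 + p.2 : ℕ) :=
    summable_chi_mul_coneExp_comp ht (f := fun p : ℕ × ℕ => (p.1 + 1, p.1 + 1 + p.2))
      (fun a b h => by
        simp only [Prod.mk.injEq] at h
        ext <;> omega) (fun p => (p.2 : ℤ))
  have e1 : ∀ r : ℕ, S r = ∑' k : ℕ, chi (k + 1 : ℕ) * coneExp t r (r + (k + 1) : ℕ) := fun r => by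
    have hs : Summable fun d : ℕ => chi d * coneExp t r (r + d) := by
      have := summable_chi_mul_coneExp_comp ht (f := fun d : ℕ => (r, r + d))
        (fun a b h => by simpa using h) (fun d => (d : ℤ))
      exact_mod_cast this
    simp only [hS]
    rw [hs.tsum_eq_zero_add, Nat.cast_zero, chi_zero, zero_mul, zero_add]
    refine tsum_congr fun k => ?_
    push_cast
    rfl
  have e2 : ∀ r : ℕ, S (r + 1) = ∑' k : ℕ, chi k * coneExp t (r + 1 : ℕ) (r + 1 + k : ℕ) := fun r => by
    simp only [hS]
    push_cast
    rfl
  have hS1 : Summable S := by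
    rw [show S = _ from funext e1]
    exact hs1.prod
  have hL : sigmaSeries (Real.exp (-t)) * Real.exp (-t / 24) = ∑' r, symWeight r * S r := by
    rw [sigmaSeries_eq_tsum_thetaTerm (Real.exp_pos _) hq, ← tsum_mul_right]
    refine tsum_congr fun r => ?_
    rw [mul_assoc, tsum_thetaTerm_mul_exp ht]
  have hw : ∑' r, symWeight r * S r = ∑' r, S r + ∑' r, S (r + 1) := by
    have hw1 : Summable fun r => symWeight r * S r := by
      refine Summable.of_norm_bounded (hS1.norm.mul_left 2) fun r => ?_
      rw [norm_mul, Real.norm_of_nonneg (symWeight_nonneg _)]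
      exact mul_le_mul_of_nonneg_right (symWeight_le_two r) (norm_nonneg _)
    rw [hw1.tsum_eq_zero_add, hS1.tsum_eq_zero_add]
    simp only [symWeight, if_true, Nat.succ_ne_zero, if_false, one_mul, tsum_mul_left]
    ring
  have hf1 : HasSum (fun p : ℕ × ℕ => chi (p.2 + 1 : ℕ) * coneExp t p.1 (p.1 + (p.2 + 1) : ℕ))
      (∑' r, S r) := by
    rw [tsum_congr e1, ← hs1.tsum_prod]
    exact hs1.hasSum
  have hf2 : HasSum (fun p : ℕ × ℕ => chi (p.2 : ℤ) * coneExp t (p.1 + 1 : ℕ) (p.1 + 1 + p.2 : ℕ))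
      (∑' r, S (r + 1)) := by
    rw [tsum_congr e2, ← hs2.tsum_prod]
    exact hs2.hasSum
  rw [hL, hw]
  symm
  refine HasSum.tsum_eq ?_
  rw [← coneEquiv.hasSum_iff]
  refine HasSum.sum ?_ ?_
  · refine hf1.congr_fun fun p => ?_
    simp only [Function.comp_apply, coneEquiv, Equiv.coe_fn_mk, Sum.elim_inl]
    push_cast
    rw [add_assoc (p.1 : ℝ), add_assoc (p.1 : ℤ), add_sub_cancel_left]
  · refine hf2.congr_fun fun p => ?_
    simp only [Function.comp_apply, coneEquiv, Equiv.coe_fn_mk, Sum.elim_inr]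
    rw [coneExp_comm, ← chi_neg]
    push_cast
    congr 2
    ring

/-! ### The generating function as an asymptotic expansion -/

theorem a_eq_sum {n K : ℕ} (h : n < K) :
    a n = ∑ k ∈ Finset.range K, PowerSeries.coeff n (term k) := by
  have h1 := (PowerSeries.WithPiTopology.hasSum_iff_hasSum_coeff ℝ).1 hasSum_gf n
  refine h1.unique (hasSum_sum_of_ne_finset_zero fun k hk => coeff_term_eq_zero ?_)
  rw [Finset.mem_range] at hk
  omega

/-- `A(-z)` with complex coefficients. -/
noncomputable def gfNeg : PowerSeries ℂ :=
  PowerSeries.mk fun n => (-1) ^ n * (a n : ℂ)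

theorem neg_one_pow_mul_qPoch_exp (k : ℕ) (t : ℝ) :
    (((-1) ^ k * qPoch (Real.exp (-t)) k : ℝ) : ℂ)
      = ∏ j ∈ Finset.Icc 1 k, (Complex.exp (-(j : ℂ) * t) + -1) := by
  induction k with
  | zero => simp [qPoch_zero]
  | succ k ih =>
    rw [Finset.prod_Icc_succ_top (by omega), ← ih, qPoch_succ, ← Real.exp_nat_mul]
    push_cast
    ring_nf

theorem hasExpansion_qPoch (k : ℕ) :
    HasExpansion (fun t => (((-1) ^ k * qPoch (Real.exp (-t)) k : ℝ) : ℂ))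
      (PowerSeries.rescale (-1) (PowerSeries.map Complex.ofRealHom (term k))) := by
  have h := HasExpansion.prod (Finset.Icc 1 k) fun j _ =>
    (HasExpansion.exp (-(j : ℂ))).add (HasExpansion.const (-1))
  convert! h using 1
  · ext t
    exact neg_one_pow_mul_qPoch_exp k t
  · rw [term, map_prod, map_prod]
    refine Finset.prod_congr rfl fun j _ => ?_
    ext n
    simp [expMul, PowerSeries.coeff_rescale, PowerSeries.coeff_exp, PowerSeries.coeff_one,
      neg_pow (j : ℂ)]
    split_ifs with hn <;> simp [hn, sub_eq_add_neg, mul_assoc]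

/-- Since `q^(n+1) (q)_n = (q)_n - (q)_(n+1)`, a partial sum of `σ` is the sum of two consecutive
partial sums of `∑ (-1)^k (q)_k`. This is the source of the factor 2 in `hasExpansion_sigmaSeries`.
-/
theorem sum_range_sigmaSeries (q : ℝ) (K : ℕ) :
    1 + ∑ n ∈ Finset.range K, (-1) ^ n * q ^ (n + 1) * qPoch q n
      = ∑ k ∈ Finset.range K, (-1) ^ k * qPoch q k
        + ∑ k ∈ Finset.range (K + 1), (-1) ^ k * qPoch q k := by
  induction K with
  | zero => simp [qPoch_zero]
  | succ K ih =>
    rw [Finset.sum_range_succ, ← add_assoc, ih, Finset.sum_range_succ _ (K + 1),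
      Finset.sum_range_succ _ K, qPoch_succ]
    ring

theorem qPoch_exp_le {t : ℝ} (ht : 0 < t) (K : ℕ) :
    qPoch (Real.exp (-t)) K ≤ K.factorial * t ^ K := by
  have hq : Real.exp (-t) < 1 := by rw [Real.exp_lt_one_iff]; linarith
  induction K with
  | zero => simp [qPoch_zero]
  | succ K ih =>
    have h1 : 1 - Real.exp (-t) ^ (K + 1) ≤ (K + 1) * t := by
      rw [← Real.exp_nat_mul]
      have := Real.add_one_le_exp (((K + 1 : ℕ) : ℝ) * -t)
      push_cast at this ⊢
      linarith
    rw [qPoch_succ, Nat.factorial_succ]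
    refine (mul_le_mul ih h1 (one_sub_pow_pos (Real.exp_pos _) hq K).le (by positivity)).trans_eq ?_
    push_cast
    ring

/-- The absolute values of the tail terms are `(q)_n - (q)_(n+1)`, so the tail telescopes to at most
`(q)_K`. -/
theorem abs_sigmaSeries_sub_le {q : ℝ} (h0 : 0 < q) (h1 : q < 1) (K : ℕ) :
    |sigmaSeries q - (∑ k ∈ Finset.range K, (-1) ^ k * qPoch q k
        + ∑ k ∈ Finset.range (K + 1), (-1) ^ k * qPoch q k)| ≤ qPoch q K := by
  have hle : ∀ n : ℕ, ‖(-1) ^ n * q ^ (n + 1) * qPoch q n‖ ≤ qPoch q n - qPoch q (n + 1) := fun n => by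
    rw [norm_mul, norm_mul, norm_pow, norm_neg, norm_one, one_pow, one_mul, norm_pow,
      Real.norm_of_nonneg h0.le, Real.norm_of_nonneg (qPoch_pos h0 h1 n).le, qPoch_succ]
    exact le_of_eq (by ring)
  have hpart : ∀ s M : ℕ, ∑ n ∈ Finset.range M, ‖(-1) ^ (n + s) * q ^ (n + s + 1) * qPoch q (n + s)‖
      ≤ qPoch q s := fun s M => by
    refine (Finset.sum_le_sum fun n _ => hle (n + s)).trans ?_
    have := Finset.sum_range_sub' (fun n => qPoch q (n + s)) M
    simp only [zero_add] at this
    simp only [add_right_comm _ s 1]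
    rw [this]
    exact sub_le_self _ (qPoch_pos h0 h1 _).le
  have hs : Summable fun n : ℕ => (-1) ^ n * q ^ (n + 1) * qPoch q n := by
    refine Summable.of_norm ?_
    exact summable_of_sum_range_le (c := qPoch q 0) (fun _ => norm_nonneg _) fun M => hpart 0 M
  have hsK := (summable_nat_add_iff K).2 hs
  rw [← sum_range_sigmaSeries, sigmaSeries, ← hs.sum_add_tsum_nat_add K, add_sub_add_left_eq_sub,
    add_sub_cancel_left, ← Real.norm_eq_abs]
  exact (norm_tsum_le_tsum_norm hsK.norm).trans
    (Real.tsum_le_of_sum_range_le (fun _ => norm_nonneg _) (hpart K))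

theorem hasExpansion_sigmaSeries :
    HasExpansion (fun t => (sigmaSeries (Real.exp (-t)) : ℂ)) (PowerSeries.C 2 * gfNeg) := by
  refine HasExpansion.of_approx fun K => ⟨_, _, (HasExpansion.sum (Finset.range K)
    fun k _ => hasExpansion_qPoch k).add (HasExpansion.sum (Finset.range (K + 1))
      fun k _ => hasExpansion_qPoch k), ?_, fun i hi => ?_⟩
  · refine IsBigO.of_bound K.factorial ?_
    filter_upwards [self_mem_nhdsWithin] with t ht
    have ht : 0 < t := ht
    have hq : Real.exp (-t) < 1 := by rw [Real.exp_lt_one_iff]; linarith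
    have h := (abs_sigmaSeries_sub_le (Real.exp_pos (-t)) hq K).trans (qPoch_exp_le ht K)
    rw [Real.norm_of_nonneg (by positivity)]
    refine le_trans (le_of_eq ?_) h
    rw [← Real.norm_eq_abs, ← Complex.norm_real]
    push_cast
    rfl
  · have hc : ∀ L, i < L → PowerSeries.coeff i (∑ k ∈ Finset.range L,
        PowerSeries.rescale (-1 : ℂ) (PowerSeries.map Complex.ofRealHom (term k)))
          = (-1) ^ i * (a i : ℂ) := fun L hL => by
      rw [a_eq_sum hL, map_sum]
      simp only [PowerSeries.coeff_rescale, PowerSeries.coeff_map, ← Finset.mul_sum]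
      simp
    rw [map_add, hc K hi, hc (K + 1) (by omega), PowerSeries.coeff_C_mul, gfNeg,
      PowerSeries.coeff_mk]
    ring

/-! ### Repeated summation by parts -/

section

/-- The weights of the `M`-fold Euler transform of `∑ w ^ j * u j`. -/
noncomputable def abelWeight (w : ℂ) (M i : ℕ) : ℂ :=
  ∑ a ∈ Finset.range M, w ^ a / (1 - w) ^ (a + 1) * ((-1) ^ (a - i) * a.choose i)

/-- The `M`-fold Euler transform of `∑ w ^ j * u j`. -/
noncomputable def abelSum (w : ℂ) (M : ℕ) (u : ℕ → ℂ) : ℂ :=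
  ∑ i ∈ Finset.range M, abelWeight w M i * u i

/-- Differences at `0` suit the recursions and polynomial `u`; the form with weights shows that only
`u 0, …, u (M - 1)` enter, linearly. -/
theorem abelSum_eq_sum_fwdDiff (w : ℂ) (M : ℕ) (u : ℕ → ℂ) :
    abelSum w M u = ∑ a ∈ Finset.range M, w ^ a / (1 - w) ^ (a + 1) * ((fwdDiff 1)^[a] u) 0 := by
  simp only [abelSum, abelWeight, Finset.sum_mul]
  rw [Finset.sum_comm]
  refine Finset.sum_congr rfl fun a ha => ?_
  rw [Finset.mem_range] at ha
  rw [fwdDiff_iter_eq_sum_shift, Finset.mul_sum,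
    ← Finset.sum_subset (Finset.range_subset_range.2 (Nat.succ_le_of_lt ha))]
  · refine Finset.sum_congr rfl fun i _ => ?_
    simp [mul_assoc]
  · intro i _ hi
    rw [Finset.mem_range, not_lt] at hi
    rw [Nat.choose_eq_zero_of_lt (by omega)]
    simp

theorem abelSum_sub_shift {w : ℂ} (hw : w ≠ 1) (M : ℕ) (u : ℕ → ℂ) :
    abelSum w M u - w * abelSum w M (fun j => u (j + 1))
      = u 0 - (w / (1 - w)) ^ M * ((fwdDiff 1)^[M] u) 0 := by
  have hw' : 1 - w ≠ 0 := sub_ne_zero.2 hw.symm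
  rw [abelSum_eq_sum_fwdDiff, abelSum_eq_sum_fwdDiff]
  have hd : ∀ a, ((fwdDiff 1)^[a] fun j => u (j + 1)) 0 = ((fwdDiff 1)^[a] u) 0 + ((fwdDiff 1)^[a + 1] u) 0 := fun a => by
    rw [fwdDiff_iter_comp_add, Function.iterate_succ_apply']
    simp [fwdDiff]
  simp only [hd]
  induction M with
  | zero => simp
  | succ M ih =>
    rw [Finset.sum_range_succ, Finset.sum_range_succ]
    have e : ∀ A B C D w' : ℂ, (A + B) - w' * (C + D) = (A - w' * C) + (B - w' * D) := by
      intros; ring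
    rw [e, ih, div_pow, div_pow]
    field_simp
    ring

theorem summable_fwdDiff_iter {u : ℕ → ℂ} (hu : Summable u) (M : ℕ) : Summable ((fwdDiff 1)^[M] u) := by
  induction M with
  | zero => exact hu
  | succ M ih =>
    rw [Function.iterate_succ_apply']
    exact ((summable_nat_add_iff 1).2 ih).sub ih

theorem summable_pow_mul {w : ℂ} (hw : ‖w‖ = 1) {u : ℕ → ℂ} (hu : Summable u) :
    Summable fun j => w ^ j * u j :=
  Summable.of_norm (by simpa [hw] using hu.norm)

/-- Each summation by parts extracts a boundary term and trades `u` for its difference at the price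
of `w/(1 - w)`. -/
theorem tsum_eq_abelSum_add {w : ℂ} (hw : ‖w‖ = 1) (hw1 : w ≠ 1) {u : ℕ → ℂ} (hu : Summable u)
    (M : ℕ) :
    ∑' j, w ^ j * u j
      = abelSum w M u + (w / (1 - w)) ^ M * ∑' j, w ^ j * ((fwdDiff 1)^[M] u) j := by
  have hw' : 1 - w ≠ 0 := sub_ne_zero.2 hw1.symm
  rw [abelSum_eq_sum_fwdDiff]
  induction M with
  | zero => simp
  | succ M ih =>
    have hM := summable_fwdDiff_iter hu M
    have hs := summable_pow_mul hw hM
    have hs1 := summable_pow_mul hw ((summable_nat_add_iff 1).2 hM)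
    have h2 : ∑' j, w ^ j * ((fwdDiff 1)^[M] u) (j + 1) * w
        = (∑' j, w ^ j * ((fwdDiff 1)^[M] u) j) - ((fwdDiff 1)^[M] u) 0 := by
      rw [hs.tsum_eq_zero_add, pow_zero, one_mul, add_sub_cancel_left]
      exact tsum_congr fun j => by ring
    rw [tsum_mul_right] at h2
    have h3 : ∑' j, w ^ j * ((fwdDiff 1)^[M + 1] u) j
        = (∑' j, w ^ j * ((fwdDiff 1)^[M] u) (j + 1)) - ∑' j, w ^ j * ((fwdDiff 1)^[M] u) j := by
      rw [← hs1.tsum_sub hs]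
      refine tsum_congr fun j => ?_
      rw [Function.iterate_succ_apply', fwdDiff]
      ring
    rw [ih, Finset.sum_range_succ, h3, add_assoc]
    congr 1
    generalize (∑' j, w ^ j * ((fwdDiff 1)^[M] u) (j + 1)) = A at *
    generalize (∑' j, w ^ j * ((fwdDiff 1)^[M] u) j) = B at *
    generalize ((fwdDiff 1)^[M] u) 0 = D at *
    have hD : D = B - A * w := by rw [h2]; ring
    rw [hD, div_pow, div_pow]
    field_simp
    ring

/-- Sum by parts in `j` for every `m`, then in `m` for the finitely many `i < M` left. The first
remainder is a full double sum, hence `B * B`; the second is a finite family of single sums. -/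
theorem norm_tsum_sub_abelSum_le {w₁ w₂ : ℂ} (hw₁ : ‖w₁‖ = 1) (hw₁' : w₁ ≠ 1) (hw₂ : ‖w₂‖ = 1)
    (hw₂' : w₂ ≠ 1) {g : ℕ → ℕ → ℂ} (hg : Summable fun p : ℕ × ℕ => g p.1 p.2) {M : ℕ}
    {β : ℕ → ℝ} {δ B : ℝ} (hδ : 0 ≤ δ) (hβ0 : ∀ j, 0 ≤ β j) (hβ1 : ∀ j, β j ≤ 1) (hβ : HasSum β B)
    (h₁ : ∀ j m, ‖((fwdDiff 1)^[M] fun i => g i m) j‖ ≤ δ * (β j * β m))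
    (h₂ : ∀ j m, ‖((fwdDiff 1)^[M] fun l => g j l) m‖ ≤ δ * (β j * β m)) :
    ‖∑' p : ℕ × ℕ, w₁ ^ p.1 * w₂ ^ p.2 * g p.1 p.2
        - abelSum w₁ M fun j => abelSum w₂ M fun m => g j m‖
      ≤ ‖w₁ / (1 - w₁)‖ ^ M * (δ * (B * B))
        + (∑ i ∈ Finset.range M, ‖abelWeight w₁ M i‖) * (‖w₂ / (1 - w₂)‖ ^ M * (δ * B)) := by
  have hg' : Summable fun p : ℕ × ℕ => g p.2 p.1 := hg.prod_symm
  have hs : Summable fun p : ℕ × ℕ => w₁ ^ p.2 * w₂ ^ p.1 * g p.2 p.1 :=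
    Summable.of_norm (by simpa [hw₁, hw₂] using hg'.norm)
  have hrow : ∀ i, Summable fun m => g i m := fun i => hg.prod_factor i
  have hcol : ∀ m, Summable fun i => g i m := fun m => hg'.prod_factor m
  set R : ℕ → ℂ := fun m => ∑' j, w₁ ^ j * ((fwdDiff 1)^[M] fun i => g i m) j with hR
  have hRb : ∀ m, ‖R m‖ ≤ δ * (B * β m) := fun m => by
    refine tsum_of_norm_bounded (((hβ.mul_right (β m))).mul_left δ) fun j => ?_
    rw [norm_mul, norm_pow, hw₁, one_pow, one_mul]
    exact h₁ j m
  have hRs : Summable R := Summable.of_norm_bounded ((hβ.summable.mul_left B).mul_left δ) hRb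
  have hinner : ∀ m, ∑' j, w₁ ^ j * w₂ ^ m * g j m
      = ∑ i ∈ Finset.range M, abelWeight w₁ M i * (w₂ ^ m * g i m)
        + (w₁ / (1 - w₁)) ^ M * (w₂ ^ m * R m) := fun m => by
    have h := tsum_eq_abelSum_add hw₁ hw₁' (hcol m) M
    have e : ∑' j, w₁ ^ j * w₂ ^ m * g j m = w₂ ^ m * ∑' j, w₁ ^ j * g j m := by
      rw [← tsum_mul_left]
      exact tsum_congr fun j => by ring
    rw [e, h, abelSum, mul_add, Finset.mul_sum]
    congr 1
    · exact Finset.sum_congr rfl fun i _ => by ring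
    · simp only [hR]; ring
  have hmain : ∑' p : ℕ × ℕ, w₁ ^ p.1 * w₂ ^ p.2 * g p.1 p.2
      = ∑ i ∈ Finset.range M, abelWeight w₁ M i * (∑' m, w₂ ^ m * g i m)
        + (w₁ / (1 - w₁)) ^ M * ∑' m, w₂ ^ m * R m := by
    rw [← (Equiv.prodComm ℕ ℕ).tsum_eq]
    refine (hs.tsum_prod).trans ?_
    refine (tsum_congr hinner).trans ?_
    rw [Summable.tsum_add (summable_sum fun i _ => (summable_pow_mul hw₂ (hrow i)).mul_left _)
      ((summable_pow_mul hw₂ hRs).mul_left _), tsum_mul_left,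
      Summable.tsum_finsetSum fun i _ => (summable_pow_mul hw₂ (hrow i)).mul_left _]
    simp only [tsum_mul_left]
  have hdiff : ∑' p : ℕ × ℕ, w₁ ^ p.1 * w₂ ^ p.2 * g p.1 p.2
        - abelSum w₁ M (fun j => abelSum w₂ M fun m => g j m)
      = (w₁ / (1 - w₁)) ^ M * (∑' m, w₂ ^ m * R m)
        + ∑ i ∈ Finset.range M, abelWeight w₁ M i *
          ((w₂ / (1 - w₂)) ^ M * ∑' m, w₂ ^ m * ((fwdDiff 1)^[M] fun l => g i l) m) := by
    rw [hmain, abelSum, add_comm, add_sub_assoc, ← Finset.sum_sub_distrib]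
    congr 1
    refine Finset.sum_congr rfl fun i _ => ?_
    rw [tsum_eq_abelSum_add hw₂ hw₂' (hrow i) M]
    ring
  rw [hdiff]
  refine (norm_add_le _ _).trans (add_le_add ?_ ?_)
  · rw [norm_mul, norm_pow]
    refine mul_le_mul_of_nonneg_left ?_ (by positivity)
    refine tsum_of_norm_bounded ((hβ.mul_left B).mul_left δ) fun m => ?_
    rw [norm_mul, norm_pow, hw₂, one_pow, one_mul]
    exact hRb m
  · rw [Finset.sum_mul]
    refine (norm_sum_le _ _).trans (Finset.sum_le_sum fun i _ => ?_)
    rw [norm_mul, norm_mul, norm_pow]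
    refine mul_le_mul_of_nonneg_left (mul_le_mul_of_nonneg_left ?_ (by positivity)) (norm_nonneg _)
    refine tsum_of_norm_bounded (hβ.mul_left δ) fun m => ?_
    rw [norm_mul, norm_pow, hw₂, one_pow, one_mul]
    refine (h₂ i m).trans (mul_le_mul_of_nonneg_left ?_ hδ)
    exact mul_le_of_le_one_left (hβ0 m) (hβ1 i)

/-- Finite differences are bounded by derivatives. -/
theorem norm_fwdDiff_iter_le {M : ℕ} {u : ℂ → ℂ} (hu : Differentiable ℂ u) {x C : ℝ}
    (h : ∀ y : ℝ, x ≤ y → y ≤ x + M → ‖iteratedDeriv M u y‖ ≤ C) :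
    ‖((fwdDiff 1)^[M] u) (x : ℂ)‖ ≤ C := by
  induction M generalizing u x with
  | zero => simpa using h x le_rfl (by simp)
  | succ M ih =>
    rw [Function.iterate_succ_apply]
    have hsmooth : ∀ n : WithTop ℕ∞, ContDiff ℂ n u := fun n => hu.contDiff
    have hu1 : Differentiable ℂ fun z => u (z + 1) := hu.comp (differentiable_id.add_const 1)
    -- Derivatives commute with the difference operator, so one difference is handled by the mean
    -- value inequality on `[y, y + 1]`.
    refine ih (u := fwdDiff 1 u) (hu1.sub hu) fun y hy1 hy2 => ?_
    have e : iteratedDeriv M (fwdDiff 1 u) (y : ℂ)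
        = iteratedDeriv M u ((y + 1 : ℝ) : ℂ) - iteratedDeriv M u (y : ℂ) := by
      have h1 : fwdDiff 1 u = fun z => u (z + 1) - u z := rfl
      rw [h1, iteratedDeriv_fun_sub (hu1.contDiff.contDiffAt) (hsmooth _).contDiffAt,
        iteratedDeriv_comp_add_const]
      push_cast
      rfl
    rw [e]
    have hd : Differentiable ℂ (iteratedDeriv M u) :=
      (hsmooth ⊤).differentiable_iteratedDeriv M (by exact_mod_cast WithTop.coe_lt_top _)
    have hc : ∀ s ∈ Set.Icc y (y + 1), HasDerivWithinAt (fun s : ℝ => iteratedDeriv M u (s : ℂ))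
        (iteratedDeriv (M + 1) u (s : ℂ)) (Set.Icc y (y + 1)) s := fun s _ => by
      rw [iteratedDeriv_succ]
      exact ((hd (s : ℂ)).hasDerivAt.comp_ofReal).hasDerivWithinAt
    have := (convex_Icc y (y + 1)).norm_image_sub_le_of_norm_hasDerivWithin_le (C := C) hc
      (fun s hs => h s (hy1.trans hs.1) ?_) (Set.left_mem_Icc.2 (by linarith))
      (Set.right_mem_Icc.2 (by linarith))
    · simpa using this
    · push_cast
      linarith [hs.2]

theorem fwdDiff_iter_natCast (U : ℂ → ℂ) (M n : ℕ) :
    ((fwdDiff 1)^[M] fun j : ℕ => U j) n = ((fwdDiff 1)^[M] U) (n : ℂ) := by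
  simp [fwdDiff_iter_eq_sum_shift]

end

/-! ### The expansion of the cone sums -/

theorem norm_cexp_form_le {τ x y : ℝ} (hτ : 0 < τ) (hx : 0 ≤ x) (hy : 0 ≤ y) {z : ℂ}
    (hz : ‖z - x‖ = 1 / τ) :
    ‖Complex.exp (-((τ : ℂ) ^ 2 * (z ^ 2 + 10 * z * y + (y : ℂ) ^ 2) / 24))‖
      ≤ Real.exp 3 * Real.exp (-(τ ^ 2 * (x ^ 2 + y ^ 2) / 48)) := by
  rw [Complex.norm_exp, ← Real.exp_add, Real.exp_le_exp]
  obtain ⟨w, rfl⟩ : ∃ w, z = x + w := ⟨z - x, by ring⟩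
  rw [add_sub_cancel_left] at hz
  have e : (-((τ : ℂ) ^ 2 * (((x : ℂ) + w) ^ 2 + 10 * ((x : ℂ) + w) * y + (y : ℂ) ^ 2) / 24)).re
      = -(τ ^ 2 * (x ^ 2 + 10 * x * y + y ^ 2 + (2 * x * w.re + 10 * y * w.re + (w ^ 2).re)) / 24) := by
    have : -((τ : ℂ) ^ 2 * (((x : ℂ) + w) ^ 2 + 10 * ((x : ℂ) + w) * y + (y : ℂ) ^ 2) / 24)
        = ((-(τ ^ 2 * (x ^ 2 + 10 * x * y + y ^ 2) / 24) : ℝ) : ℂ)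
          + ((-(τ ^ 2 * (2 * x + 10 * y) / 24) : ℝ) : ℂ) * w + ((-(τ ^ 2 / 24) : ℝ) : ℂ) * w ^ 2 := by
      push_cast; ring
    rw [this, Complex.add_re, Complex.add_re, Complex.ofReal_re, Complex.re_ofReal_mul,
      Complex.re_ofReal_mul]
    ring
  rw [e]
  have hw : -(1 / τ) ≤ w.re := by
    rw [← hz]; exact (abs_le.1 (Complex.abs_re_le_norm w)).1
  have hw2 : -(1 / τ) ^ 2 ≤ (w ^ 2).re := by
    rw [← hz, ← norm_pow]; exact (abs_le.1 (Complex.abs_re_le_norm _)).1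
  have h1 : -(τ * (2 * x + 10 * y)) ≤ τ ^ 2 * ((2 * x + 10 * y) * w.re) := by
    have := mul_le_mul_of_nonneg_left hw (by positivity : 0 ≤ τ ^ 2 * (2 * x + 10 * y))
    refine le_trans (le_of_eq ?_) (this.trans_eq (by ring))
    field_simp
  have h2 : -1 ≤ τ ^ 2 * (w ^ 2).re := by
    have := mul_le_mul_of_nonneg_left hw2 (by positivity : 0 ≤ τ ^ 2)
    refine le_trans (le_of_eq ?_) this
    field_simp
  have h3 : 0 ≤ τ ^ 2 * (x * y) := by positivity
  -- With `X = τx`, `Y = τy`, half of `X² + Y²` absorbs the linear terms `2X + 10Y` at the cost `2 +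
  -- 50`; with the `1` from `w²` this is `53 ≤ 72 = 24 · 3`.
  nlinarith [sq_nonneg (τ * x - 2), sq_nonneg (τ * y - 10)]

/-- Cauchy's estimate on circles of radius `1/√t`, the natural scale of the Gaussian: each
difference gains a factor `√t`, while Gaussian decay in both variables is kept. -/
theorem norm_fwdDiff_coneExp_le {t y : ℝ} (ht : 0 < t) (hy : 0 ≤ y) (M : ℕ) {n : ℝ} (hn : 0 ≤ n) :
    ‖((fwdDiff 1)^[M] fun z : ℂ =>
        Complex.exp (-((t : ℂ) * (z ^ 2 + 10 * z * y + (y : ℂ) ^ 2) / 24))) (n : ℂ)‖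
      ≤ M.factorial * Real.exp 3 * √t ^ M * (Real.exp (-(t * n ^ 2 / 48)) * Real.exp (-(t * y ^ 2 / 48))) := by
  set τ := √t with hτ
  have hτ0 : 0 < τ := Real.sqrt_pos.2 ht
  have hτ2 : τ ^ 2 = t := Real.sq_sqrt ht.le
  refine norm_fwdDiff_iter_le (by fun_prop) fun x hx _ => ?_
  have hx0 : 0 ≤ x := hn.trans hx
  have h := Complex.norm_iteratedDeriv_le_of_forall_mem_sphere_norm_le M (c := (x : ℂ)) (R := 1 / τ)
    (f := fun z : ℂ => Complex.exp (-((t : ℂ) * (z ^ 2 + 10 * z * y + (y : ℂ) ^ 2) / 24)))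
    (C := Real.exp 3 * Real.exp (-(τ ^ 2 * (x ^ 2 + y ^ 2) / 48))) (by positivity)
    (Differentiable.diffContOnCl (by fun_prop)) fun z hz => by
      rw [mem_sphere_iff_norm] at hz
      have := norm_cexp_form_le hτ0 hx0 hy hz
      rw [← Complex.ofReal_pow, hτ2] at this
      rwa [hτ2]
  refine h.trans ?_
  have h4 : Real.exp (-(τ ^ 2 * (x ^ 2 + y ^ 2) / 48))
      ≤ Real.exp (-(t * n ^ 2 / 48)) * Real.exp (-(t * y ^ 2 / 48)) := by
    rw [← Real.exp_add, Real.exp_le_exp, hτ2]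
    have : t * n ^ 2 ≤ t * x ^ 2 := mul_le_mul_of_nonneg_left (pow_le_pow_left₀ hn hx 2) ht.le
    linarith
  rw [one_div, inv_pow, div_inv_eq_mul]
  calc _ = M.factorial * Real.exp 3 * τ ^ M * Real.exp (-(τ ^ 2 * (x ^ 2 + y ^ 2) / 48)) := by ring
    _ ≤ _ := mul_le_mul_of_nonneg_left h4 (by positivity)

theorem exists_tsum_gaussian_le : ∃ S : ℝ, 0 ≤ S ∧ ∀ t : ℝ, 0 < t → t ≤ 1 →
    Summable (fun j : ℕ => Real.exp (-(t * (j : ℝ) ^ 2 / 48))) ∧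
      ∑' j : ℕ, Real.exp (-(t * (j : ℝ) ^ 2 / 48)) ≤ S / t := by
  have hs : Summable fun j : ℕ => 96 * (1 / ((j : ℝ) + 1) ^ 2) :=
    ((summable_nat_add_iff 1).2 (Real.summable_one_div_nat_pow.2 one_lt_two)).mul_left 96
      |>.congr fun j => by push_cast; rfl
  refine ⟨∑' j : ℕ, 96 * (1 / ((j : ℝ) + 1) ^ 2), tsum_nonneg fun j => by positivity,
    fun t ht ht1 => ?_⟩
  have hb : ∀ j : ℕ, Real.exp (-(t * (j : ℝ) ^ 2 / 48)) ≤ 96 * (1 / ((j : ℝ) + 1) ^ 2) * (1 / t) := by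
    intro j
    have h1 : 1 + t * (j : ℝ) ^ 2 / 48 ≤ Real.exp (t * (j : ℝ) ^ 2 / 48) := by
      linarith [Real.add_one_le_exp (t * (j : ℝ) ^ 2 / 48)]
    rw [Real.exp_neg, inv_le_comm₀ (Real.exp_pos _) (by positivity)]
    refine le_trans ?_ h1
    rw [mul_one_div, mul_one_div, div_div, inv_div]
    nlinarith [mul_nonneg ht.le (sq_nonneg ((j : ℝ) - 1))]
  have hs' := hs.mul_right (1 / t)
  have hsum := Summable.of_nonneg_of_le (fun j => (Real.exp_pos _).le) hb hs'
  refine ⟨hsum, (hsum.tsum_le_tsum hb hs').trans_eq ?_⟩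
  rw [tsum_mul_right, mul_one_div]

theorem summable_coneExp_succ {t : ℝ} (ht : 0 < t) :
    Summable fun p : ℕ × ℕ => coneExp t p.1 (p.2 + 1 : ℕ) := by
  have hi : Function.Injective fun p : ℕ × ℕ => (p.1, p.2 + 1) := fun a b h => by
    simp only [Prod.mk.injEq] at h
    ext <;> omega
  have h := (summable_coneExp ht).comp_injective hi
  refine h.congr fun p => ?_
  simp only [Function.comp_apply]

theorem ofReal_coneExp (t x y : ℝ) :
    (coneExp t x y : ℂ)
      = Complex.exp (-((t : ℂ) * ((x : ℂ) ^ 2 + 10 * x * y + (y : ℂ) ^ 2) / 24)) := by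
  rw [coneExp]; push_cast; rfl

theorem norm_fwdDiff_coneExp_natCast_le {t y : ℝ} (ht : 0 < t) (hy : 0 ≤ y) (M n : ℕ) :
    ‖((fwdDiff 1)^[M] fun i : ℕ => (coneExp t i y : ℂ)) n‖
      ≤ M.factorial * Real.exp 3 * √t ^ M *
        (Real.exp (-(t * (n : ℝ) ^ 2 / 48)) * Real.exp (-(t * y ^ 2 / 48))) := by
  have h := norm_fwdDiff_coneExp_le ht hy M (Nat.cast_nonneg n)
  rw [Complex.ofReal_natCast, ← fwdDiff_iter_natCast] at h
  simp only [ofReal_coneExp, Complex.ofReal_natCast]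
  exact h

/-- The `M` differences give `√t^M = t^(K+2)`, and the two Gaussian sums cost at most `(S/t)²`; this
dictates `M = 2K + 4`. -/
theorem coneSum_sub_isBigO {w₁ w₂ : ℂ} (hw₁ : ‖w₁‖ = 1) (hw₁' : w₁ ≠ 1) (hw₂ : ‖w₂‖ = 1)
    (hw₂' : w₂ ≠ 1) {K M : ℕ} (hM : M = 2 * K + 4) :
    (fun t : ℝ => (∑' p : ℕ × ℕ, w₁ ^ p.1 * w₂ ^ p.2 * (coneExp t p.1 (p.2 + 1 : ℕ) : ℂ))
        - abelSum w₁ M fun j => abelSum w₂ M fun m =>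
            (coneExp t j (m + 1 : ℕ) : ℂ)) =O[𝓝[>] 0] fun t : ℝ => t ^ K := by
  obtain ⟨S, hS0, hS⟩ := exists_tsum_gaussian_le
  obtain ⟨C₀, hC₀⟩ : ∃ C₀ : ℝ, M.factorial * Real.exp 3 = C₀ := ⟨_, rfl⟩
  have hC₀0 : 0 ≤ C₀ := hC₀ ▸ by positivity
  set C₁ : ℝ := ‖w₁ / (1 - w₁)‖ ^ M with hC₁
  set C₂ : ℝ := (∑ i ∈ Finset.range M, ‖abelWeight w₁ M i‖) * ‖w₂ / (1 - w₂)‖ ^ M with hC₂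
  have hC₂0 : 0 ≤ C₂ := mul_nonneg (Finset.sum_nonneg fun _ _ => norm_nonneg _) (by positivity)
  refine IsBigO.of_bound (C₁ * (C₀ * (S * S)) + C₂ * (C₀ * S)) ?_
  filter_upwards [Ioo_mem_nhdsGT (zero_lt_one' ℝ)] with t ht
  obtain ⟨ht0, ht1⟩ := ht
  obtain ⟨hsum, hB⟩ := hS t ht0 ht1.le
  set β : ℕ → ℝ := fun j => Real.exp (-(t * (j : ℝ) ^ 2 / 48)) with hβ
  have hβ1 : ∀ j, β j ≤ 1 := fun j => Real.exp_le_one_iff.2 (neg_nonpos.2 (by positivity))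
  have hβs : ∀ m : ℕ, Real.exp (-(t * ((m + 1 : ℕ) : ℝ) ^ 2 / 48)) ≤ β m := fun m => by
    rw [hβ, Real.exp_le_exp, neg_le_neg_iff]
    push_cast
    gcongr
    linarith
  have hgs : Summable fun p : ℕ × ℕ => (coneExp t p.1 (p.2 + 1 : ℕ) : ℂ) := by
    have h := summable_coneExp_succ ht0
    rw [← Complex.summable_ofReal] at h
    exact h
  have h₀ : ∀ (n : ℕ) (y : ℝ), 0 ≤ y → ‖((fwdDiff 1)^[M] fun i : ℕ => (coneExp t i y : ℂ)) n‖
      ≤ C₀ * √t ^ M * (β n * Real.exp (-(t * y ^ 2 / 48))) := fun n y hy => by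
    rw [← hC₀]
    exact norm_fwdDiff_coneExp_natCast_le ht0 hy M n
  have h₁ : ∀ j m : ℕ, ‖((fwdDiff 1)^[M] fun i : ℕ => (coneExp t i (m + 1 : ℕ) : ℂ)) j‖
      ≤ C₀ * √t ^ M * (β j * β m) := fun j m => by
    have h3 : β j * Real.exp (-(t * ((m + 1 : ℕ) : ℝ) ^ 2 / 48)) ≤ β j * β m :=
      mul_le_mul_of_nonneg_left (hβs m) (Real.exp_pos _).le
    exact (h₀ j _ (Nat.cast_nonneg (m + 1))).trans (mul_le_mul_of_nonneg_left h3 (by positivity))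
  have h₂ : ∀ j m : ℕ, ‖((fwdDiff 1)^[M] fun l : ℕ => (coneExp t j (l + 1 : ℕ) : ℂ)) m‖
      ≤ C₀ * √t ^ M * (β j * β m) := fun j m => by
    have h3 : β (m + 1) * Real.exp (-(t * (j : ℝ) ^ 2 / 48)) ≤ β j * β m := by
      rw [mul_comm (β j)]
      exact mul_le_mul_of_nonneg_right (hβs m) (Real.exp_pos _).le
    rw [fwdDiff_iter_comp_add 1 (fun l : ℕ => (coneExp t j (l : ℕ) : ℂ))]
    simp only [coneExp_comm t j]
    exact (h₀ (m + 1) _ (Nat.cast_nonneg j)).trans (mul_le_mul_of_nonneg_left h3 (by positivity))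
  have h := norm_tsum_sub_abelSum_le hw₁ hw₁' hw₂ hw₂'
    (g := fun j m => (coneExp t j (m + 1 : ℕ) : ℂ)) hgs (δ := C₀ * √t ^ M) (by positivity)
    (fun j => (Real.exp_pos _).le) hβ1 hsum.hasSum h₁ h₂
  refine h.trans ?_
  have hτ : √t ^ M = t ^ K * (t * t) := by
    rw [hM, pow_add, pow_mul, Real.sq_sqrt ht0.le, show (4 : ℕ) = 2 * 2 from rfl, pow_mul,
      Real.sq_sqrt ht0.le, sq]
  have hB0 : 0 ≤ ∑' j, β j := tsum_nonneg fun j => (Real.exp_pos _).le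
  have hBt : t * ∑' j, β j ≤ S := by
    rw [mul_comm]; exact (le_div_iff₀ ht0).1 hB
  have hBt0 : 0 ≤ t * ∑' j, β j := by positivity
  rw [Real.norm_of_nonneg (by positivity), hτ, ← hC₁, add_mul]
  refine add_le_add ?_ ?_
  · calc C₁ * (C₀ * (t ^ K * (t * t)) * ((∑' j, β j) * ∑' j, β j))
        = C₁ * C₀ * t ^ K * ((t * ∑' j, β j) * (t * ∑' j, β j)) := by ring
      _ ≤ C₁ * C₀ * t ^ K * (S * S) :=
        mul_le_mul_of_nonneg_left (mul_le_mul hBt hBt hBt0 hS0) (by positivity)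
      _ = _ := by ring
  · rw [← mul_assoc, ← hC₂]
    calc C₂ * (C₀ * (t ^ K * (t * t)) * ∑' j, β j)
        = C₂ * C₀ * t ^ K * (t * (t * ∑' j, β j)) := by ring
      _ ≤ C₂ * C₀ * t ^ K * (1 * S) :=
        mul_le_mul_of_nonneg_left (mul_le_mul ht1.le hBt hBt0 zero_le_one) (by positivity)
      _ = _ := by ring

/-- The `N`-th power of the form `x ^ 2 + 10 * x * y + y ^ 2`, with each monomial `x ^ a * y ^ b`
replaced by `r a * s b`. -/
noncomputable def formMoment (N : ℕ) (r s : ℕ → ℂ) : ℂ :=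
  ∑ i ∈ Finset.range (N + 1), ∑ k ∈ Finset.range (i + 1),
    (N.choose i * i.choose k * 10 ^ (i - k) : ℕ) *
      (r (2 * k + (i - k)) * s ((i - k) + 2 * (N - i)))

theorem formMoment_pow (N : ℕ) (x y : ℂ) :
    formMoment N (fun a => x ^ a) (fun b => y ^ b) = (x ^ 2 + 10 * x * y + y ^ 2) ^ N := by
  rw [add_pow (x ^ 2 + 10 * x * y), formMoment]
  refine Finset.sum_congr rfl fun i _ => ?_
  rw [add_pow, Finset.sum_mul, Finset.sum_mul]
  refine Finset.sum_congr rfl fun k _ => ?_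
  push_cast
  rw [pow_add, pow_add, pow_mul, pow_mul, mul_pow, mul_pow]
  ring

theorem formMoment_sum_left {ι : Type*} (N : ℕ) (I : Finset ι) (c : ι → ℂ) (r : ι → ℕ → ℂ)
    (s : ℕ → ℂ) :
    formMoment N (fun a => ∑ i ∈ I, c i * r i a) s = ∑ i ∈ I, c i * formMoment N (r i) s := by
  simp only [formMoment, Finset.mul_sum, Finset.sum_mul]
  rw [Finset.sum_comm (s := I)]
  refine Finset.sum_congr rfl fun i _ => ?_
  rw [Finset.sum_comm (s := I)]
  exact Finset.sum_congr rfl fun k _ => Finset.sum_congr rfl fun j _ => by ring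

theorem formMoment_sum_right {ι : Type*} (N : ℕ) (I : Finset ι) (c : ι → ℂ) (r : ℕ → ℂ)
    (s : ι → ℕ → ℂ) :
    formMoment N r (fun a => ∑ i ∈ I, c i * s i a) = ∑ i ∈ I, c i * formMoment N r (s i) := by
  simp only [formMoment, Finset.mul_sum]
  rw [Finset.sum_comm (s := I)]
  refine Finset.sum_congr rfl fun i _ => ?_
  rw [Finset.sum_comm (s := I)]
  exact Finset.sum_congr rfl fun k _ => Finset.sum_congr rfl fun j _ => by ring

/-- The regularized moments `∑ w ^ j * j ^ a`. -/
noncomputable def abelMoment (w : ℂ) (a : ℕ) : ℂ :=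
  abelSum w (a + 1) fun j => (j : ℂ) ^ a

/-- The regularized moments `∑ w ^ j * (j + 1) ^ a`. -/
noncomputable def abelMomentSucc (w : ℂ) (a : ℕ) : ℂ :=
  abelSum w (a + 1) fun j => ((j + 1 : ℕ) : ℂ) ^ a

theorem fwdDiff_iter_natCast_pow {a M : ℕ} (h : a < M) (n : ℕ) :
    ((fwdDiff 1)^[M] fun j : ℕ => (j : ℂ) ^ a) n = 0 := by
  rw [fwdDiff_iter_natCast fun z => z ^ a, fwdDiff_iter_pow_eq_zero_of_lt h]
  rfl

/-- Differences of order above `a` kill `j^a`, so the regularized moment does not depend on the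
number of summations by parts. -/
theorem abelSum_pow (w : ℂ) {a M : ℕ} (h : a < M) :
    (abelSum w M fun j => (j : ℂ) ^ a) = abelMoment w a := by
  rw [abelMoment, abelSum_eq_sum_fwdDiff, abelSum_eq_sum_fwdDiff,
    ← Finset.sum_subset (Finset.range_subset_range.2 (Nat.succ_le_of_lt h))]
  intro i _ hi
  rw [Finset.mem_range, not_lt] at hi
  rw [fwdDiff_iter_natCast_pow (by omega), mul_zero]

theorem abelSum_succ_pow (w : ℂ) {a M : ℕ} (h : a < M) :
    (abelSum w M fun j => ((j + 1 : ℕ) : ℂ) ^ a) = abelMomentSucc w a := by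
  rw [abelMomentSucc, abelSum_eq_sum_fwdDiff, abelSum_eq_sum_fwdDiff,
    ← Finset.sum_subset (Finset.range_subset_range.2 (Nat.succ_le_of_lt h))]
  intro i _ hi
  rw [Finset.mem_range, not_lt] at hi
  rw [fwdDiff_iter_comp_add 1 (fun j : ℕ => (j : ℂ) ^ a), fwdDiff_iter_natCast_pow (by omega), mul_zero]

theorem mul_abelMomentSucc {w : ℂ} (hw : w ≠ 1) (a : ℕ) :
    w * abelMomentSucc w a = abelMoment w a - if a = 0 then 1 else 0 := by
  have h := abelSum_sub_shift hw (a + 1) fun j : ℕ => (j : ℂ) ^ a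
  rw [fwdDiff_iter_natCast_pow a.lt_succ_self, mul_zero, sub_zero] at h
  rw [abelMomentSucc, abelMoment, sub_eq_iff_eq_add.1 h]
  simp [zero_pow_eq]

/-- The shift rule `∑ w^j j^a - w ∑ w^j (j+1)^a = 0^a` survives regularization; expand `(j+1)^a` by
the binomial theorem. -/
theorem abelMoment_rec {w : ℂ} (hw : w ≠ 1) (a : ℕ) :
    abelMoment w a - w * ∑ i ∈ Finset.range (a + 1), a.choose i * abelMoment w i
      = if a = 0 then 1 else 0 := by
  have e : abelMomentSucc w a = ∑ i ∈ Finset.range (a + 1), a.choose i * abelMoment w i := by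
    rw [abelMomentSucc, Finset.sum_congr rfl fun i hi => by
      rw [← abelSum_pow w (Finset.mem_range.1 hi)]]
    simp only [abelSum, Finset.mul_sum]
    rw [Finset.sum_comm]
    refine Finset.sum_congr rfl fun j _ => ?_
    push_cast
    rw [add_pow, Finset.mul_sum]
    exact Finset.sum_congr rfl fun i _ => by rw [one_pow]; ring
  rw [← e, mul_abelMomentSucc hw]
  ring

/-- Up to `O(t^K)` the sum is a finite combination of exponentials in `t`. The coefficient of `t^N`
is the Abel sum of the `N`-th power of the form, which by bilinearity splits into products of
moments. These have degree at most `2N < M`, hence are independent of `K`. -/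
theorem hasExpansion_coneSum {w₁ w₂ : ℂ} (hw₁ : ‖w₁‖ = 1) (hw₁' : w₁ ≠ 1) (hw₂ : ‖w₂‖ = 1)
    (hw₂' : w₂ ≠ 1) :
    HasExpansion
      (fun t : ℝ => ∑' p : ℕ × ℕ, w₁ ^ p.1 * w₂ ^ p.2 * (coneExp t p.1 (p.2 + 1 : ℕ) : ℂ))
      (PowerSeries.mk fun N => (-1 / 24) ^ N / (N.factorial : ℂ) *
        formMoment N (abelMoment w₁) (abelMomentSucc w₂)) := by
  refine HasExpansion.of_approx fun K => ?_
  obtain ⟨M, hM⟩ : ∃ M, M = 2 * K + 4 := ⟨_, rfl⟩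
  have hexp : ∀ j m : ℕ, HasExpansion (fun t : ℝ => (coneExp t j (m + 1 : ℕ) : ℂ))
      (PowerSeries.rescale (-1 / 24 * ((j : ℂ) ^ 2 + 10 * j * (m + 1 : ℕ) + ((m + 1 : ℕ) : ℂ) ^ 2))
        (PowerSeries.exp ℂ)) := fun j m => by
    convert! HasExpansion.exp (-1 / 24 * ((j : ℂ) ^ 2 + 10 * j * (m + 1 : ℕ) + ((m + 1 : ℕ) : ℂ) ^ 2))
      using 2 with t
    rw [ofReal_coneExp]
    push_cast
    ring_nf
  refine ⟨_, _, HasExpansion.sum (Finset.range M) fun j _ => (HasExpansion.sum (Finset.range M)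
    fun m _ => (hexp j m).const_mul (abelWeight w₂ M m)).const_mul (abelWeight w₁ M j),
    coneSum_sub_isBigO hw₁ hw₁' hw₂ hw₂' hM, fun N hN => ?_⟩
  have hr : formMoment N (abelMoment w₁) (abelMomentSucc w₂)
      = formMoment N (fun a => ∑ j ∈ Finset.range M, abelWeight w₁ M j * (j : ℂ) ^ a)
        (fun b => ∑ m ∈ Finset.range M, abelWeight w₂ M m * ((m + 1 : ℕ) : ℂ) ^ b) := by
    refine Finset.sum_congr rfl fun i hi => Finset.sum_congr rfl fun k hk => ?_
    rw [Finset.mem_range] at hi hk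
    congr 2
    · exact (abelSum_pow w₁ (by omega)).symm
    · exact (abelSum_succ_pow w₂ (by omega)).symm
  rw [PowerSeries.coeff_mk, hr, formMoment_sum_left]
  simp only [formMoment_sum_right, formMoment_pow, map_sum, PowerSeries.coeff_C_mul, PowerSeries.coeff_rescale,
    PowerSeries.coeff_exp, Finset.mul_sum]
  refine Finset.sum_congr rfl fun j _ => Finset.sum_congr rfl fun m _ => ?_
  rw [mul_pow]
  simp
  ring

/-! ### Growth of the regularized moments -/

/-- The function `(1 - exp (-y)) / y`, extended by continuity. -/
noncomputable def expSlope : ℂ → ℂ := dslope (fun y : ℂ => 1 - Complex.exp (-y)) 0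

theorem mul_expSlope (y : ℂ) : y * expSlope y = 1 - Complex.exp (-y) := by
  have := sub_smul_dslope (fun y : ℂ => 1 - Complex.exp (-y)) 0 y
  rw [sub_zero, smul_eq_mul] at this
  rw [expSlope, this]
  simp

theorem expSlope_zero : expSlope 0 = 1 := by
  rw [expSlope, dslope_same]
  have h : HasDerivAt (fun y : ℂ => 1 - Complex.exp (-y)) (-(Complex.exp (-0) * -1)) 0 :=
    ((hasDerivAt_neg (0 : ℂ)).cexp).const_sub 1
  simpa using h.deriv

theorem one_sub_exp_ne_zero {y : ℂ} (h0 : y ≠ 0) (h : ‖y‖ < 2 * Real.pi) :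
    1 - Complex.exp (-y) ≠ 0 := by
  intro he
  obtain ⟨n, hn⟩ := Complex.exp_eq_one_iff.1 (sub_eq_zero.1 he).symm
  have hn' : ‖y‖ = |(n : ℝ)| * (2 * Real.pi) := by
    rw [← norm_neg, hn, norm_mul]
    simp [abs_of_pos Real.pi_pos]
  rcases eq_or_ne n 0 with rfl | hne
  · simp at hn
    exact h0 hn
  · have : (1 : ℝ) ≤ |(n : ℝ)| := by exact_mod_cast Int.one_le_abs hne
    nlinarith [Real.pi_pos]

theorem expSlope_ne_zero {y : ℂ} (h : ‖y‖ < 2 * Real.pi) : expSlope y ≠ 0 := by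
  rcases eq_or_ne y 0 with rfl | h0
  · rw [expSlope_zero]; exact one_ne_zero
  · intro he
    have := mul_expSlope y
    rw [he, mul_zero] at this
    exact one_sub_exp_ne_zero h0 h this.symm

/-- The function `1 / (1 - exp (-y)) - 1 / y`, extended by continuity. -/
noncomputable def expPolar : ℂ → ℂ := dslope (fun y => (expSlope y)⁻¹) 0

theorem differentiableOn_expPolar :
    DifferentiableOn ℂ expPolar (Metric.ball 0 (2 * Real.pi)) := by
  have hmem : Metric.ball (0 : ℂ) (2 * Real.pi) ∈ 𝓝 0 := Metric.ball_mem_nhds _ (by positivity)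
  refine (Complex.differentiableOn_dslope hmem).2 (DifferentiableOn.inv ?_ fun y hy =>
    expSlope_ne_zero (by simpa using hy))
  exact (Complex.differentiableOn_dslope hmem).2 (Differentiable.differentiableOn (by fun_prop))

/-- The identity `1/(1 - exp (-y)) = 1/y + expPolar y`, cleared of denominators so that it also
holds at `y = 0`. -/
theorem expPolar_spec {y : ℂ} (h : ‖y‖ < 2 * Real.pi) :
    (1 + y * expPolar y) * (1 - Complex.exp (-y)) = y := by
  have h1 : y * expPolar y = (expSlope y)⁻¹ - 1 := by
    have := sub_smul_dslope (fun y => (expSlope y)⁻¹) 0 y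
    rwa [sub_zero, smul_eq_mul, expSlope_zero, inv_one] at this
  rw [h1, add_sub_cancel, ← mul_expSlope, mul_comm, mul_assoc, mul_inv_cancel₀ (expSlope_ne_zero h),
    mul_one]

theorem HasExpansion.of_hasFPowerSeriesAt {f : ℂ → ℂ} {p : FormalMultilinearSeries ℂ ℂ ℂ}
    (h : HasFPowerSeriesAt f p 0) :
    HasExpansion (fun t : ℝ => f t) (PowerSeries.mk fun n => p.coeff n) := fun K => by
  have h1 := h.isBigO_sub_partialSum_pow K
  have hc : Tendsto (fun t : ℝ => (t : ℂ)) (𝓝[>] 0) (𝓝 0) := by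
    have h : ContinuousAt (fun t : ℝ => (t : ℂ)) 0 := by fun_prop
    simpa using h.tendsto.mono_left nhdsWithin_le_nhds
  have h2 := h1.comp_tendsto hc
  refine (h2.congr_left fun t => ?_).trans (IsBigO.of_bound 1 (Eventually.of_forall fun t => by simp))
  simp only [Function.comp_apply, zero_add, FormalMultilinearSeries.partialSum,
    FormalMultilinearSeries.apply_eq_pow_smul_coeff, smul_eq_mul]
  congr 1
  rw [← Polynomial.eval₂_id, PowerSeries.eval₂_trunc_eq_sum_range]
  simp [mul_comm]

theorem exp_neg_mul_I_ne_one {θ : ℝ} (h0 : θ ≠ 0) (h : |θ| < 2 * Real.pi) :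
    Complex.exp (-(θ * Complex.I)) ≠ 1 := fun he =>
  one_sub_exp_ne_zero (y := θ * Complex.I) (by simp [h0]) (by simpa using h)
    (by rw [he, sub_self])

/-- The recursion for the moments as a generating function: formally `∑ w^j exp (-jx) = 1/(1 - w exp
(-x))`. -/
theorem abelMoment_powerSeries {w : ℂ} (hw : w ≠ 1) :
    (PowerSeries.mk fun a => (-1) ^ a * abelMoment w a / (a.factorial : ℂ)) *
      (1 - PowerSeries.C w * PowerSeries.rescale (-1) (PowerSeries.exp ℂ)) = 1 := by
  ext a
  rw [mul_sub, mul_one, map_sub, mul_left_comm, PowerSeries.coeff_C_mul, PowerSeries.coeff_mul,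
    Finset.Nat.sum_antidiagonal_eq_sum_range_succ_mk, PowerSeries.coeff_mk, PowerSeries.coeff_one]
  have h := abelMoment_rec hw a
  have ha : (a.factorial : ℂ) ≠ 0 := by exact_mod_cast a.factorial_ne_zero
  have e : ∑ k ∈ Finset.range a.succ,
      (PowerSeries.coeff k) (PowerSeries.mk fun a => (-1) ^ a * abelMoment w a / (a.factorial : ℂ)) *
        (PowerSeries.coeff (a - k)) (PowerSeries.rescale (-1) (PowerSeries.exp ℂ))
      = (-1) ^ a / (a.factorial : ℂ) *
        ∑ i ∈ Finset.range (a + 1), a.choose i * abelMoment w i := by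
    rw [Finset.mul_sum]
    refine Finset.sum_congr rfl fun k hk => ?_
    have hk : k ≤ a := Nat.lt_succ_iff.1 (Finset.mem_range.1 hk)
    have h1 : (k.factorial : ℂ) ≠ 0 := by exact_mod_cast k.factorial_ne_zero
    have h2 : ((a - k).factorial : ℂ) ≠ 0 := by exact_mod_cast (a - k).factorial_ne_zero
    rw [PowerSeries.coeff_mk, PowerSeries.coeff_rescale, PowerSeries.coeff_exp, Nat.cast_choose ℂ hk,
      show ((-1 : ℂ)) ^ a = (-1) ^ k * (-1) ^ (a - k) by rw [← pow_add]; congr 1; omega]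
    simp
    field_simp
  rw [e]
  have e2 : ∀ A B : ℂ, (-1) ^ a * A / (a.factorial : ℂ) - w * ((-1) ^ a / (a.factorial : ℂ) * B)
      = (-1) ^ a / (a.factorial : ℂ) * (A - w * B) := fun A B => by ring
  rw [e2, h]
  split_ifs with h0 <;> simp [h0]

/-- With `w = exp (-s)` the generating function is `1/(x+s) + expPolar (x+s)`. The first summand
produces the factorial main term; the second is holomorphic on `|x| ≤ ρ`, so Cauchy's estimate
bounds its coefficients by `C ρ^(-a)`. -/
theorem exists_abelMoment_sub_le {θ ρ : ℝ} (h0 : θ ≠ 0) (hρ : 0 < ρ) (h : |θ| + ρ < 2 * Real.pi) :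
    ∃ C, 0 ≤ C ∧ ∀ a, ‖abelMoment (Complex.exp (-(θ * Complex.I))) a
      - a.factorial * ((θ * Complex.I)⁻¹) ^ (a + 1)‖ ≤ C * (a.factorial * ρ⁻¹ ^ a) := by
  set s : ℂ := θ * Complex.I with hs
  have hs0 : s ≠ 0 := by simp [hs, h0]
  have hsn : ‖s‖ = |θ| := by simp [hs]
  have hw := exp_neg_mul_I_ne_one h0 (by linarith : |θ| < 2 * Real.pi)
  set E : ℂ → ℂ := fun x => expPolar (x + s) with hE
  have hlt : ∀ x : ℂ, ‖x‖ ≤ ρ → ‖x + s‖ < 2 * Real.pi := fun x hx =>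
    (norm_add_le _ _).trans_lt (by rw [hsn]; linarith)
  have hEd : DifferentiableOn ℂ E (Metric.closedBall 0 ρ) := by
    refine differentiableOn_expPolar.comp (Differentiable.differentiableOn (by fun_prop)) fun x hx => ?_
    rw [mem_closedBall_zero_iff] at hx
    rw [mem_ball_zero_iff]
    exact hlt x hx
  lift ρ to NNReal using hρ.le
  set p := cauchyPowerSeries E 0 ρ with hp
  have hps : HasFPowerSeriesOnBall E p 0 ρ := hEd.hasFPowerSeriesOnBall (by exact_mod_cast hρ)
  have hx1 := HasExpansion.of_hasFPowerSeriesAt hps.hasFPowerSeriesAt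
  set R : PowerSeries ℂ := PowerSeries.mk fun n => p.coeff n with hR
  have hXs : HasExpansion (fun t : ℝ => (t : ℂ) + s) (PowerSeries.X + PowerSeries.C s) := by
    refine HasExpansion.add (fun K => ?_) (HasExpansion.const s)
    rcases Nat.lt_or_ge 1 K with hK | hK
    · refine HasExpansion.of_eval (K := K) (p := Polynomial.X) (by simpa using isBigO_zero _ _)
        fun i hi => ?_
      rw [PowerSeries.coeff_X, Polynomial.coeff_X]
      simp only [eq_comm]
    · refine HasExpansion.of_eval (K := K) (p := 0) ?_ fun i hi => ?_
      · have := (pow_isBigO_pow hK)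
        refine IsBigO.trans (IsBigO.of_bound 1 (Eventually.of_forall fun t => ?_)) this
        simp
      · rw [PowerSeries.coeff_X, if_neg (by omega), Polynomial.coeff_zero]
  have hexp : HasExpansion (fun t : ℝ => 1 + -Complex.exp (-s) * Complex.exp (-1 * t))
      (PowerSeries.C 1 + PowerSeries.C (-Complex.exp (-s)) *
        PowerSeries.rescale (-1) (PowerSeries.exp ℂ)) :=
    (HasExpansion.const 1).add ((HasExpansion.exp (-1)).const_mul _)
  have hprod := ((HasExpansion.const 1).add (hXs.mul hx1)).mul hexp
  -- The analytic identity `expPolar_spec` at `y = t + s` passes to formal power series by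
  -- uniqueness of expansions.
  have hid : (PowerSeries.C 1 + (PowerSeries.X + PowerSeries.C s) * R) *
      (PowerSeries.C 1 + PowerSeries.C (-Complex.exp (-s)) *
        PowerSeries.rescale (-1) (PowerSeries.exp ℂ)) = PowerSeries.X + PowerSeries.C s := by
    ext i
    refine HasExpansion.of_isBigO (K := i + 1) hXs (IsBigO.congr' (isBigO_zero _ _)
      ?_ EventuallyEq.rfl) i.lt_succ_self hprod
    have : ∀ᶠ t : ℝ in 𝓝[>] 0, t ∈ Set.Ioo 0 (ρ : ℝ) := Ioo_mem_nhdsGT hρ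
    filter_upwards [this] with t ht
    have h := expPolar_spec (hlt (t : ℂ) (by
      rw [Complex.norm_real, Real.norm_of_nonneg ht.1.le]; exact ht.2.le))
    simp only [hE]
    rw [neg_add, Complex.exp_add] at h
    rw [neg_one_mul]
    linear_combination -h
  set P : PowerSeries ℂ := PowerSeries.mk fun a => (-1) ^ a * s⁻¹ ^ (a + 1) with hP
  have hPinv : (PowerSeries.X + PowerSeries.C s) * P = 1 := by
    ext i
    rw [add_mul, map_add, PowerSeries.coeff_C_mul, hP, PowerSeries.coeff_mk, PowerSeries.coeff_one]
    cases i with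
    | zero => simp [hs0]
    | succ i =>
      rw [PowerSeries.coeff_succ_X_mul, PowerSeries.coeff_mk, if_neg i.succ_ne_zero]
      linear_combination (-(-1) ^ i * s⁻¹ ^ (i + 1)) * mul_inv_cancel₀ hs0
  have hmain : (PowerSeries.mk fun a => (-1) ^ a * abelMoment (Complex.exp (-s)) a / (a.factorial : ℂ))
      = P + R := by
    have hm := abelMoment_powerSeries hw
    set Mo : PowerSeries ℂ :=
      PowerSeries.mk fun a => (-1) ^ a * abelMoment (Complex.exp (-s)) a / (a.factorial : ℂ) with hMo
    set Ex := PowerSeries.rescale (-1) (PowerSeries.exp ℂ)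
    have h3 : (P + R) * (1 - PowerSeries.C (Complex.exp (-s)) * Ex) = 1 := by
      have h4 : (PowerSeries.X + PowerSeries.C s) * ((P + R) *
          (1 - PowerSeries.C (Complex.exp (-s)) * Ex)) = (PowerSeries.X + PowerSeries.C s) := by
        rw [map_neg, map_one] at hid
        calc _ = ((PowerSeries.X + PowerSeries.C s) * P + (PowerSeries.X + PowerSeries.C s) * R) *
              (1 - PowerSeries.C (Complex.exp (-s)) * Ex) := by ring
          _ = _ := by rw [hPinv]; linear_combination hid
      calc _ = P * ((PowerSeries.X + PowerSeries.C s) * ((P + R) *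
          (1 - PowerSeries.C (Complex.exp (-s)) * Ex))) := by
            linear_combination (-((P + R) * (1 - PowerSeries.C (Complex.exp (-s)) * Ex))) * hPinv
        _ = 1 := by rw [h4, mul_comm, hPinv]
    calc Mo = Mo * ((P + R) * (1 - PowerSeries.C (Complex.exp (-s)) * Ex)) := by rw [h3, mul_one]
      _ = (Mo * (1 - PowerSeries.C (Complex.exp (-s)) * Ex)) * (P + R) := by ring
      _ = P + R := by rw [hm, one_mul]
  set C := ((2 * Real.pi)⁻¹ * ∫ u : ℝ in 0..2 * Real.pi, ‖E (circleMap 0 ρ u)‖) with hC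
  refine ⟨C, mul_nonneg (by positivity) (intervalIntegral.integral_nonneg (by positivity)
    fun _ _ => norm_nonneg _), fun a => ?_⟩
  have ha : (a.factorial : ℂ) ≠ 0 := by exact_mod_cast a.factorial_ne_zero
  have hcoef := congrArg (PowerSeries.coeff a) hmain
  rw [map_add, PowerSeries.coeff_mk, hP, hR, PowerSeries.coeff_mk, PowerSeries.coeff_mk] at hcoef
  have hsgn : ((-1 : ℂ) ^ a) * (-1) ^ a = 1 := by rw [← mul_pow]; simp
  have heq : abelMoment (Complex.exp (-s)) a - a.factorial * s⁻¹ ^ (a + 1)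
      = (-1) ^ a * a.factorial * p.coeff a := by
    have h5 : p.coeff a = (-1) ^ a * abelMoment (Complex.exp (-s)) a / (a.factorial : ℂ)
        - (-1) ^ a * s⁻¹ ^ (a + 1) := by rw [hcoef]; ring
    rw [h5]
    field_simp
    linear_combination (a.factorial * s⁻¹ ^ (a + 1) - abelMoment (Complex.exp (-s)) a) * hsgn
  rw [heq, norm_mul, norm_mul, norm_pow, norm_neg, norm_one, one_pow, one_mul, Complex.norm_natCast]
  have hb := norm_cauchyPowerSeries_le E 0 ρ a
  rw [← FormalMultilinearSeries.norm_apply_eq_norm_coef]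
  rw [← hC, abs_of_nonneg hρ.le] at hb
  calc _ ≤ (a.factorial : ℝ) * (C * (ρ : ℝ)⁻¹ ^ a) := mul_le_mul_of_nonneg_left hb (by positivity)
    _ = _ := by ring

/-! ### Size of the expansion coefficients -/

theorem factorial_mul_factorial_eq_integral (m n : ℕ) :
    (m.factorial * n.factorial : ℂ)
      = (m + n + 1).factorial * ∫ p : ℝ in 0..1, (p : ℂ) ^ m * (1 - (p : ℂ)) ^ n := by
  have h := Complex.Gamma_mul_Gamma_eq_betaIntegral (s := (m : ℂ) + 1) (t := (n : ℂ) + 1)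
    (by simp; positivity) (by simp; positivity)
  rw [Complex.Gamma_nat_eq_factorial, Complex.Gamma_nat_eq_factorial,
    show (m : ℂ) + 1 + (n + 1) = ((m + n + 1 : ℕ) : ℂ) + 1 by push_cast; ring,
    Complex.Gamma_nat_eq_factorial, Complex.betaIntegral] at h
  simpa using h

/-- The integral `∫ ((x p) ^ 2 + 10 (x p) (y (1 - p)) + (y (1 - p)) ^ 2) ^ N` over `[0, 1]`. -/
noncomputable def formInt (N : ℕ) (x y : ℝ) : ℝ :=
  ∫ p in (0 : ℝ)..1, ((x * p) ^ 2 + 10 * (x * p) * (y * (1 - p)) + (y * (1 - p)) ^ 2) ^ N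

/-- Every monomial has total degree `2N`, so the beta integral writes each `u! v!` as the same
`(2N+1)!` times `∫ p^u (1-p)^v`, and the powers of the form reassemble under the integral. -/
theorem formMoment_factorial (N : ℕ) (x y : ℝ) :
    formMoment N (fun i => i.factorial * (x : ℂ) ^ i) (fun i => i.factorial * (y : ℂ) ^ i)
      = (((2 * N + 1).factorial * formInt N x y : ℝ) : ℂ) := by
  rw [formInt, Complex.ofReal_mul, ← intervalIntegral.integral_ofReal]
  simp only [Complex.ofReal_pow, Complex.ofReal_add, Complex.ofReal_mul, Complex.ofReal_sub,
    Complex.ofReal_one, Complex.ofReal_ofNat, ← formMoment_pow]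
  simp only [formMoment]
  rw [intervalIntegral.integral_finsetSum fun i _ =>
    Continuous.intervalIntegrable (by fun_prop) _ _, Finset.mul_sum]
  refine Finset.sum_congr rfl fun i hi => ?_
  rw [intervalIntegral.integral_finsetSum fun i _ =>
    Continuous.intervalIntegrable (by fun_prop) _ _, Finset.mul_sum]
  refine Finset.sum_congr rfl fun k hk => ?_
  rw [Finset.mem_range] at hi hk
  rw [intervalIntegral.integral_const_mul]
  obtain ⟨u, hu⟩ : ∃ u, 2 * k + (i - k) = u := ⟨_, rfl⟩
  obtain ⟨v, hv⟩ : ∃ v, (i - k) + 2 * (N - i) = v := ⟨_, rfl⟩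
  have huv : 2 * N + 1 = u + v + 1 := by omega
  rw [hu, hv, huv]
  have e : ∀ p : ℝ, ((x : ℂ) * p) ^ u * (y * (1 - (p : ℂ))) ^ v
      = (x ^ u * y ^ v) * ((p : ℂ) ^ u * (1 - (p : ℂ)) ^ v) := fun p => by
    rw [mul_pow, mul_pow]; ring
  simp only [e]
  rw [intervalIntegral.integral_const_mul]
  have h := factorial_mul_factorial_eq_integral u v
  push_cast
  linear_combination ((N.choose i : ℂ) * (i.choose k) * 10 ^ (i - k) * x ^ u * y ^ v) * h

theorem norm_formMoment_le (N : ℕ) {r s : ℕ → ℂ} {R S : ℕ → ℝ} (hr : ∀ i, ‖r i‖ ≤ R i)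
    (hs : ∀ i, ‖s i‖ ≤ S i) :
    ‖formMoment N r s‖ ≤ (formMoment N (fun i => (R i : ℂ)) fun i => (S i : ℂ)).re := by
  have e : formMoment N (fun i => (R i : ℂ)) (fun i => (S i : ℂ))
      = ((∑ i ∈ Finset.range (N + 1), ∑ k ∈ Finset.range (i + 1),
    (N.choose i * i.choose k * 10 ^ (i - k) : ℕ) *
      (R (2 * k + (i - k)) * S ((i - k) + 2 * (N - i))) : ℝ) : ℂ) := by
    rw [formMoment]; push_cast; rfl
  rw [e, Complex.ofReal_re, formMoment]
  refine (norm_sum_le _ _).trans (Finset.sum_le_sum fun i _ => (norm_sum_le _ _).trans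
    (Finset.sum_le_sum fun k _ => ?_))
  rw [norm_mul, norm_mul, Complex.norm_natCast]
  exact mul_le_mul_of_nonneg_left (mul_le_mul (hr _) (hs _) (norm_nonneg _)
    ((norm_nonneg _).trans (hr _))) (Nat.cast_nonneg _)

theorem formMoment_const_mul (N : ℕ) (c d : ℂ) (r s : ℕ → ℂ) :
    formMoment N (fun i => c * r i) (fun i => d * s i) = c * d * formMoment N r s := by
  simp only [formMoment, Finset.mul_sum]
  exact Finset.sum_congr rfl fun i _ => Finset.sum_congr rfl fun k _ => by ring

theorem norm_formMoment_le_formInt (N : ℕ) {r s : ℕ → ℂ} {C D x y : ℝ}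
    (hr : ∀ i, ‖r i‖ ≤ C * (i.factorial * x ^ i)) (hs : ∀ i, ‖s i‖ ≤ D * (i.factorial * y ^ i)) :
    ‖formMoment N r s‖ ≤ C * D * ((2 * N + 1).factorial * formInt N x y) := by
  refine (norm_formMoment_le N hr hs).trans_eq ?_
  push_cast
  rw [formMoment_const_mul, formMoment_factorial, ← Complex.ofReal_mul, ← Complex.ofReal_mul,
    Complex.ofReal_re]

theorem formInt_le (N : ℕ) {x y B : ℝ} (hx : 0 ≤ x) (hy : 0 ≤ y)
    (h : ∀ p, 0 ≤ p → p ≤ 1 →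
      (x * p) ^ 2 + 10 * (x * p) * (y * (1 - p)) + (y * (1 - p)) ^ 2 ≤ B) :
    formInt N x y ≤ B ^ N := by
  have h1 : formInt N x y ≤ ∫ _p in (0 : ℝ)..1, B ^ N := by
    refine intervalIntegral.integral_mono_on zero_le_one
      (Continuous.intervalIntegrable (by fun_prop) _ _) (by simp) fun p hp => ?_
    have h1 : 0 ≤ 1 - p := sub_nonneg.2 hp.2
    have h0 : 0 ≤ p := hp.1
    exact pow_le_pow_left₀ (by positivity) (h p hp.1 hp.2) N
  simpa using h1

/-- Bilinearity, arranged so that every error term contains one factor that is a difference of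
moments. -/
theorem formMoment_sub (N : ℕ) (r r' s s' : ℕ → ℂ) :
    formMoment N r s - formMoment N r' s'
      = formMoment N r' (fun i => s i - s' i) + formMoment N (fun i => r i - r' i) s := by
  simp only [formMoment, ← Finset.sum_add_distrib, ← Finset.sum_sub_distrib]
  exact Finset.sum_congr rfl fun i _ => Finset.sum_congr rfl fun k _ => by ring

/-- The moments of `exp (θ * I * (m + 1 - j))` against the powers of the form
`j ^ 2 + 10 * j * (m + 1) + (m + 1) ^ 2`, summed over all natural `j` and `m` by regularization. -/
noncomputable def coneMoment (θ : ℝ) (N : ℕ) : ℂ :=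
  formMoment N (abelMoment (Complex.exp (-(θ * Complex.I))))
    fun b => Complex.exp (θ * Complex.I) * abelMomentSucc (Complex.exp (θ * Complex.I)) b

theorem exp_mul_I_ne_one {θ : ℝ} (h0 : θ ≠ 0) (h : |θ| < 2 * Real.pi) :
    Complex.exp (θ * Complex.I) ≠ 1 := by
  have := exp_neg_mul_I_ne_one (neg_ne_zero.2 h0) (by rwa [abs_neg])
  simpa using this

theorem hasExpansion_tsum_exp_mul_coneExp {θ : ℝ} (h0 : θ ≠ 0) (h : |θ| < 2 * Real.pi) :
    HasExpansion
      (fun t : ℝ => ∑' p : ℕ × ℕ, Complex.exp (((p.2 + 1 - p.1 : ℤ) * θ : ℝ) * Complex.I)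
        * (coneExp t p.1 (p.2 + 1 : ℕ) : ℂ))
      (PowerSeries.mk fun N => (-1 / 24) ^ N / (N.factorial : ℂ) * coneMoment θ N) := by
  have hn : ‖Complex.exp (θ * Complex.I)‖ = 1 := Complex.norm_exp_ofReal_mul_I θ
  have hn' : ‖Complex.exp (-(θ * Complex.I))‖ = 1 := by
    have := Complex.norm_exp_ofReal_mul_I (-θ)
    rwa [Complex.ofReal_neg, neg_mul] at this
  have := (hasExpansion_coneSum hn' (exp_neg_mul_I_ne_one h0 h) hn (exp_mul_I_ne_one h0 h)).const_mul
    (Complex.exp (θ * Complex.I))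
  convert! this using 1
  · funext t
    rw [← tsum_mul_left]
    refine tsum_congr fun p => ?_
    rw [← mul_assoc, ← Complex.exp_nat_mul, ← Complex.exp_nat_mul, ← Complex.exp_add,
      ← Complex.exp_add]
    congr 2
    push_cast
    ring
  · ext N
    rw [PowerSeries.coeff_C_mul, PowerSeries.coeff_mk, PowerSeries.coeff_mk, coneMoment]
    have := formMoment_const_mul N 1 (Complex.exp (θ * Complex.I))
      (abelMoment (Complex.exp (-(θ * Complex.I)))) (abelMomentSucc (Complex.exp (θ * Complex.I)))
    simp only [one_mul] at this
    rw [this]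
    ring

/-- The coefficients of the expansion of `sigmaSeries (exp (-t)) * exp (-t / 24)`. -/
noncomputable def sigmaCoeff (N : ℕ) : ℂ :=
  (-1 / 24) ^ N / (N.factorial : ℂ) * (1 / (2 * (√3 : ℝ)) *
    (coneMoment (Real.pi / 6) N + coneMoment (-(Real.pi / 6)) N
      - (coneMoment (5 * Real.pi / 6) N + coneMoment (-(5 * Real.pi / 6)) N)))

theorem chi_eq_exp (d : ℤ) :
    (chi d : ℂ) = 1 / (2 * (√3 : ℝ)) *
      (Complex.exp ((d * (Real.pi / 6) : ℝ) * Complex.I)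
        + Complex.exp ((d * (-(Real.pi / 6)) : ℝ) * Complex.I)
        - (Complex.exp ((d * (5 * Real.pi / 6) : ℝ) * Complex.I)
        + Complex.exp ((d * (-(5 * Real.pi / 6)) : ℝ) * Complex.I))) := by
  have h : ∀ u : ℝ, Complex.exp ((d * u : ℝ) * Complex.I)
      + Complex.exp ((d * -u : ℝ) * Complex.I) = ((2 * Real.cos (u * d) : ℝ) : ℂ) := fun u => by
    rw [Complex.ofReal_mul 2, Complex.ofReal_cos, Complex.ofReal_ofNat, Complex.two_cos]
    push_cast
    ring_nf
  rw [h, h, chi]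
  push_cast
  have e1 : (Real.pi : ℂ) * d / 6 = Real.pi / 6 * d := by ring
  have e2 : 5 * (Real.pi : ℂ) * d / 6 = 5 * Real.pi / 6 * d := by ring
  rw [e1, e2]
  have : ((√3 : ℝ) : ℂ) ≠ 0 := by
    rw [Complex.ofReal_ne_zero]; positivity
  field_simp

theorem HasExpansion.congr {f g : ℝ → ℂ} {φ : PowerSeries ℂ} (hf : HasExpansion f φ)
    (h : f =ᶠ[𝓝[>] 0] g) : HasExpansion g φ := fun K =>
  (hf K).congr' (h.mono fun t ht => by simp only [ht]) EventuallyEq.rfl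

theorem hasExpansion_sigmaSeries_mul_exp :
    HasExpansion (fun t => ((sigmaSeries (Real.exp (-t)) * Real.exp (-t / 24) : ℝ) : ℂ))
      (PowerSeries.mk sigmaCoeff) := by
  have hpi := Real.pi_pos
  have ha : |Real.pi / 6| < 2 * Real.pi := by rw [abs_of_pos (by positivity)]; linarith
  have hb : |5 * Real.pi / 6| < 2 * Real.pi := by rw [abs_of_pos (by positivity)]; linarith
  have ha0 : Real.pi / 6 ≠ 0 := by positivity
  have hb0 : 5 * Real.pi / 6 ≠ 0 := by positivity
  have h1 := hasExpansion_tsum_exp_mul_coneExp ha0 ha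
  have h2 := hasExpansion_tsum_exp_mul_coneExp (neg_ne_zero.2 ha0) (by rwa [abs_neg])
  have h3 := hasExpansion_tsum_exp_mul_coneExp hb0 hb
  have h4 := hasExpansion_tsum_exp_mul_coneExp (neg_ne_zero.2 hb0) (by rwa [abs_neg])
  have h := ((h1.add h2).add ((h3.add h4).const_mul (-1))).const_mul (1 / (2 * (√3 : ℝ)) : ℂ)
  convert! h.congr ?_ using 1
  · ext N
    simp only [map_add, PowerSeries.coeff_C_mul, PowerSeries.coeff_mk, sigmaCoeff]
    ring
  · filter_upwards [self_mem_nhdsWithin] with t ht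
    rw [sigmaSeries_exp ht, Complex.ofReal_tsum]
    have hs : ∀ θ : ℝ, Summable fun p : ℕ × ℕ =>
        Complex.exp (((p.2 + 1 - p.1 : ℤ) * θ : ℝ) * Complex.I)
        * (coneExp t p.1 (p.2 + 1 : ℕ) : ℂ) := fun θ => by
      refine Summable.of_norm ((summable_coneExp_succ ht).congr fun p => ?_)
      rw [norm_mul, Complex.norm_exp_ofReal_mul_I, one_mul, Complex.norm_real,
        Real.norm_of_nonneg (show 0 ≤ coneExp t _ _ from (Real.exp_pos _).le)]
    rw [← (hs _).tsum_add (hs _), ← (hs _).tsum_add (hs _), ← tsum_mul_left,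
      ← ((hs _).add (hs _)).tsum_add (((hs _).add (hs _)).mul_left _), ← tsum_mul_left]
    refine tsum_congr fun p => ?_
    rw [Complex.ofReal_mul (chi _), chi_eq_exp]
    ring

theorem exists_norm_abelMoment_sub_le {θ : ℝ} (h0 : θ ≠ 0) (h : |θ| + Real.pi / 3 < 2 * Real.pi) :
    ∃ C : ℝ, 0 ≤ C ∧
      (∀ i : ℕ, ‖abelMoment (Complex.exp (-(θ * Complex.I))) i
        - i.factorial * ((θ * Complex.I)⁻¹) ^ (i + 1)‖ ≤ C * (i.factorial * (3 / Real.pi) ^ i)) ∧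
      ∀ i : ℕ, ‖Complex.exp (θ * Complex.I) * abelMomentSucc (Complex.exp (θ * Complex.I)) i
        - i.factorial * (-(θ * Complex.I)⁻¹) ^ (i + 1)‖ ≤ C * (i.factorial * (3 / Real.pi) ^ i) := by
  have hpi := Real.pi_pos
  obtain ⟨C₁, hC₁, h1⟩ := exists_abelMoment_sub_le h0 (ρ := Real.pi / 3) (by positivity) h
  obtain ⟨C₂, hC₂, h2⟩ := exists_abelMoment_sub_le (neg_ne_zero.2 h0) (ρ := Real.pi / 3)
    (by positivity) (by rwa [abs_neg])
  rw [inv_div] at h1 h2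
  have hq : ∀ i : ℕ, 0 ≤ (i.factorial : ℝ) * (3 / Real.pi) ^ i := fun i => by positivity
  refine ⟨C₁ + C₂ + 1, by positivity, fun i => (h1 i).trans ?_, fun i => ?_⟩
  · exact mul_le_mul_of_nonneg_right (by linarith) (hq i)
  · rw [mul_abelMomentSucc (exp_mul_I_ne_one h0 (by linarith))]
    have h3 := h2 i
    rw [Complex.ofReal_neg, neg_mul, neg_neg, inv_neg] at h3
    have h4 : ‖(if i = 0 then 1 else 0 : ℂ)‖ ≤ i.factorial * (3 / Real.pi) ^ i := by
      split_ifs with hi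
      · simp [hi]
      · simpa using hq i
    have h5 := (norm_sub_le (abelMoment (Complex.exp (θ * Complex.I)) i
      - i.factorial * (-(θ * Complex.I)⁻¹) ^ (i + 1)) (if i = 0 then 1 else 0)).trans
        (add_le_add h3 h4)
    rw [sub_right_comm] at h5
    refine h5.trans ?_
    have := mul_nonneg hC₁ (hq i)
    linarith

theorem norm_factorial_mul_pow_le {θ x : ℝ} (hx : |θ|⁻¹ ≤ x) {z : ℂ} (hz : ‖z‖ = |θ|⁻¹) (i : ℕ) :
    ‖(i.factorial : ℂ) * z ^ (i + 1)‖ ≤ x * (i.factorial * x ^ i) := by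
  rw [norm_mul, norm_pow, hz, Complex.norm_natCast]
  have h : (|θ|⁻¹) ^ (i + 1) ≤ x ^ (i + 1) := pow_le_pow_left₀ (by positivity) hx _
  calc _ ≤ (i.factorial : ℝ) * x ^ (i + 1) := mul_le_mul_of_nonneg_left h (by positivity)
    _ = _ := by ring

theorem norm_inv_mul_I (θ : ℝ) : ‖(θ * Complex.I)⁻¹‖ = |θ|⁻¹ := by simp

/-- Growth rate of the error: one variable at the main rate `6/π`, the other at `3/π`. The maximum
over `p`, attained at `p = 3/5`, is `57.6/π²`, which is `4/5` of the main rate `2 · 36/π²`. -/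
theorem formInt_le_six_three (N : ℕ) :
    formInt N (6 / Real.pi) (3 / Real.pi) ≤ (288 / (5 * Real.pi ^ 2)) ^ N := by
  have hpi := Real.pi_pos
  refine formInt_le N (by positivity) (by positivity) fun p _ _ => ?_
  have e : 288 / (5 * Real.pi ^ 2) - ((6 / Real.pi * p) ^ 2
      + 10 * (6 / Real.pi * p) * (3 / Real.pi * (1 - p)) + (3 / Real.pi * (1 - p)) ^ 2)
      = 135 * (p - 3 / 5) ^ 2 / Real.pi ^ 2 := by field_simp; ring
  have : 0 ≤ 135 * (p - 3 / 5) ^ 2 / Real.pi ^ 2 := by positivity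
  linarith

theorem formInt_le_three_six (N : ℕ) :
    formInt N (3 / Real.pi) (6 / Real.pi) ≤ (288 / (5 * Real.pi ^ 2)) ^ N := by
  have hpi := Real.pi_pos
  refine formInt_le N (by positivity) (by positivity) fun p _ _ => ?_
  have e : 288 / (5 * Real.pi ^ 2) - ((3 / Real.pi * p) ^ 2
      + 10 * (3 / Real.pi * p) * (6 / Real.pi * (1 - p)) + (6 / Real.pi * (1 - p)) ^ 2)
      = 135 * (p - 2 / 5) ^ 2 / Real.pi ^ 2 := by field_simp; ring
  have : 0 ≤ 135 * (p - 2 / 5) ^ 2 / Real.pi ^ 2 := by positivity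
  linarith

theorem exists_norm_coneMoment_sub_le {θ : ℝ} (h0 : θ ≠ 0) (h : |θ| + Real.pi / 3 < 2 * Real.pi)
    (h6 : |θ|⁻¹ ≤ 6 / Real.pi) :
    ∃ C : ℝ, 0 ≤ C ∧ ∀ N : ℕ, ‖coneMoment θ N
      - formMoment N (fun i => i.factorial * ((θ * Complex.I)⁻¹) ^ (i + 1))
        (fun i => i.factorial * (-(θ * Complex.I)⁻¹) ^ (i + 1))‖
      ≤ C * ((2 * N + 1).factorial * (288 / (5 * Real.pi ^ 2)) ^ N) := by
  have hpi := Real.pi_pos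
  obtain ⟨C, hC, h1, h2⟩ := exists_norm_abelMoment_sub_le h0 h
  have hz := norm_inv_mul_I θ
  have h3 := norm_factorial_mul_pow_le h6 hz
  have h4 := norm_factorial_mul_pow_le h6 (z := -(θ * Complex.I)⁻¹) (by rw [norm_neg, hz])
  have h36 : 3 / Real.pi ≤ 6 / Real.pi := by gcongr; norm_num
  have h5 : ∀ i : ℕ, ‖Complex.exp (θ * Complex.I) * abelMomentSucc (Complex.exp (θ * Complex.I)) i‖
      ≤ (C + 6 / Real.pi) * (i.factorial * (6 / Real.pi) ^ i) := fun i => by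
    have h6 := (norm_le_norm_add_norm_sub' _ _).trans (add_le_add (h4 i) (h2 i))
    have h7 : C * (i.factorial * (3 / Real.pi) ^ i) ≤ C * (i.factorial * (6 / Real.pi) ^ i) := by
      gcongr
    linarith
  refine ⟨6 / Real.pi * C + C * (C + 6 / Real.pi), by positivity, fun N => ?_⟩
  rw [coneMoment, formMoment_sub]
  refine (norm_add_le _ _).trans ((add_le_add (norm_formMoment_le_formInt N h3 h2)
    (norm_formMoment_le_formInt N h1 h5)).trans ?_)
  rw [add_mul]
  have := formInt_le_three_six N
  have := formInt_le_six_three N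
  gcongr

/-- Meant for `θ = ±5π/6`, where the main moments grow at rate `6/(5π) ≤ 3/π`, so that the whole
contribution is an error term. Relaxing one factor to `6/π` allows the same integral bound to be
used. -/
theorem exists_norm_coneMoment_le {θ : ℝ} (h0 : θ ≠ 0) (h : |θ| + Real.pi / 3 < 2 * Real.pi)
    (h3 : |θ|⁻¹ ≤ 3 / Real.pi) :
    ∃ C : ℝ, 0 ≤ C ∧ ∀ N : ℕ, ‖coneMoment θ N‖
      ≤ C * ((2 * N + 1).factorial * (288 / (5 * Real.pi ^ 2)) ^ N) := by
  have hpi := Real.pi_pos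
  obtain ⟨C, hC, h1, h2⟩ := exists_norm_abelMoment_sub_le h0 h
  have hz := norm_inv_mul_I θ
  have h36 : 3 / Real.pi ≤ 6 / Real.pi := by gcongr; norm_num
  have h4 := norm_factorial_mul_pow_le h3 hz
  have h5 := norm_factorial_mul_pow_le (h3.trans h36) (z := -(θ * Complex.I)⁻¹) (by rw [norm_neg, hz])
  have h6 : ∀ i : ℕ, ‖abelMoment (Complex.exp (-(θ * Complex.I))) i‖
      ≤ (C + 3 / Real.pi) * (i.factorial * (3 / Real.pi) ^ i) := fun i => by
    have := (norm_le_norm_add_norm_sub' _ _).trans (add_le_add (h4 i) (h1 i))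
    linarith
  have h7 : ∀ i : ℕ, ‖Complex.exp (θ * Complex.I) * abelMomentSucc (Complex.exp (θ * Complex.I)) i‖
      ≤ (C + 6 / Real.pi) * (i.factorial * (6 / Real.pi) ^ i) := fun i => by
    have h6 := (norm_le_norm_add_norm_sub' _ _).trans (add_le_add (h5 i) (h2 i))
    have h7 : C * (i.factorial * (3 / Real.pi) ^ i) ≤ C * (i.factorial * (6 / Real.pi) ^ i) := by
      gcongr
    linarith
  refine ⟨(C + 3 / Real.pi) * (C + 6 / Real.pi), by positivity, fun N => ?_⟩
  refine (norm_formMoment_le_formInt N h6 h7).trans ?_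
  have := formInt_le_three_six N
  gcongr

theorem formMoment_mul_pow (N : ℕ) (z : ℂ) (r s : ℕ → ℂ) :
    formMoment N (fun i => r i * z ^ i) (fun i => s i * z ^ i) = z ^ (2 * N) * formMoment N r s := by
  simp only [formMoment, Finset.mul_sum]
  refine Finset.sum_congr rfl fun i hi => Finset.sum_congr rfl fun k hk => ?_
  rw [Finset.mem_range] at hi hk
  have e : 2 * N = (2 * k + (i - k)) + ((i - k) + 2 * (N - i)) := by omega
  rw [e, pow_add z (2 * k + (i - k))]
  ring

/-- The two poles are opposite, so with `z = 1/(iθ)` the form is taken at `(z, -z)`: the powers of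
`z` come out by homogeneity, and `z² = -θ^(-2)`. -/
theorem formMoment_factorial_mul_pow (N : ℕ) (θ : ℝ) :
    formMoment N (fun i => i.factorial * ((θ * Complex.I)⁻¹) ^ (i + 1))
        (fun i => i.factorial * (-(θ * Complex.I)⁻¹) ^ (i + 1))
      = (((-1) ^ N * (θ⁻¹ ^ 2) ^ (N + 1) * ((2 * N + 1).factorial * formInt N 1 (-1)) : ℝ) : ℂ) := by
  obtain ⟨z, hz⟩ : ∃ z, (θ * Complex.I)⁻¹ = z := ⟨_, rfl⟩
  have hz2 : z ^ 2 = -(θ : ℂ)⁻¹ ^ 2 := by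
    rw [← hz, mul_inv, mul_pow, inv_pow Complex.I, Complex.I_sq]; norm_num
  have h := formMoment_factorial N 1 (-1)
  rw [hz, Complex.ofReal_mul, ← h]
  have e1 : (fun i : ℕ => (i.factorial : ℂ) * z ^ (i + 1))
      = fun i => z * (i.factorial * ((1 : ℝ) : ℂ) ^ i * z ^ i) := by
    funext i; rw [Complex.ofReal_one, one_pow]; ring
  have e2 : (fun i : ℕ => (i.factorial : ℂ) * (-z) ^ (i + 1))
      = fun i => -z * (i.factorial * ((-1 : ℝ) : ℂ) ^ i * z ^ i) := by
    funext i; rw [pow_succ, neg_pow z]; push_cast; ring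
  rw [e1, e2, formMoment_const_mul, formMoment_mul_pow, pow_mul, hz2]
  have e3 : z * -z = (θ : ℂ)⁻¹ ^ 2 := by linear_combination -hz2
  rw [e3, neg_pow ((θ : ℂ)⁻¹ ^ 2)]
  push_cast
  ring

/-! ### The main integral and the leading constant. -/

theorem integral_one_sub_sq_pow (N : ℕ) :
    (2 * N + 1).factorial * ∫ v in (-1 : ℝ)..1, (1 - v ^ 2) ^ N
      = 2 * 4 ^ N * (N.factorial : ℝ) ^ 2 := by
  have h := intervalIntegral.integral_comp_mul_sub (a := 0) (b := 1) (c := 2)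
    (fun v : ℝ => (1 - v ^ 2) ^ N) two_ne_zero 1
  norm_num only [smul_eq_mul] at h
  have h2 := factorial_mul_factorial_eq_integral N N
  have e : ∀ p : ℝ, (p : ℂ) ^ N * (1 - (p : ℂ)) ^ N = ((p ^ N * (1 - p) ^ N : ℝ) : ℂ) := fun p => by
    push_cast; rfl
  simp only [e] at h2
  rw [intervalIntegral.integral_ofReal] at h2
  have h3 : (N.factorial * N.factorial : ℝ)
      = (N + N + 1).factorial * ∫ p in (0 : ℝ)..1, p ^ N * (1 - p) ^ N := by exact_mod_cast h2
  -- The substitution `v = 2p - 1` reduces the integral to a beta integral.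
  have e2 : (fun p : ℝ => (1 - (2 * p - 1) ^ 2) ^ N) = fun p => 4 ^ N * (p ^ N * (1 - p) ^ N) := by
    funext p
    rw [← mul_pow, ← mul_pow]
    ring
  rw [e2, intervalIntegral.integral_const_mul] at h
  rw [two_mul N]
  linear_combination (-2 * (N + N + 1).factorial) * h - 2 * 4 ^ N * h3

/-- At `(p, p - 1)` the form is `1 - 12p(1-p) = -2(1 - v²)` with `v = √6 (p - 1/2)`. The part `|v| ≤
1` has a closed form; on the rest `1 ≤ v² ≤ 3/2`, so the integrand is bounded by `(2 · 1/2)^N = 1`.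
-/
theorem abs_formInt_sub_le (N : ℕ) :
    |formInt N 1 (-1) - (-2) ^ N * (√6)⁻¹ * ∫ v in (-1 : ℝ)..1, (1 - v ^ 2) ^ N| ≤ 1 := by
  have h6 : (√6 : ℝ) ^ 2 = 6 := Real.sq_sqrt (by norm_num)
  have h60 : 0 < √6 := by positivity
  have h62 : 2 ≤ √6 := by nlinarith
  have h63 : √6 ≤ 3 := by nlinarith
  have h := intervalIntegral.integral_comp_mul_sub (a := 0) (b := 1) (c := √6)
    (fun v : ℝ => (1 - v ^ 2) ^ N) h60.ne' (√6 / 2)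
  rw [mul_zero, mul_one, zero_sub, sub_half, smul_eq_mul] at h
  have hf : formInt N 1 (-1) = (-2) ^ N * ∫ p in (0 : ℝ)..1, (1 - (√6 * p - √6 / 2) ^ 2) ^ N := by
    rw [formInt, ← intervalIntegral.integral_const_mul]
    congr 1
    funext p
    rw [← mul_pow]
    congr 1
    linear_combination (-2 * (p - 1 / 2) ^ 2) * h6
  have hi : ∀ x y : ℝ, IntervalIntegrable (fun v : ℝ => (1 - v ^ 2) ^ N) MeasureTheory.volume x y :=
    fun x y => Continuous.intervalIntegrable (by fun_prop) _ _
  rw [← intervalIntegral.integral_add_adjacent_intervals (hi _ (-1)) (hi _ _),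
    ← intervalIntegral.integral_add_adjacent_intervals (hi (-1) 1) (hi _ _)] at h
  have hb : ∀ v : ℝ, 1 ≤ v ^ 2 → v ^ 2 ≤ 3 / 2 → ‖(1 - v ^ 2) ^ N‖ ≤ (1 / 2 : ℝ) ^ N := by
    intro v h1 h2
    rw [norm_pow]
    refine pow_le_pow_left₀ (norm_nonneg _) ?_ N
    rw [Real.norm_eq_abs, abs_le]
    constructor <;> linarith
  have hs1 : ‖∫ v in -(√6 / 2)..(-1 : ℝ), (1 - v ^ 2) ^ N‖
      ≤ (1 / 2 : ℝ) ^ N * |-1 - -(√6 / 2)| := by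
    refine intervalIntegral.norm_integral_le_of_norm_le_const fun v hv => ?_
    rw [Set.uIoc_of_le (by linarith)] at hv
    exact hb v (by nlinarith [hv.2]) (by nlinarith [hv.1, hv.2])
  have hs2 : ‖∫ v in (1 : ℝ)..√6 / 2, (1 - v ^ 2) ^ N‖ ≤ (1 / 2 : ℝ) ^ N * |√6 / 2 - 1| := by
    refine intervalIntegral.norm_integral_le_of_norm_le_const fun v hv => ?_
    rw [Set.uIoc_of_le (by linarith)] at hv
    exact hb v (by nlinarith [hv.1]) (by nlinarith [hv.1, hv.2])
  rw [hf, h]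
  obtain ⟨I₁, hI₁⟩ : ∃ I, ∫ v in -(√6 / 2)..(-1 : ℝ), (1 - v ^ 2) ^ N = I := ⟨_, rfl⟩
  obtain ⟨I₂, hI₂⟩ : ∃ I, ∫ v in (1 : ℝ)..√6 / 2, (1 - v ^ 2) ^ N = I := ⟨_, rfl⟩
  rw [hI₁] at hs1 ⊢
  rw [hI₂] at hs2 ⊢
  rw [abs_of_nonneg (by linarith), Real.norm_eq_abs] at hs1 hs2
  have hq : (0 : ℝ) < (1 / 2) ^ N := by positivity
  have hs : |I₁ + I₂| ≤ (1 / 2 : ℝ) ^ N := by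
    refine (abs_add_le _ _).trans ((add_le_add hs1 hs2).trans ?_)
    nlinarith
  rw [show ∀ W : ℝ, (-2 : ℝ) ^ N * ((√6)⁻¹ * (I₁ + (W + I₂))) - (-2) ^ N * (√6)⁻¹ * W
      = (-2) ^ N * ((√6)⁻¹ * (I₁ + I₂)) from fun W => by ring, abs_mul, abs_pow, abs_neg, abs_two,
    abs_mul, abs_of_pos (inv_pos.2 h60)]
  have h61 : (√6)⁻¹ ≤ 1 := inv_le_one_of_one_le₀ (by linarith)
  calc (2 : ℝ) ^ N * ((√6)⁻¹ * |I₁ + I₂|) ≤ 2 ^ N * (1 * (1 / 2) ^ N) := by gcongr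
    _ = 1 := by rw [one_mul, ← mul_pow]; norm_num

theorem abs_factorial_mul_formInt_sub_le (N : ℕ) :
    |(2 * N + 1).factorial * formInt N 1 (-1) - (-8) ^ N * (2 / √6) * (N.factorial : ℝ) ^ 2|
      ≤ ((2 * N + 1).factorial : ℝ) := by
  have h := abs_formInt_sub_le N
  have hw := integral_one_sub_sq_pow N
  have hf : (0 : ℝ) < (2 * N + 1).factorial := by positivity
  have e : (2 * N + 1).factorial * formInt N 1 (-1) - (-8) ^ N * (2 / √6) * (N.factorial : ℝ) ^ 2
      = (2 * N + 1).factorial * (formInt N 1 (-1)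
        - (-2) ^ N * (√6)⁻¹ * ∫ v in (-1 : ℝ)..1, (1 - v ^ 2) ^ N) := by
    rw [show (-8 : ℝ) = -2 * 4 by norm_num, mul_pow]
    linear_combination ((-2) ^ N * (√6)⁻¹) * hw
  rw [e, abs_mul, abs_of_pos hf]
  exact mul_le_of_le_one_right hf.le h

theorem factorial_two_mul_add_one_le (N : ℕ) :
    ((2 * N + 1).factorial : ℝ) ≤ (2 * N + 1) * 4 ^ N * (N.factorial : ℝ) ^ 2 := by
  have h := Nat.choose_mul_factorial_mul_factorial (n := 2 * N) (k := N) (by omega)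
  rw [show 2 * N - N = N by omega] at h
  have h2 : (2 * N).choose N ≤ 4 ^ N := (Nat.choose_le_two_pow _ _).trans_eq (by rw [pow_mul]; rfl)
  have h3 : (2 * N + 1).factorial ≤ (2 * N + 1) * 4 ^ N * N.factorial ^ 2 := by
    rw [Nat.factorial_succ, ← h, mul_assoc, mul_assoc, sq]
    exact Nat.mul_le_mul_left _ (Nat.mul_le_mul_right _ h2)
  exact_mod_cast h3

theorem exists_two_mul_add_one_mul_pow_le :
    ∃ C : ℝ, 0 ≤ C ∧ ∀ N : ℕ, (2 * N + 1) * (4 / 5 : ℝ) ^ N ≤ C / (N + 1) := by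
  have h := tendsto_pow_const_mul_const_pow_of_abs_lt_one 2 (r := (4 / 5 : ℝ))
    (by rw [abs_of_pos] <;> norm_num)
  obtain ⟨B, hB⟩ := h.bddAbove_range
  have hB' : ∀ n : ℕ, (n : ℝ) ^ 2 * (4 / 5) ^ n ≤ B := fun n => hB ⟨n, rfl⟩
  refine ⟨5 / 2 * B, ?_, fun N => ?_⟩
  · have := hB' 0
    norm_num at this
    positivity
  · rw [le_div_iff₀ (by positivity)]
    have h1 := hB' (N + 1)
    push_cast at h1
    rw [pow_succ (4 / 5 : ℝ)] at h1
    have : 0 < (4 / 5 : ℝ) ^ N := by positivity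
    have h2 : (0 : ℝ) ≤ N * (4 / 5) ^ N := by positivity
    nlinarith

theorem norm_coneMoment_factor_le (N : ℕ) :
    ‖((-1 / 24) ^ N / (N.factorial : ℂ) * (1 / (2 * (√3 : ℝ))) : ℂ)‖
      ≤ 1 / (24 ^ N * N.factorial) := by
  have h3 : (1 : ℝ) ≤ √3 := Real.one_le_sqrt.2 (by norm_num)
  have e : ((-1 / 24) ^ N / (N.factorial : ℂ) * (1 / (2 * (√3 : ℝ))) : ℂ)
      = (((-1 / 24) ^ N / (N.factorial : ℝ) * (1 / (2 * √3)) : ℝ) : ℂ) := by push_cast; rfl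
  rw [e, Complex.norm_real, norm_mul, norm_div, norm_pow, Real.norm_natCast,
    Real.norm_of_nonneg (show 0 ≤ 1 / (2 * √3) by positivity)]
  have h1 : ‖(-1 / 24 : ℝ)‖ = 1 / 24 := by rw [Real.norm_eq_abs, abs_of_neg] <;> norm_num
  rw [h1, one_div_pow, div_div]
  refine mul_le_of_le_one_right (by positivity) ?_
  rw [div_le_one (by positivity)]
  linarith

theorem coneMoment_main_factor (N : ℕ) :
    (-1 / 24) ^ N / (N.factorial : ℝ) * (1 / (2 * √3)) *
      (2 * ((-1) ^ N * (36 / Real.pi ^ 2) ^ (N + 1) * ((-8) ^ N * (2 / √6) * (N.factorial : ℝ) ^ 2)))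
      = 12 * √2 / Real.pi ^ 2 * ((-1) ^ N * (N.factorial * (12 / Real.pi ^ 2) ^ N)) := by
  have hpi := Real.pi_pos
  have h6 : √6 = √2 * √3 := by rw [← Real.sqrt_mul (by norm_num)]; norm_num
  have h2 : √2 ^ 2 = 2 := Real.sq_sqrt (by norm_num)
  have h3 : √3 ^ 2 = 3 := Real.sq_sqrt (by norm_num)
  have hf : (N.factorial : ℝ) ≠ 0 := by positivity
  have e1 : (-1 / 24 : ℝ) ^ N * (36 / Real.pi ^ 2) ^ N * (-8) ^ N = (12 / Real.pi ^ 2) ^ N := by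
    rw [← mul_pow, ← mul_pow]; congr 1; ring
  have e2 : 1 / (2 * √3) * (2 / √6) * 2 * 36 = 12 * √2 := by
    rw [h6]
    have : 0 < √2 := by positivity
    have : 0 < √3 := by positivity
    field_simp
    rw [h2, h3]
    norm_num
  calc _ = ((-1 / 24 : ℝ) ^ N * (36 / Real.pi ^ 2) ^ N * (-8) ^ N)
        * (1 / (2 * √3) * (2 / √6) * 2 * 36) / Real.pi ^ 2 * (-1) ^ N
        * ((N.factorial : ℝ) ^ 2 / N.factorial) := by rw [pow_succ (36 / Real.pi ^ 2)]; ring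
    _ = _ := by
      rw [e1, e2, sq (N.factorial : ℝ), mul_div_assoc (N.factorial : ℝ), div_self hf]; ring

theorem exists_norm_coneMoment_main_sub_le {θ : ℝ} (h : |θ| = Real.pi / 6) :
    ∃ C : ℝ, 0 ≤ C ∧ ∀ N : ℕ, ‖coneMoment θ N
      - (((-1) ^ N * (36 / Real.pi ^ 2) ^ (N + 1) *
        ((-8) ^ N * (2 / √6) * (N.factorial : ℝ) ^ 2) : ℝ) : ℂ)‖
      ≤ C * ((2 * N + 1).factorial * (288 / (5 * Real.pi ^ 2)) ^ N) := by
  have hpi := Real.pi_pos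
  have h0 : θ ≠ 0 := abs_pos.1 (h ▸ by positivity)
  obtain ⟨C, hC, hN⟩ := exists_norm_coneMoment_sub_le h0 (by rw [h]; linarith)
    (by rw [h, inv_div])
  have h2 : θ⁻¹ ^ 2 = 36 / Real.pi ^ 2 := by
    rw [← sq_abs, abs_inv, h, inv_div, div_pow]; norm_num
  refine ⟨C + 36 / Real.pi ^ 2, by positivity, fun N => ?_⟩
  have h3 := hN N
  rw [formMoment_factorial_mul_pow, h2] at h3
  have h4 := abs_factorial_mul_formInt_sub_le N
  have h5 : ‖(((-1) ^ N * (36 / Real.pi ^ 2) ^ (N + 1) *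
        ((2 * N + 1).factorial * formInt N 1 (-1)) : ℝ) : ℂ)
      - (((-1) ^ N * (36 / Real.pi ^ 2) ^ (N + 1) *
        ((-8) ^ N * (2 / √6) * (N.factorial : ℝ) ^ 2) : ℝ) : ℂ)‖
      ≤ 36 / Real.pi ^ 2 * ((2 * N + 1).factorial * (288 / (5 * Real.pi ^ 2)) ^ N) := by
    rw [← Complex.ofReal_sub, Complex.norm_real, ← mul_sub, norm_mul, norm_mul, norm_pow, norm_neg,
      norm_one, one_pow, one_mul, Real.norm_of_nonneg (by positivity), pow_succ, Real.norm_eq_abs]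
    have h6 : 36 / Real.pi ^ 2 ≤ 288 / (5 * Real.pi ^ 2) := by
      rw [div_le_div_iff₀ (by positivity) (by positivity)]
      nlinarith [sq_nonneg Real.pi]
    calc _ ≤ (288 / (5 * Real.pi ^ 2)) ^ N * (36 / Real.pi ^ 2) * ((2 * N + 1).factorial : ℝ) := by
          gcongr
      _ = _ := by ring
  have := norm_sub_le_norm_sub_add_norm_sub (coneMoment θ N) (((-1) ^ N *
    (36 / Real.pi ^ 2) ^ (N + 1) * ((2 * N + 1).factorial * formInt N 1 (-1)) : ℝ) : ℂ)
    (((-1) ^ N * (36 / Real.pi ^ 2) ^ (N + 1) *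
        ((-8) ^ N * (2 / √6) * (N.factorial : ℝ) ^ 2) : ℝ) : ℂ)
  rw [add_mul]
  exact this.trans (add_le_add h3 h5)

/-- The angles `±π/6` give equal main terms. By `(2N+1)! ≤ (2N+1) 4^N N!²` the errors, relative to
the main term, are at most a constant times `(2N+1) (4/5)^N`, which is `O(1/N)`. -/
theorem exists_norm_sigmaCoeff_sub_le :
    ∃ C : ℝ, 0 ≤ C ∧ ∀ N : ℕ, ‖sigmaCoeff N - ((12 * √2 / Real.pi ^ 2 *
        ((-1) ^ N * (N.factorial * (12 / Real.pi ^ 2) ^ N)) : ℝ) : ℂ)‖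
      ≤ C / (N + 1) * (N.factorial * (12 / Real.pi ^ 2) ^ N) := by
  have hpi := Real.pi_pos
  have a1 : |Real.pi / 6| = Real.pi / 6 := abs_of_pos (by positivity)
  have a2 : |5 * Real.pi / 6| = 5 * Real.pi / 6 := abs_of_pos (by positivity)
  have b0 : 5 * Real.pi / 6 ≠ 0 := by positivity
  have b3 : (5 * Real.pi / 6)⁻¹ ≤ 3 / Real.pi := by
    rw [inv_div, div_le_div_iff₀ (by positivity) hpi]; linarith
  obtain ⟨C₁, hC₁, h1⟩ := exists_norm_coneMoment_main_sub_le a1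
  obtain ⟨C₂, hC₂, h2⟩ := exists_norm_coneMoment_main_sub_le ((abs_neg _).trans a1)
  obtain ⟨C₃, hC₃, h3⟩ := exists_norm_coneMoment_le b0 (by rw [a2]; linarith) (by rwa [a2])
  obtain ⟨C₄, hC₄, h4⟩ := exists_norm_coneMoment_le (neg_ne_zero.2 b0)
    (by rw [abs_neg, a2]; linarith) (by rwa [abs_neg, a2])
  obtain ⟨B, hB, h5⟩ := exists_two_mul_add_one_mul_pow_le
  refine ⟨(C₁ + C₂ + (C₃ + C₄)) * B, by positivity, fun N => ?_⟩
  have h6 := coneMoment_main_factor N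
  obtain ⟨m, hm⟩ : ∃ m : ℝ, (-1) ^ N * (36 / Real.pi ^ 2) ^ (N + 1) *
    ((-8) ^ N * (2 / √6) * (N.factorial : ℝ) ^ 2) = m := ⟨_, rfl⟩
  obtain ⟨E, hE⟩ : ∃ E : ℝ, (2 * N + 1).factorial * (288 / (5 * Real.pi ^ 2)) ^ N = E := ⟨_, rfl⟩
  have g1 := h1 N
  have g2 := h2 N
  have g3 := h3 N
  have g4 := h4 N
  rw [hm, hE] at g1 g2
  rw [hE] at g3 g4
  rw [hm] at h6
  rw [← h6, sigmaCoeff]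
  have e : (-1 / 24) ^ N / (N.factorial : ℂ) * (1 / (2 * (√3 : ℝ)) *
    (coneMoment (Real.pi / 6) N + coneMoment (-(Real.pi / 6)) N
      - (coneMoment (5 * Real.pi / 6) N + coneMoment (-(5 * Real.pi / 6)) N)))
      - (((-1 / 24) ^ N / (N.factorial : ℝ) * (1 / (2 * √3)) * (2 * m) : ℝ) : ℂ)
      = ((-1 / 24) ^ N / (N.factorial : ℂ) * (1 / (2 * (√3 : ℝ)))) *
        ((coneMoment (Real.pi / 6) N - m) + (coneMoment (-(Real.pi / 6)) N - m)
      - (coneMoment (5 * Real.pi / 6) N + coneMoment (-(5 * Real.pi / 6)) N)) := by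
    push_cast; ring
  rw [e, norm_mul]
  have g5 : ‖(coneMoment (Real.pi / 6) N - m) + (coneMoment (-(Real.pi / 6)) N - m)
      - (coneMoment (5 * Real.pi / 6) N + coneMoment (-(5 * Real.pi / 6)) N)‖
      ≤ (C₁ + C₂ + (C₃ + C₄)) * E := by
    refine (norm_sub_le _ _).trans ((add_le_add (norm_add_le_of_le g1 g2)
      (norm_add_le_of_le g3 g4)).trans_eq ?_)
    ring
  refine (mul_le_mul (norm_coneMoment_factor_le N) g5 (norm_nonneg _) (by positivity)).trans ?_
  have g6 : 1 / (24 ^ N * N.factorial) * E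
      ≤ (2 * N + 1) * (4 / 5 : ℝ) ^ N * (N.factorial * (12 / Real.pi ^ 2) ^ N) := by
    rw [← hE]
    have hf : (N.factorial : ℝ) ≠ 0 := by positivity
    have e1 : (1 / 24 : ℝ) ^ N * 4 ^ N * (288 / (5 * Real.pi ^ 2)) ^ N
        = (4 / 5) ^ N * (12 / Real.pi ^ 2) ^ N := by
      rw [← mul_pow, ← mul_pow, ← mul_pow]; congr 1; field_simp; norm_num
    calc _ ≤ 1 / (24 ^ N * N.factorial) * (((2 * N + 1) * 4 ^ N * (N.factorial : ℝ) ^ 2) *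
          (288 / (5 * Real.pi ^ 2)) ^ N) := by
          have := factorial_two_mul_add_one_le N
          gcongr
      _ = (2 * N + 1) * ((1 / 24 : ℝ) ^ N * 4 ^ N * (288 / (5 * Real.pi ^ 2)) ^ N)
          * ((N.factorial : ℝ) ^ 2 / N.factorial) := by rw [one_div_pow]; field_simp
      _ = _ := by rw [e1, sq (N.factorial : ℝ), mul_div_assoc (N.factorial : ℝ), div_self hf]; ring
  calc _ = (C₁ + C₂ + (C₃ + C₄)) * (1 / (24 ^ N * N.factorial) * E) := by ring
    _ ≤ (C₁ + C₂ + (C₃ + C₄)) * ((2 * N + 1) * (4 / 5 : ℝ) ^ N *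
        (N.factorial * (12 / Real.pi ^ 2) ^ N)) := by gcongr
    _ ≤ (C₁ + C₂ + (C₃ + C₄)) * (B / (N + 1) * (N.factorial * (12 / Real.pi ^ 2) ^ N)) := by
      have := h5 N
      gcongr
    _ = _ := by ring

/-! ### Asymptotics of the coefficients -/

/-- Two expansions of `σ(exp (-t))` agree by uniqueness; the second is the cone expansion multiplied
by `exp (t/24)`. -/
theorem two_mul_gfNeg_coeff (n : ℕ) :
    2 * ((-1) ^ n * (a n : ℂ))
      = ∑ l ∈ Finset.range (n + 1), (1 / 24) ^ l / (l.factorial : ℂ) * sigmaCoeff (n - l) := by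
  have h : HasExpansion (fun t => (sigmaSeries (Real.exp (-t)) : ℂ))
      (PowerSeries.rescale (1 / 24) (PowerSeries.exp ℂ) * PowerSeries.mk sigmaCoeff) := by
    refine ((HasExpansion.exp (1 / 24)).mul hasExpansion_sigmaSeries_mul_exp).congr
      (Eventually.of_forall fun t => ?_)
    have e : Complex.exp (1 / 24 * t) = ((Real.exp (t / 24) : ℝ) : ℂ) := by
      push_cast; congr 1; ring
    have e2 : Real.exp (t / 24) * Real.exp (-t / 24) = 1 := by
      rw [← Real.exp_add, neg_div, add_neg_cancel, Real.exp_zero]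
    simp only [e]
    rw [← Complex.ofReal_mul]
    congr 1
    linear_combination sigmaSeries (Real.exp (-t)) * e2
  have h2 := congrArg (PowerSeries.coeff n) (hasExpansion_sigmaSeries.unique h)
  rw [PowerSeries.coeff_C_mul, gfNeg, PowerSeries.coeff_mk, PowerSeries.coeff_mul,
    Finset.Nat.sum_antidiagonal_eq_sum_range_succ_mk] at h2
  rw [h2]
  refine Finset.sum_congr rfl fun l _ => ?_
  rw [PowerSeries.coeff_rescale, PowerSeries.coeff_exp, PowerSeries.coeff_mk, map_div₀, map_one, map_natCast]
  ring

/-- In the convolution the term `l = 0` is the main one. For `l ≥ 1` one has `(n-l)! ≤ n!/n`, and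
the factors `(1/24)^l / l!` are summable. -/
theorem exists_abs_two_mul_a_sub_le :
    ∃ C : ℝ, 0 ≤ C ∧ ∀ n : ℕ, n ≠ 0 →
      |2 * a n - 12 * √2 / Real.pi ^ 2 * (n.factorial * (12 / Real.pi ^ 2) ^ n)|
        ≤ C / n * (n.factorial * (12 / Real.pi ^ 2) ^ n) := by
  have hpi := Real.pi_pos
  obtain ⟨C, hC, hL⟩ := exists_norm_sigmaCoeff_sub_le
  -- Needed for `x^(n-l) ≤ x^n`.
  have hx1 : 1 ≤ 12 / Real.pi ^ 2 := by
    rw [one_le_div (by positivity)]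
    nlinarith [Real.pi_lt_d2]
  obtain ⟨x, hx⟩ : ∃ x, 12 / Real.pi ^ 2 = x := ⟨_, rfl⟩
  obtain ⟨k, hk⟩ : ∃ k, 12 * √2 / Real.pi ^ 2 = k := ⟨_, rfl⟩
  have hk0 : 0 ≤ k := hk ▸ by positivity
  simp only [hx, hk] at hL hx1 ⊢
  have hx0 : 0 < x := by linarith
  have hL' : ∀ N : ℕ, ‖sigmaCoeff N‖ ≤ (k + C) * (N.factorial * x ^ N) := fun N => by
    have h1 := (norm_le_norm_add_norm_sub' _ _).trans (add_le_add_right (hL N) _)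
    have hg : 0 ≤ (N.factorial : ℝ) * x ^ N := by positivity
    rw [Complex.norm_real, norm_mul, norm_mul, norm_pow, norm_neg, norm_one, one_pow, one_mul,
      Real.norm_of_nonneg hg, Real.norm_of_nonneg hk0, ← add_mul] at h1
    refine h1.trans (mul_le_mul_of_nonneg_right (add_le_add_right ?_ _) hg)
    exact div_le_self hC (by linarith [Nat.cast_nonneg (α := ℝ) N])
  refine ⟨C + (k + C), by positivity, fun n hn => ?_⟩
  have hn0 : (0 : ℝ) < n := by positivity
  have h := two_mul_gfNeg_coeff n
  rw [Finset.sum_range_succ'] at h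
  norm_num only [pow_zero, Nat.factorial_zero, Nat.cast_one, div_one, one_mul, Nat.sub_zero] at h
  have hnorm : |2 * a n - k * (n.factorial * x ^ n)|
      = ‖2 * ((-1) ^ n * (a n : ℂ)) - ((k * ((-1) ^ n * (n.factorial * x ^ n)) : ℝ) : ℂ)‖ := by
    have e : 2 * ((-1) ^ n * (a n : ℂ)) - ((k * ((-1) ^ n * (n.factorial * x ^ n)) : ℝ) : ℂ)
        = (((-1) ^ n * (2 * a n - k * (n.factorial * x ^ n)) : ℝ) : ℂ) := by
      push_cast; ring
    rw [e, Complex.norm_real, norm_mul, norm_pow, norm_neg, norm_one, one_pow, one_mul,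
      Real.norm_eq_abs]
  rw [hnorm, h, add_sub_assoc]
  have h1 : ∀ l ∈ Finset.range n,
      ‖(1 / 24) ^ (l + 1) / ((l + 1).factorial : ℂ) * sigmaCoeff (n - (l + 1))‖
      ≤ (1 / 2) ^ (l + 1) * ((k + C) / n * (n.factorial * x ^ n)) := fun l hl => by
    rw [Finset.mem_range] at hl
    have hf : (1 : ℝ) ≤ ((l + 1).factorial : ℝ) := by
      exact_mod_cast Nat.one_le_iff_ne_zero.2 (l + 1).factorial_ne_zero
    have h24 : ‖(1 / 24 : ℂ)‖ ≤ 1 / 2 := by norm_num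
    rw [norm_mul, norm_div, norm_pow, Complex.norm_natCast]
    have h2 : ‖(1 / 24 : ℂ)‖ ^ (l + 1) / ((l + 1).factorial : ℝ) ≤ (1 / 2) ^ (l + 1) :=
      (div_le_self (by positivity) hf).trans (pow_le_pow_left₀ (norm_nonneg _) h24 _)
    have h3 : ((n - (l + 1)).factorial : ℝ) ≤ n.factorial / n := by
      rw [le_div_iff₀ hn0, ← Nat.mul_factorial_pred hn, Nat.cast_mul, mul_comm]
      have : ((n - (l + 1)).factorial : ℝ) ≤ ((n - 1).factorial : ℝ) := by
        exact_mod_cast Nat.factorial_le (by omega)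
      gcongr
    have h4 : x ^ (n - (l + 1)) ≤ x ^ n := pow_le_pow_right₀ hx1 (by omega)
    have h5 : ‖sigmaCoeff (n - (l + 1))‖ ≤ (k + C) / n * (n.factorial * x ^ n) := by
      refine (hL' _).trans ?_
      calc _ ≤ (k + C) * (n.factorial / n * x ^ n) := by gcongr
        _ = _ := by ring
    exact mul_le_mul h2 h5 (norm_nonneg _) (by positivity)
  have h2 : ∑ l ∈ Finset.range n, (1 / 2 : ℝ) ^ (l + 1) ≤ 1 := by
    have : ∀ m : ℕ, ∑ l ∈ Finset.range m, (1 / 2 : ℝ) ^ (l + 1) = 1 - (1 / 2) ^ m := fun m => by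
      induction m with
      | zero => simp
      | succ m ih => rw [Finset.sum_range_succ, ih]; ring
    rw [this]
    have : (0 : ℝ) < (1 / 2) ^ n := by positivity
    linarith
  have h3 := (norm_sum_le _ _).trans (Finset.sum_le_sum h1)
  rw [← Finset.sum_mul] at h3
  have hg : 0 ≤ (n.factorial : ℝ) * x ^ n := by positivity
  have h4 : C / (n + 1) * (n.factorial * x ^ n) ≤ C / n * (n.factorial * x ^ n) := by
    gcongr; linarith
  have h5 : (0 : ℝ) ≤ (k + C) / n * (n.factorial * x ^ n) := by positivity
  refine (norm_add_le _ _).trans ((add_le_add (h3.trans (mul_le_of_le_one_left h5 h2))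
    ((hL n).trans h4)).trans_eq ?_)
  ring

/-! ### Stirling's formula with a `1/n` error. -/

theorem stirlingSeq_le_mul_exp {n : ℕ} (hn : n ≠ 0) :
    Stirling.stirlingSeq n ≤ √Real.pi * Real.exp (1 / (12 * n)) := by
  obtain ⟨n, rfl⟩ := Nat.exists_eq_succ_of_ne_zero hn
  -- The decrements of `log stirlingSeq` are at most `1/(12n(n+1))`, the decrement of `1/(12n)`. The
  -- difference therefore increases to its limit `log √π`.
  have hmono : Monotone fun m : ℕ =>
      Real.log (Stirling.stirlingSeq (m + 1)) - 1 / (12 * ((m + 1 : ℕ) : ℝ)) := by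
    refine monotone_nat_of_le_succ fun m => ?_
    have h := Stirling.log_stirlingSeq_sdiff_le (m + 1)
    have e : 1 / (12 * ((m + 1 : ℕ) : ℝ)) - 1 / (12 * ((m + 1 + 1 : ℕ) : ℝ))
        = 1 / (12 * ((m + 1 : ℕ) : ℝ) * (((m + 1 : ℕ) : ℝ) + 1)) := by
      push_cast; field_simp; ring
    linarith
  have hsp : 0 < √Real.pi := Real.sqrt_pos.2 Real.pi_pos
  have h1 : Tendsto (fun m : ℕ => Real.log (Stirling.stirlingSeq (m + 1))) atTop
      (𝓝 (Real.log √Real.pi)) :=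
    ((Real.continuousAt_log hsp.ne').tendsto.comp Stirling.tendsto_stirlingSeq_sqrt_pi).comp
      (tendsto_add_atTop_nat 1)
  have h2 : Tendsto (fun m : ℕ => 1 / (12 * ((m + 1 : ℕ) : ℝ))) atTop (𝓝 0) := by
    have := (tendsto_one_div_add_atTop_nhds_zero_nat (𝕜 := ℝ)).const_mul (1 / 12)
    rw [mul_zero] at this
    refine this.congr fun m => ?_
    push_cast
    field_simp
  have h3 := hmono.ge_of_tendsto (h1.sub h2) n
  rw [sub_zero] at h3
  have h4 : Real.log (Stirling.stirlingSeq (n + 1))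
      ≤ Real.log √Real.pi + 1 / (12 * ((n + 1 : ℕ) : ℝ)) := by linarith
  rw [← Real.exp_le_exp, Real.exp_log (Stirling.stirlingSeq'_pos n), Real.exp_add,
    Real.exp_log hsp] at h4
  exact h4

theorem abs_stirlingSeq_div_sub_one_le {n : ℕ} (hn : n ≠ 0) :
    |Stirling.stirlingSeq n / √Real.pi - 1| ≤ 1 / n := by
  have hsp : 0 < √Real.pi := Real.sqrt_pos.2 Real.pi_pos
  have h1 : 1 ≤ Stirling.stirlingSeq n / √Real.pi :=
    (one_le_div hsp).2 (Stirling.sqrt_pi_le_stirlingSeq hn)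
  have h2 : Stirling.stirlingSeq n / √Real.pi ≤ Real.exp (1 / (12 * n)) := by
    rw [div_le_iff₀ hsp, mul_comm]
    exact stirlingSeq_le_mul_exp hn
  have hn1 : (1 : ℝ) ≤ n := by exact_mod_cast Nat.one_le_iff_ne_zero.2 hn
  have hy : 1 / (12 * (n : ℝ)) = 1 / n / 12 := by field_simp
  have hz : 1 / (n : ℝ) ≤ 1 := (div_le_one (by linarith)).2 hn1
  have hz0 : 0 < 1 / (n : ℝ) := by positivity
  rw [hy] at h2
  have h3 := Real.abs_exp_sub_one_le (x := 1 / (n : ℝ) / 12) (by rw [abs_of_pos] <;> linarith)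
  rw [abs_of_pos (by linarith : 0 < 1 / (n : ℝ) / 12)] at h3
  rw [abs_of_nonneg (by linarith)]
  linarith [(abs_le.1 h3).2]

/-- The normalization splits into the factorial asymptotics and Stirling's ratio; the constants
match because `(12√2/π²)/2 · √(2π) = 12/π^(3/2)`. -/
theorem a_div_eq {n : ℕ} (hn : n ≠ 0) :
    a n / ((12 / Real.pi ^ (3 / 2 : ℝ)) * (12 / (Real.exp 1 * Real.pi ^ 2)) ^ n *
        (n : ℝ) ^ ((n : ℝ) + 1 / 2))
      = 2 * a n / (12 * √2 / Real.pi ^ 2 * (n.factorial * (12 / Real.pi ^ 2) ^ n)) *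
        (Stirling.stirlingSeq n / √Real.pi) := by
  have hpi := Real.pi_pos
  have hn0 : (0 : ℝ) < n := by positivity
  have e1 : Real.pi ^ (3 / 2 : ℝ) = Real.pi * √Real.pi := by
    rw [show (3 / 2 : ℝ) = 1 + 1 / 2 by norm_num, Real.rpow_add hpi, Real.rpow_one, Real.sqrt_eq_rpow]
  have e2 : (n : ℝ) ^ ((n : ℝ) + 1 / 2) = (n : ℝ) ^ n * √n := by
    rw [Real.rpow_add hn0, Real.rpow_natCast, Real.sqrt_eq_rpow]
  have hsp : 0 < √Real.pi := Real.sqrt_pos.2 hpi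
  have hsp2 : √Real.pi ^ 2 = Real.pi := Real.sq_sqrt hpi.le
  have hs2 : √2 ^ 2 = 2 := Real.sq_sqrt (by norm_num)
  have hsn : 0 < √(n : ℝ) := Real.sqrt_pos.2 hn0
  have hs20 : 0 < √2 := by positivity
  have he := Real.exp_pos 1
  rw [e1, e2, Stirling.stirlingSeq, Real.sqrt_mul zero_le_two, div_pow, div_pow, div_pow, mul_pow]
  have hf : (0 : ℝ) < n.factorial := by positivity
  field_simp
  rw [hs2]
  norm_num
  exact Or.inl hsp2

end Fishburn

theorem theorem1 :
    (fun n : ℕ =>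
        Fishburn.a n /
          ((12 / Real.pi ^ (3 / 2 : ℝ)) * (12 / (Real.exp 1 * Real.pi ^ 2)) ^ n *
            (n : ℝ) ^ ((n : ℝ) + 1 / 2)) - 1)
      =O[atTop] (fun n : ℕ => 1 / (n : ℝ)) := by
  obtain ⟨C, hC, h⟩ := Fishburn.exists_abs_two_mul_a_sub_le
  have hpi := Real.pi_pos
  have hK : 0 < 12 * √2 / Real.pi ^ 2 := by positivity
  -- With relative errors `x` and `y` of the two factors the total is `xy + x + y`; since `|y| ≤ 1/n
  -- ≤ 1`, the bound for `x` counts twice and that for `y` once.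
  refine IsBigO.of_bound (C / (12 * √2 / Real.pi ^ 2) * 2 + 1) ?_
  filter_upwards [eventually_ne_atTop 0] with n hn
  rw [Fishburn.a_div_eq hn]
  have hn1 : (1 : ℝ) ≤ n := by exact_mod_cast Nat.one_le_iff_ne_zero.2 hn
  have h2 := Fishburn.abs_stirlingSeq_div_sub_one_le hn
  have h1 := h n hn
  have hg : 0 < (n.factorial : ℝ) * (12 / Real.pi ^ 2) ^ n := by positivity
  obtain ⟨g, hg'⟩ : ∃ g, (n.factorial : ℝ) * (12 / Real.pi ^ 2) ^ n = g := ⟨_, rfl⟩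
  obtain ⟨k, hk⟩ : ∃ k, 12 * √2 / Real.pi ^ 2 = k := ⟨_, rfl⟩
  obtain ⟨r, hr⟩ : ∃ r, Stirling.stirlingSeq n / √Real.pi = r := ⟨_, rfl⟩
  rw [hg', hk] at h1 ⊢
  rw [hr] at h2 ⊢
  rw [hg'] at hg
  rw [hk] at hK
  have h3 : |2 * Fishburn.a n / (k * g) - 1| ≤ C / k * (1 / n) := by
    rw [div_sub_one (by positivity), abs_div, abs_of_pos (mul_pos hK hg), div_le_iff₀ (by positivity)]
    refine h1.trans_eq ?_
    field_simp
  have hz : 1 / (n : ℝ) ≤ 1 := (div_le_one (by linarith)).2 hn1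
  have h4 : |2 * Fishburn.a n / (k * g) - 1| * |r - 1| ≤ C / k * (1 / n) * 1 :=
    mul_le_mul h3 (h2.trans hz) (abs_nonneg _) (by positivity)
  rw [Real.norm_eq_abs, Real.norm_of_nonneg (by positivity),
    show 2 * Fishburn.a n / (k * g) * r - 1 = (2 * Fishburn.a n / (k * g) - 1) * (r - 1)
      + (2 * Fishburn.a n / (k * g) - 1) + (r - 1) by ring]
  refine (abs_add_three _ _ _).trans ?_
  rw [abs_mul]
  linarith
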